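/- Fix $n\in\mathbb N$ and consider a lattice triangle of side-length $n$ (with sides facing Northwest, Northeast and South) in the unit triangular lattice. **Puzzles.** A puzzle of size $n$ is a decomposition of this triangle into lattice polygons, with all edges labeled $0$ or $1$, such that each region is one of the following pieces: a unit triangle with all edges labeled $0$; a unit triangle with all edges labeled $1$; a unit rhombus (two unit triangles joined together) whose outer edges are labeled $1$ if clockwise of an obtuse angle and $0$ if clockwise of an acute angle. The boundary labels of a puzzle are read clockwise along each side. A puzzle $P$ is *rigid* if it is the only puzzle of size $n$ with the boundary labels of $P$. A *region edge* of a puzzle is an edge that separates two pieces of distinct types ($0$-triangle, $1$-triangle, rhombus); it is oriented so that $0$-triangles are on its left and $1$-triangles are on its right. A *gentle path* is a finite list of region edges such that the head of each is the tail of the next and the angle of turn is $0^\circ$ or $60^\circ$, never $120^\circ$. A *gentle loop* is a gentle path with at least two entries whose first and last edges coincide. **Honeycombs.** An $n$-honeycomb assigns to each unit triangle $t$ of the lattice triangle a point $h(t)$ of the plane $\{(a,b,c)\in\mathbb R^3: a+b+c=0\}$ such that, whenever an upside-down unit triangle $d$ and a right-side-up unit triangle $u$ share an edge, $h(u)-h(d)$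 is $\ell\,(-1,1,0)$, $\ell\,(0,-1,1)$ or $\ell\,(1,0,-1)$ for some real $\ell\ge 0$, according to whether the shared edge is parallel to the South, the Northwest or the Northeast side of the lattice triangle. Its boundary coordinates are $(\lambda,\mu,\nu)\in(\mathbb R^n)^3$, where $\lambda_i$ (resp. $\mu_i$, $\nu_i$) is the coordinate $a$ (resp. $b$, $c$) of $h(t)$, with $t$ the unit triangle at the $i$-th edge, read clockwise, of the Northwest (resp. Northeast, South) side. Let $\mathrm{LR}_n\subseteq(\mathbb R^n)^3$ be the set of boundary coordinates of all $n$-honeycombs. For a puzzle $P$ of size $n$ and $(\lambda,\mu,\nu)\in(\mathbb R^n)^3$, let $f_P(\lambda,\mu,\nu)$ be the sum of those $\lambda_i$, $\mu_i$, $\nu_i$ for which the $i$-th edge (read clockwise) of the Northwest, Northeast, South side, respectively, is labeled $0$ in $P$. **Theorem.** Let $n\in\mathbb N$. 1. Every puzzle of size $n$ with no gentle loops is rigid. 2. The rigid puzzles of size $n$ give a complete set of inequalities determining $\mathrm{LR}_n$: a triple $(\lambda,\mu,\nu)\in(\mathbb R^n)^3$ lies in $\mathrm{LR}_n$ if and only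 if $\lambda,\mu,\nu$ are weakly decreasing, $\sum_i\lambda_i+\sum_i\mu_i+\sum_i\nu_i=0$, and $f_P(\lambda,\mu,\nu)\ge 0$ for every rigid puzzle $P$ of size $n$. -/

import Mathlib

open scoped BigOperators

namespace HoneycombPuzzle

/-! ## The triangular lattice

The point `(x, y)` with integer coordinates stands for `x • e₀ + y • e₁`, where `e₀` is the unit
vector pointing East and `e₁` is `e₀` rotated counterclockwise by 60 degrees.  The lattice triangle
of side-length `n` is the set `0 ≤ x`, `0 ≤ y`, `x + y ≤ n`; its sides face South, Northwest and
Northeast. -/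

/-- The three sides of the (right-side-up) lattice triangle, and hence the three directions of
lattice edges. -/
inductive Side
  | south
  | northwest
  | northeast
  deriving DecidableEq

/-- The next side, going clockwise around the lattice triangle. -/
def Side.next : Side → Side
  | .south => .northwest
  | .northwest => .northeast
  | .northeast => .south

/-- A unit lattice edge.  Each one is a side of exactly one right-side-up unit triangle:
`⟨x, y, s⟩` is the side `s` of the triangle with vertices `(x, y)`, `(x + 1, y)`, `(x, y + 1)`. -/
@[ext]
structure Edge where
  x : ℤ
  y : ℤ
  side : Side
  deriving DecidableEq

/-- Unit lattice triangles: `up x y` is the right-side-up triangle with vertices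
`(x, y)`, `(x + 1, y)`, `(x, y + 1)`, and `down x y` is the upside-down triangle with vertices
`(x + 1, y)`, `(x, y + 1)`, `(x + 1, y + 1)`. -/
inductive Tri
  | up (x y : ℤ)
  | down (x y : ℤ)
  deriving DecidableEq

/-- The edge of a unit triangle that is parallel to the side `s` of the lattice triangle. -/
def Tri.edge : Tri → Side → Edge
  | .up x y, s => ⟨x, y, s⟩
  | .down x y, .south => ⟨x, y + 1, .south⟩
  | .down x y, .northwest => ⟨x + 1, y, .northwest⟩
  | .down x y, .northeast => ⟨x, y, .northeast⟩

/-- The unit triangle lies in the lattice triangle of side-length `n`. -/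
def Tri.InTriangle (n : ℕ) : Tri → Prop
  | .up x y => 0 ≤ x ∧ 0 ≤ y ∧ x + y + 1 ≤ n
  | .down x y => 0 ≤ x ∧ 0 ≤ y ∧ x + y + 2 ≤ n

/-- The right-side-up unit triangle adjacent to an edge. -/
def Edge.upTri (e : Edge) : Tri := .up e.x e.y

/-- The upside-down unit triangle adjacent to an edge. -/
def Edge.downTri : Edge → Tri
  | ⟨x, y, .south⟩ => .down x (y - 1)
  | ⟨x, y, .northwest⟩ => .down (x - 1) y
  | ⟨x, y, .northeast⟩ => .down x y

/-! ## Puzzles -/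

/-- Puzzle pieces, placed in the lattice: unit triangles all of whose edges carry the same label
`a`, and unit rhombi, given by the edge along which their two unit triangles are joined. -/
inductive Piece
  | tri (t : Tri) (a : Fin 2)
  | rhombus (diagonal : Edge)
  deriving DecidableEq

/-- The unit triangles that make up a piece. -/
def Piece.tris : Piece → Finset Tri
  | .tri t _ => {t}
  | .rhombus e => {e.upTri, e.downTri}

/-- `p.HasEdge e a`: the edge `e` lies on the boundary of the piece `p`, and `p` labels it `a`.

In a rhombus whose (short) diagonal has direction `s`, the two boundary edges of direction `s.next`
are those that come directly after an obtuse vertex when the boundary is traversed clockwise,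
and get label `1`; the two of direction `s.next.next` come directly after an acute vertex, and get
label `0`. -/
def Piece.HasEdge : Piece → Edge → Fin 2 → Prop
  | .tri t b, e, a => a = b ∧ ∃ s, e = t.edge s
  | .rhombus d, e, a => ∃ t ∈ (Piece.rhombus d).tris,
      (e = t.edge d.side.next ∧ a = 1) ∨ (e = t.edge d.side.next.next ∧ a = 0)

/-- A puzzle of size `n`: a decomposition of the lattice triangle of side-length `n` into puzzle
pieces, such that pieces that share an edge give it the same label. -/
@[ext]
structure Puzzle (n : ℕ) where
  pieces : Finset Piece
  inside : ∀ p ∈ pieces, ∀ t ∈ p.tris, t.InTriangle n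
  cover : ∀ t : Tri, t.InTriangle n → ∃! p : Piece, p ∈ pieces ∧ t ∈ p.tris
  labels_agree : ∀ p ∈ pieces, ∀ q ∈ pieces, ∀ (e : Edge) (a b : Fin 2),
    p.HasEdge e a → q.HasEdge e b → a = b

/-- The `i`-th unit edge on the side `s` of the lattice triangle of side-length `n`, where the
edges on each side are read clockwise: the Northwest side from the bottom left to the top, the
Northeast side from the top to the bottom right, the South side from right to left. -/
def boundaryEdge (n : ℕ) : Side → Fin n → Edge
  | .south, i => ⟨n - 1 - (i : ℕ), 0, .south⟩
  | .northwest, i => ⟨0, (i : ℕ), .northwest⟩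
  | .northeast, i => ⟨(i : ℕ), n - 1 - (i : ℕ), .northeast⟩

/-- The edge `e` is an edge of the puzzle, and carries the label `a`. -/
def Puzzle.HasLabel {n : ℕ} (P : Puzzle n) (e : Edge) (a : Fin 2) : Prop :=
  ∃ p ∈ P.pieces, p.HasEdge e a

/-- Two puzzles of size `n` have the same labels on the boundary. -/
def Puzzle.SameBoundary {n : ℕ} (P Q : Puzzle n) : Prop :=
  ∀ (s : Side) (i : Fin n) (a : Fin 2),
    P.HasLabel (boundaryEdge n s i) a ↔ Q.HasLabel (boundaryEdge n s i) a

/-- A puzzle is rigid if it is determined by its boundary labels. -/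
def Puzzle.IsRigid {n : ℕ} (P : Puzzle n) : Prop :=
  ∀ Q : Puzzle n, P.SameBoundary Q → Q = P

/-! ## Gentle loops -/

/-- The three types of puzzle pieces. -/
inductive Kind
  | zero
  | one
  | rhombus
  deriving DecidableEq

/-- The type of a puzzle piece. -/
def Piece.kind : Piece → Kind
  | .tri _ a => if a = 0 then .zero else .one
  | .rhombus _ => .rhombus

/-- An oriented lattice edge; `ccw` says that the edge is traversed counterclockwise around the
right-side-up triangle of which it is a side. -/
structure Arrow where
  edge : Edge
  ccw : Bool
  deriving DecidableEq

/-- The unit triangle to the left of an oriented edge. -/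
def Arrow.leftTri (a : Arrow) : Tri := if a.ccw then a.edge.upTri else a.edge.downTri

/-- The unit triangle to the right of an oriented edge. -/
def Arrow.rightTri (a : Arrow) : Tri := if a.ccw then a.edge.downTri else a.edge.upTri

/-- The first endpoint of an edge traversed counterclockwise around `e.upTri`. -/
def Edge.source : Edge → ℤ × ℤ
  | ⟨x, y, .south⟩ => (x, y)
  | ⟨x, y, .northeast⟩ => (x + 1, y)
  | ⟨x, y, .northwest⟩ => (x, y + 1)

/-- The second endpoint of an edge traversed counterclockwise around `e.upTri`. -/
def Edge.target : Edge → ℤ × ℤ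
  | ⟨x, y, .south⟩ => (x + 1, y)
  | ⟨x, y, .northeast⟩ => (x, y + 1)
  | ⟨x, y, .northwest⟩ => (x, y)

/-- The tail of an oriented edge. -/
def Arrow.tail (a : Arrow) : ℤ × ℤ := if a.ccw then a.edge.source else a.edge.target

/-- The head of an oriented edge. -/
def Arrow.head (a : Arrow) : ℤ × ℤ := if a.ccw then a.edge.target else a.edge.source

/-- The direction of an oriented edge: `k` stands for the angle `k * 60` degrees, measured
counterclockwise from East. -/
def Arrow.direction (a : Arrow) : ZMod 6 :=
  (match a.edge.side with
    | .south => 0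
    | .northeast => 2
    | .northwest => 4) + (if a.ccw then 0 else 3)

/-- `a` is a region edge of the puzzle, with its orientation: it separates two pieces of distinct
types, and is oriented so that a `0`-triangle can only be on its left and a `1`-triangle can only
be on its right. -/
def Puzzle.IsRegionEdge {n : ℕ} (P : Puzzle n) (a : Arrow) : Prop :=
  ∃ p ∈ P.pieces, ∃ q ∈ P.pieces, a.leftTri ∈ p.tris ∧ a.rightTri ∈ q.tris ∧
    p.kind ≠ q.kind ∧ p.kind ≠ .one ∧ q.kind ≠ .zero

/-- The head of `a` is the tail of `b`, and the angle of turn from `a` to `b` is `0` or `60`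
degrees (to the left or to the right). -/
def GentleStep (a b : Arrow) : Prop :=
  a.head = b.tail ∧ (b.direction = a.direction ∨ b.direction = a.direction + 1 ∨
    b.direction = a.direction - 1)

/-- A gentle path: a finite list of oriented region edges with gentle turns. -/
def Puzzle.IsGentlePath {n : ℕ} (P : Puzzle n) (l : List Arrow) : Prop :=
  (∀ a ∈ l, P.IsRegionEdge a) ∧ l.IsChain GentleStep

/-- The puzzle has a gentle loop: a gentle path whose first and last edges coincide
(with at least one step between them). -/
def Puzzle.HasGentleLoop {n : ℕ} (P : Puzzle n) : Prop :=
  ∃ (a : Arrow) (l : List Arrow), P.IsGentlePath (a :: (l ++ [a]))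

/-! ## Honeycombs -/

/-- An `n`-honeycomb: a configuration of the honeycomb tinkertoy `τ_n` with nonnegative edge
lengths.  The vertices of `τ_n` are the unit triangles `t` in the lattice triangle of side-length
`n`, and `coord t` is the position of the vertex `t` in the plane of triples with zero sum.
Edges that run Northwest–Southeast, Northeast–Southwest and North–South have constant
`northwest`, `northeast` and `south` coordinate, respectively.  For each lattice edge `e` in the
interior of the lattice triangle, an edge of `τ_n` connects the vertex `e.downTri` to the vertex
`e.upTri`; it leaves `e.downTri` towards the North, Southeast, Southwest if `e.side` is `south`,
`northwest`, `northeast`.  So, with `s = e.side`, the coordinate `s` is constant on it, and, `ℓ`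
being its length, the coordinate `s.next` decreases by `ℓ` from `e.downTri` to `e.upTri`, and
`s.next.next` increases by `ℓ`. -/
structure Honeycomb (n : ℕ) where
  coord : {t : Tri // t.InTriangle n} → Side → ℝ
  sum_eq_zero : ∀ t, coord t .northwest + coord t .northeast + coord t .south = 0
  edges : ∀ (e : Edge) (hd : e.downTri.InTriangle n) (hu : e.upTri.InTriangle n),
    ∃ ℓ : ℝ, 0 ≤ ℓ ∧
      coord ⟨e.upTri, hu⟩ e.side = coord ⟨e.downTri, hd⟩ e.side ∧
      coord ⟨e.upTri, hu⟩ e.side.next = coord ⟨e.downTri, hd⟩ e.side.next - ℓ ∧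
      coord ⟨e.upTri, hu⟩ e.side.next.next = coord ⟨e.downTri, hd⟩ e.side.next.next + ℓ

/-- The unit triangle at the `i`-th boundary edge on the side `s`; as a vertex of the honeycomb
tinkertoy, it is the endpoint of the corresponding semiinfinite edge. -/
def boundaryTri (n : ℕ) (s : Side) (i : Fin n) : {t : Tri // t.InTriangle n} :=
  ⟨(boundaryEdge n s i).upTri, by
    have := i.2
    cases s <;> simp [boundaryEdge, Edge.upTri, Tri.InTriangle]
    all_goals omega⟩

/-- The constant coordinate on the `i`-th semiinfinite edge on the side `s`. These edges point
Northwest, Northeast or South, according to `s`. -/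
def Honeycomb.boundary {n : ℕ} (h : Honeycomb n) (s : Side) (i : Fin n) : ℝ :=
  h.coord (boundaryTri n s i) s

/-- The cone `LR_n` of triples `(λ, μ, ν)` of boundary coordinates of `n`-honeycombs. -/
def LR (n : ℕ) : Set ((Fin n → ℝ) × (Fin n → ℝ) × (Fin n → ℝ)) :=
  Set.range fun h : Honeycomb n =>
    (h.boundary .northwest, h.boundary .northeast, h.boundary .south)

open Classical in
/-- The linear functional on triples `(λ, μ, ν)` given by a puzzle: the sum of the boundary
coordinates that correspond to boundary edges of the puzzle labeled `0`. -/
noncomputable def Puzzle.functional {n : ℕ} (P : Puzzle n) (lam mu nu : Fin n → ℝ) : ℝ :=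
  (∑ i, if P.HasLabel (boundaryEdge n .northwest i) 0 then lam i else 0) +
  (∑ i, if P.HasLabel (boundaryEdge n .northeast i) 0 then mu i else 0) +
  (∑ i, if P.HasLabel (boundaryEdge n .south i) 0 then nu i else 0)

end HoneycombPuzzle

namespace HoneycombPuzzle

/-! ## Sums over edges -/

/-! A puzzle is encoded by an edge labeling with values `0`, `1`, `2`, where `2` marks the diagonals
of rhombi. A honeycomb is encoded by its constant coordinates on edges, which may be taken as the
increments of a convex hive on the lattice points. Summation by parts (`sum_boundary_eq`) turns the
boundary functional of a puzzle into the sum of the lengths of its diagonals. Hence every puzzle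
inequality is necessary. The same formula is complementary slackness: if all diagonals of a puzzle
have length zero in some honeycomb, so do the diagonals of any puzzle with the same boundary. If
moreover the edges of length zero form a matching (at most one per unit triangle), then
`labeling_eq_of_matching` shows that the puzzle is rigid.

Sufficiency is proved by duality. Suppose that boundary data `G` bound no convex hive. Move from a
strictly convex quadratic boundary towards `G` as far as convex hives exist, and at the last
parameter choose a hive `h` with the fewest edges of length zero. Stiemke's lemma puts a positive
weight on exactly these edges, balanced at interior points and pairing negatively with `G`
(`exists_dual_weight`). Testing the weight against the dimension of flat cells, a function concave
along flat edges, shows that the edges form a matching (`matching_of_weight`). The balanced weight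
integrates to edge values `y`. Each threshold of `y` is a puzzle whose diagonals are flat in `h`,
hence a rigid one, and by the layer-cake formula their functionals cannot all be nonnegative on `G`.

For the first claim, let `P` have no gentle loops and let `Q` have the same boundary. Counting
gentle paths from a region edge to the boundary gives a finite positive weight, balanced by the
local law `predecessors`. Paired with the difference of the deflations of `Q` and `P` (the maps that
collapse the `1`-labeled edges), it yields zero on one hand, and minus the weighted number of region
edges of `P` that are diagonals of `Q` on the other. So no region edge of `P` is a diagonal of `Q`.
Away from the region edges, the hive that overlays the two deflations of `P` has nonnegative
lengths, vanishing exactly at the diagonals of `P`. Slackness then puts the diagonals of `Q` among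
those of `P`, and the matching argument gives `Q = P`. -/

instance : Fintype Side := ⟨{.south, .northwest, .northeast}, fun s => by cases s <;> simp⟩

theorem sum_side {M : Type*} [AddCommMonoid M] (f : Side → M) :
    ∑ s, f s = f .south + f .northwest + f .northeast := by
  have : (Finset.univ : Finset Side) = {.south, .northwest, .northeast} := rfl
  rw [this, Finset.sum_insert (by simp), Finset.sum_insert (by simp), Finset.sum_singleton,
    add_assoc]

/-- Positions of the right-side-up unit triangles. -/
noncomputable def upIndex (n : ℕ) : Finset (ℤ × ℤ) :=
  ((Finset.Icc (0 : ℤ) n) ×ˢ (Finset.Icc (0 : ℤ) n)).filter fun p => p.1 + p.2 + 1 ≤ n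

/-- Positions of the upside-down unit triangles. -/
noncomputable def downIndex (n : ℕ) : Finset (ℤ × ℤ) :=
  ((Finset.Icc (0 : ℤ) n) ×ˢ (Finset.Icc (0 : ℤ) n)).filter fun p => p.1 + p.2 + 2 ≤ n

theorem mem_upIndex {n : ℕ} {p : ℤ × ℤ} :
    p ∈ upIndex n ↔ 0 ≤ p.1 ∧ 0 ≤ p.2 ∧ p.1 + p.2 + 1 ≤ n := by
  simp only [upIndex, Finset.mem_filter, Finset.mem_product, Finset.mem_Icc]; omega

theorem mem_downIndex {n : ℕ} {p : ℤ × ℤ} :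
    p ∈ downIndex n ↔ 0 ≤ p.1 ∧ 0 ≤ p.2 ∧ p.1 + p.2 + 2 ≤ n := by
  simp only [downIndex, Finset.mem_filter, Finset.mem_product, Finset.mem_Icc]; omega

/-- For one edge direction: the side of an up triangle is either shared with the down triangle at
offset `-a`, or it is one of the boundary edges `b i`. -/
theorem sum_upIndex_eq {n : ℕ} (F : ℤ × ℤ → ℝ) (a : ℤ × ℤ) (b : Fin n → ℤ × ℤ)
    (ha : ∀ p ∈ downIndex n, p + a ∈ upIndex n) (hb : ∀ i, b i ∈ upIndex n)
    (hinj : Function.Injective b) (hdisj : ∀ i, b i - a ∉ downIndex n)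
    (hcov : ∀ p ∈ upIndex n, p - a ∈ downIndex n ∨ ∃ i, p = b i) :
    ∑ p ∈ upIndex n, F p = ∑ p ∈ downIndex n, F (p + a) + ∑ i, F (b i) := by
  classical
  have h : upIndex n = (downIndex n).image (· + a) ∪ Finset.univ.image b := by
    ext p
    simp only [Finset.mem_union, Finset.mem_image, Finset.mem_univ, true_and]
    constructor
    · intro hp
      rcases hcov p hp with h | ⟨i, h⟩
      · exact Or.inl ⟨_, h, by simp⟩
      · exact Or.inr ⟨i, h.symm⟩
    · rintro (⟨q, hq, rfl⟩ | ⟨i, rfl⟩)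
      · exact ha q hq
      · exact hb i
  rw [h, Finset.sum_union, Finset.sum_image (by intro x _ y _ h; simpa using h),
    Finset.sum_image (by intro x _ y _ h; exact hinj h)]
  rw [Finset.disjoint_left]
  simp only [Finset.mem_image, Finset.mem_univ, true_and, not_exists, forall_exists_index, and_imp]
  rintro p q hq rfl i h
  exact hdisj i (by rw [h]; simpa using hq)

/-- Every edge belongs to exactly one up triangle, and every inner edge to exactly one down
triangle. This is the discrete divergence theorem behind Green's formula. -/
theorem sum_up_eq_sum_down_add {n : ℕ} (f : Edge → ℝ) :
    ∑ p ∈ upIndex n, ∑ s, f ((Tri.up p.1 p.2).edge s) =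
      ∑ p ∈ downIndex n, ∑ s, f ((Tri.down p.1 p.2).edge s) +
        ∑ s, ∑ i, f (boundaryEdge n s i) := by
  simp only [sum_side, Finset.sum_add_distrib]
  have h1 := sum_upIndex_eq (n := n) (fun p => f ⟨p.1, p.2, .south⟩) (0, 1)
    (fun i => (n - 1 - (i : ℕ), 0))
    (by intro p; simp only [mem_upIndex, mem_downIndex, Prod.fst_add, Prod.snd_add]; omega)
    (by intro i; have := i.2; simp only [mem_upIndex]; omega)
    (by intro i j h; simp only [Prod.mk.injEq] at h; ext; omega)
    (by intro i; simp only [mem_downIndex, Prod.fst_sub, Prod.snd_sub]; omega)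
    (by
      rintro ⟨x, y⟩
      simp only [mem_upIndex, mem_downIndex, Prod.fst_sub, Prod.snd_sub, Prod.mk.injEq]
      intro h
      by_cases hy : 1 ≤ y
      · left; omega
      · right; exact ⟨⟨(n - 1 - x).toNat, by omega⟩, by simp; omega⟩)
  have h2 := sum_upIndex_eq (n := n) (fun p => f ⟨p.1, p.2, .northwest⟩) (1, 0)
    (fun i => (0, (i : ℕ)))
    (by intro p; simp only [mem_upIndex, mem_downIndex, Prod.fst_add, Prod.snd_add]; omega)
    (by intro i; have := i.2; simp only [mem_upIndex]; omega)
    (by intro i j h; simp only [Prod.mk.injEq] at h; ext; omega)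
    (by intro i; simp only [mem_downIndex, Prod.fst_sub, Prod.snd_sub]; omega)
    (by
      rintro ⟨x, y⟩
      simp only [mem_upIndex, mem_downIndex, Prod.fst_sub, Prod.snd_sub, Prod.mk.injEq]
      intro h
      by_cases hy : 1 ≤ x
      · left; omega
      · right; exact ⟨⟨y.toNat, by omega⟩, by simp; omega⟩)
  have h3 := sum_upIndex_eq (n := n) (fun p => f ⟨p.1, p.2, .northeast⟩) (0, 0)
    (fun i => ((i : ℕ), n - 1 - (i : ℕ)))
    (by intro p; simp only [mem_upIndex, mem_downIndex, Prod.fst_add, Prod.snd_add]; omega)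
    (by intro i; have := i.2; simp only [mem_upIndex]; omega)
    (by intro i j h; simp only [Prod.mk.injEq] at h; ext; omega)
    (by intro i; simp only [mem_downIndex, Prod.fst_sub, Prod.snd_sub]; omega)
    (by
      rintro ⟨x, y⟩
      simp only [mem_upIndex, mem_downIndex, Prod.fst_sub, Prod.snd_sub, Prod.mk.injEq]
      intro h
      by_cases hy : x + y + 2 ≤ n
      · left; omega
      · right; exact ⟨⟨x.toNat, by omega⟩, by simp; omega⟩)
  simp only [Prod.fst_add, Prod.snd_add, add_zero] at h1 h2 h3
  simp only [Tri.edge, boundaryEdge]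
  linarith

/-! ## Virtual honeycombs -/

/-- The edge `e` is a side of a unit triangle of the lattice triangle. -/
def Edge.InTriangle (n : ℕ) (e : Edge) : Prop := e.upTri.InTriangle n

/-- The edge `e` separates two unit triangles of the lattice triangle. -/
def Edge.IsInner (n : ℕ) (e : Edge) : Prop := e.downTri.InTriangle n

theorem Edge.IsInner.inTriangle {n : ℕ} {e : Edge} (h : e.IsInner n) : e.InTriangle n := by
  obtain ⟨x, y, s⟩ := e
  cases s <;> simp only [Edge.IsInner, Edge.InTriangle, Edge.downTri, Edge.upTri,
    Tri.InTriangle] at * <;> omega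

@[simp] theorem upTri_edge (e : Edge) : e.upTri.edge e.side = e := rfl

@[simp] theorem downTri_edge (e : Edge) : e.downTri.edge e.side = e := by
  obtain ⟨x, y, s⟩ := e
  cases s <;> simp [Edge.downTri, Tri.edge]

@[simp] theorem edge_side (t : Tri) (s : Side) : (t.edge s).side = s := by
  cases t <;> cases s <;> rfl

@[simp] theorem up_edge_upTri (x y : ℤ) (s : Side) : ((Tri.up x y).edge s).upTri = .up x y := rfl

@[simp] theorem down_edge_downTri (x y : ℤ) (s : Side) :
    ((Tri.down x y).edge s).downTri = .down x y := by
  cases s <;> simp [Edge.downTri, Tri.edge]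

theorem Tri.InTriangle.edge {n : ℕ} {t : Tri} (h : t.InTriangle n) (s : Side) :
    (t.edge s).InTriangle n := by
  cases t with
  | up x y => exact h
  | down x y => exact Edge.IsInner.inTriangle (by rwa [Edge.IsInner, down_edge_downTri])

theorem eq_upTri_or_eq_downTri (t : Tri) (s : Side) :
    t = (t.edge s).upTri ∨ t = (t.edge s).downTri := by
  cases t with
  | up x y => left; rfl
  | down x y => right; rw [down_edge_downTri]

theorem not_isInner_boundaryEdge (n : ℕ) (s : Side) (i : Fin n) :
    ¬ (boundaryEdge n s i).IsInner n := by
  have := i.2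
  cases s <;> simp [boundaryEdge, Edge.IsInner, Edge.downTri, Tri.InTriangle]
  omega

theorem inTriangle_boundaryEdge (n : ℕ) (s : Side) (i : Fin n) :
    (boundaryEdge n s i).InTriangle n := (boundaryTri n s i).2

/-- The length of an edge of a virtual honeycomb. -/
def len (κ : Edge → ℝ) (e : Edge) : ℝ :=
  κ (e.upTri.edge e.side.next.next) - κ (e.downTri.edge e.side.next.next)

@[simp] theorem next_next_next (s : Side) : s.next.next.next = s := by cases s <;> rfl

theorem sum_side_cycle (s : Side) (f : Side → ℝ) :
    ∑ s, f s = f s + f s.next + f s.next.next := by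
  rw [sum_side]; cases s <;> simp only [Side.next] <;> ring

/-- Green's formula for a weighted family of rhombi. -/
theorem sum_boundary_eq {n : ℕ} {κ y w : Edge → ℝ}
    (hκ : ∀ t : Tri, t.InTriangle n → ∑ s, κ (t.edge s) = 0)
    (hy : ∀ t : Tri, t.InTriangle n → ∃ C, ∀ s,
      y (t.edge s) = C + (w (t.edge s.next) - w (t.edge s.next.next)) / 2)
    (hw : ∀ s i, w (boundaryEdge n s i) = 0) :
    ∑ s, ∑ i, y (boundaryEdge n s i) * κ (boundaryEdge n s i) =
      ∑ p ∈ downIndex n, ∑ s, w ((Tri.down p.1 p.2).edge s) *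
        len κ ((Tri.down p.1 p.2).edge s) := by
  -- Summation by parts inside one triangle: the constant `C` drops out because `κ` sums to zero,
  -- and a cyclic shift moves the difference from `w` to `κ`.
  have key : ∀ t : Tri, t.InTriangle n → ∑ s, y (t.edge s) * κ (t.edge s) =
      ∑ s, w (t.edge s) * ((κ (t.edge s.next.next) - κ (t.edge s.next)) / 2) := by
    intro t ht
    obtain ⟨C, hC⟩ := hy t ht
    have := hκ t ht
    simp only [sum_side, hC, Side.next] at this ⊢
    linear_combination C * this
  have h1 := sum_up_eq_sum_down_add (n := n) (fun e => y e * κ e)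
  have h2 := sum_up_eq_sum_down_add (n := n)
    (fun e => w e * ((κ (e.upTri.edge e.side.next.next) - κ (e.upTri.edge e.side.next)) / 2))
  simp only [hw, zero_mul, Finset.sum_const_zero, add_zero] at h2
  simp only [edge_side, up_edge_upTri] at h2
  have h3 : ∀ p ∈ upIndex n, _ := fun p hp => key (Tri.up p.1 p.2) (mem_upIndex.1 hp)
  have h4 : ∀ p ∈ downIndex n, _ := fun p hp => key (Tri.down p.1 p.2) (mem_downIndex.1 hp)
  rw [Finset.sum_congr rfl h3, Finset.sum_congr rfl h4, h2] at h1
  rw [eq_sub_of_add_eq' h1.symm, ← Finset.sum_sub_distrib]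
  refine Finset.sum_congr rfl fun p hp => ?_
  rw [← Finset.sum_sub_distrib]
  refine Finset.sum_congr rfl fun s _ => ?_
  have hd : (Tri.down p.1 p.2).InTriangle n := mem_downIndex.1 hp
  have e1 := hκ _ hd
  have e2 := hκ ((Tri.down p.1 p.2).edge s).upTri (hd.edge s)
  rw [sum_side_cycle s] at e1 e2
  have e3 : ((Tri.down p.1 p.2).edge s).upTri.edge s = (Tri.down p.1 p.2).edge s := by
    conv_rhs => rw [← upTri_edge ((Tri.down p.1 p.2).edge s)]
    rw [edge_side]
  rw [e3] at e2
  simp only [len, edge_side, down_edge_downTri]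
  -- Both triangle sums vanish and `κ` on the shared edge is common, so the jump of the
  -- half-difference across the edge is its length.
  linear_combination (w ((Tri.down p.1 p.2).edge s)/2) * (e1 - e2)

/-! ## Puzzles as edge labelings -/

/-- The labels of the edges of the unit triangle `t` fit a puzzle piece; the label `2` marks the
diagonals of rhombi. -/
def Fits (c : Edge → Fin 3) (t : Tri) : Prop :=
  (∀ s, c (t.edge s) = 0) ∨ (∀ s, c (t.edge s) = 1) ∨
    ∃ s, c (t.edge s) = 2 ∧ c (t.edge s.next) = 1 ∧ c (t.edge s.next.next) = 0

theorem castSucc_ne_two : ∀ a : Fin 2, a.castSucc ≠ (2 : Fin 3) := by decide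

/-- An edge labeling that describes a puzzle of size `n`. -/
structure IsLabeling (n : ℕ) (c : Edge → Fin 3) : Prop where
  fits : ∀ t : Tri, t.InTriangle n → Fits c t
  boundary : ∀ s i, c (boundaryEdge n s i) ≠ 2

theorem Side.eq_or (s r : Side) : r = s ∨ r = s.next ∨ r = s.next.next := by
  cases s <;> cases r <;> simp [Side.next]

theorem Fits.of_eq_two {c : Edge → Fin 3} {t : Tri} (h : Fits c t) {s : Side}
    (hs : c (t.edge s) = 2) : c (t.edge s.next) = 1 ∧ c (t.edge s.next.next) = 0 := by
  rcases h with h | h | ⟨r, h1, h2, h3⟩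
  · simp [h] at hs
  · simp [h] at hs
  · rcases Side.eq_or r s with rfl | rfl | rfl
    · exact ⟨h2, h3⟩
    · simp [hs] at h2
    · simp [hs] at h3

theorem Edge.isInner_or_boundary {n : ℕ} {e : Edge} (h : e.InTriangle n) :
    e.IsInner n ∨ ∃ i, e = boundaryEdge n e.side i := by
  obtain ⟨x, y, s⟩ := e
  cases s <;> simp only [Edge.InTriangle, Edge.IsInner, Edge.upTri, Edge.downTri, Tri.InTriangle,
    boundaryEdge] at *
  · by_cases hy : 1 ≤ y
    · left; omega
    · right; exact ⟨⟨(n - 1 - x).toNat, by omega⟩, by ext <;> simp <;> omega⟩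
  · by_cases hy : 1 ≤ x
    · left; omega
    · right; exact ⟨⟨y.toNat, by omega⟩, by ext <;> simp <;> omega⟩
  · by_cases hy : x + y + 2 ≤ n
    · left; omega
    · right; exact ⟨⟨x.toNat, by omega⟩, by ext <;> simp <;> omega⟩

theorem IsLabeling.isInner {n : ℕ} {c : Edge → Fin 3} (hc : IsLabeling n c) {e : Edge}
    (he : e.InTriangle n) (h : c e = 2) : e.IsInner n := by
  rcases Edge.isInner_or_boundary he with h' | ⟨i, h'⟩
  · exact h'
  · rw [h'] at h; exact absurd h (hc.boundary _ _)

theorem mem_tris_rhombus {d : Edge} {t : Tri} :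
    t ∈ (Piece.rhombus d).tris ↔ t.edge d.side = d := by
  simp only [Piece.tris, Finset.mem_insert, Finset.mem_singleton]
  constructor
  · rintro (rfl | rfl) <;> simp
  · intro h
    rcases eq_upTri_or_eq_downTri t d.side with h' | h' <;> rw [h] at h'
    · exact Or.inl h'
    · exact Or.inr h'

/-! ### The edge labeling of a puzzle -/

namespace Puzzle
variable {n : ℕ} (P : Puzzle n)

open Classical in
/-- The labels of a puzzle, with `2` for the diagonals of rhombi. -/
noncomputable def label (e : Edge) : Fin 3 :=
  if Piece.rhombus e ∈ P.pieces then 2 else if P.HasLabel e 0 then 0 else 1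

theorem piece_unique {t : Tri} (ht : t.InTriangle n) {p q : Piece} (hp : p ∈ P.pieces)
    (hq : q ∈ P.pieces) (htp : t ∈ p.tris) (htq : t ∈ q.tris) : p = q :=
  (P.cover t ht).unique ⟨hp, htp⟩ ⟨hq, htq⟩

theorem hasLabel_unique {e : Edge} {a b : Fin 2} (ha : P.HasLabel e a) (hb : P.HasLabel e b) :
    a = b := by
  obtain ⟨p, hp, ha⟩ := ha
  obtain ⟨q, hq, hb⟩ := hb
  exact P.labels_agree p hp q hq e a b ha hb

theorem label_of_hasLabel {e : Edge} {a : Fin 2} (ha : P.HasLabel e a)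
    (hr : Piece.rhombus e ∉ P.pieces) : P.label e = a.castSucc := by
  unfold label
  rw [if_neg hr]
  split_ifs with h
  · rw [P.hasLabel_unique ha h]; rfl
  · have : a = 1 := by
      by_contra h'
      have : a = 0 := by omega
      exact h (this ▸ ha)
    rw [this]; rfl

theorem label_rhombus {e : Edge} (hr : Piece.rhombus e ∈ P.pieces) : P.label e = 2 := by
  rw [label, if_pos hr]

theorem label_eq_two {e : Edge} : P.label e = 2 ↔ Piece.rhombus e ∈ P.pieces := by
  refine ⟨fun h => ?_, P.label_rhombus⟩
  unfold label at h
  split_ifs at h with h1 h2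
  · exact h1
  · exact absurd h (by decide)
  · exact absurd h (by decide)

theorem label_of_tri {t : Tri} {a : Fin 2} (hp : Piece.tri t a ∈ P.pieces) (s : Side) :
    P.label (t.edge s) = a.castSucc := by
  have ht : t.InTriangle n := P.inside _ hp t (by simp [Piece.tris])
  apply P.label_of_hasLabel ⟨_, hp, rfl, s, rfl⟩
  intro hr
  have := P.piece_unique ht hp hr (by simp [Piece.tris]) (by rw [mem_tris_rhombus, edge_side])
  simp at this

theorem label_of_rhombus {d : Edge} (hp : Piece.rhombus d ∈ P.pieces) {t : Tri}
    (ht : t ∈ (Piece.rhombus d).tris) :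
    P.label (t.edge d.side) = 2 ∧ P.label (t.edge d.side.next) = 1 ∧
      P.label (t.edge d.side.next.next) = 0 := by
  have htn := P.inside _ hp t ht
  have key : ∀ s, s ≠ d.side → Piece.rhombus (t.edge s) ∉ P.pieces := by
    intro s hs hr
    have := P.piece_unique htn hp hr ht (by rw [mem_tris_rhombus, edge_side])
    rw [Piece.rhombus.injEq] at this
    apply hs
    rw [this, edge_side]
  refine ⟨?_, ?_, ?_⟩
  · rw [mem_tris_rhombus.1 ht]; exact P.label_rhombus hp
  · exact P.label_of_hasLabel (a := 1) ⟨_, hp, t, ht, Or.inl ⟨rfl, rfl⟩⟩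
      (key _ (by cases d.side <;> simp [Side.next]))
  · exact P.label_of_hasLabel (a := 0) ⟨_, hp, t, ht, Or.inr ⟨rfl, rfl⟩⟩
      (key _ (by cases d.side <;> simp [Side.next]))

theorem isLabeling : IsLabeling n P.label where
  fits t ht := by
    obtain ⟨p, ⟨hp, htp⟩, -⟩ := P.cover t ht
    cases p with
    | tri t' a =>
      obtain rfl : t = t' := by simpa [Piece.tris] using htp
      have := P.label_of_tri hp
      fin_cases a
      · exact Or.inl this
      · exact Or.inr (Or.inl this)
    | rhombus d => exact Or.inr (Or.inr ⟨_, P.label_of_rhombus hp htp⟩)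
  boundary s i h := by
    rw [label_eq_two] at h
    exact not_isInner_boundaryEdge n s i (P.inside _ h _ (by simp [Piece.tris]))

theorem label_of_hasEdge {p : Piece} (hp : p ∈ P.pieces) {e : Edge} {a : Fin 2}
    (h : p.HasEdge e a) : P.label e = a.castSucc := by
  cases p with
  | tri t b =>
    obtain ⟨rfl, s, rfl⟩ := h
    exact P.label_of_tri hp s
  | rhombus d =>
    obtain ⟨t, ht, ⟨rfl, rfl⟩ | ⟨rfl, rfl⟩⟩ := h
    · exact (P.label_of_rhombus hp ht).2.1
    · exact (P.label_of_rhombus hp ht).2.2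

theorem hasLabel_iff {e : Edge} (he : e.InTriangle n) {a : Fin 2} :
    P.HasLabel e a ↔ P.label e = a.castSucc := by
  refine ⟨fun ⟨p, hp, h⟩ => P.label_of_hasEdge hp h, fun h => ?_⟩
  obtain ⟨p, ⟨hp, htp⟩, -⟩ := P.cover e.upTri he
  cases p with
  | tri t' b =>
    have ht : e.upTri = t' := by simpa [Piece.tris] using htp
    have h1 : Piece.HasEdge (.tri t' b) e b := ⟨rfl, e.side, by rw [← ht, upTri_edge]⟩
    have h2 := P.label_of_hasEdge hp h1
    rw [h] at h2
    rw [Fin.castSucc_injective _ h2]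
    exact ⟨_, hp, h1⟩
  | rhombus d =>
    have h3 := P.label_of_rhombus hp htp
    rcases Side.eq_or d.side e.side with hs | hs | hs
    · rw [← hs, upTri_edge, h] at h3
      exact absurd h3.1 (castSucc_ne_two a)
    · have h1 : Piece.HasEdge (.rhombus d) e 1 :=
        ⟨e.upTri, htp, Or.inl ⟨by rw [← hs, upTri_edge], rfl⟩⟩
      have h2 := P.label_of_hasEdge hp h1
      rw [h] at h2
      rw [Fin.castSucc_injective _ h2]
      exact ⟨_, hp, h1⟩
    · have h1 : Piece.HasEdge (.rhombus d) e 0 :=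
        ⟨e.upTri, htp, Or.inr ⟨by rw [← hs, upTri_edge], rfl⟩⟩
      have h2 := P.label_of_hasEdge hp h1
      rw [h] at h2
      rw [Fin.castSucc_injective _ h2]
      exact ⟨_, hp, h1⟩

theorem tri_mem_iff {t : Tri} (ht : t.InTriangle n) {a : Fin 2} :
    Piece.tri t a ∈ P.pieces ↔ ∀ s, P.label (t.edge s) = a.castSucc := by
  refine ⟨fun h => P.label_of_tri h, fun h => ?_⟩
  obtain ⟨p, ⟨hp, htp⟩, -⟩ := P.cover t ht
  cases p with
  | tri t' b =>
    obtain rfl : t = t' := by simpa [Piece.tris] using htp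
    have h2 := P.label_of_tri hp .south
    rw [h] at h2
    rwa [Fin.castSucc_injective _ h2]
  | rhombus d =>
    have := (P.label_of_rhombus hp htp).1
    rw [h] at this
    exact absurd this (castSucc_ne_two a)

theorem ext_of_label {P Q : Puzzle n}
    (h : ∀ e : Edge, e.InTriangle n → P.label e = Q.label e) : P = Q := by
  ext p
  cases p with
  | tri t a =>
    by_cases ht : t.InTriangle n
    · rw [P.tri_mem_iff ht, Q.tri_mem_iff ht]
      exact forall_congr' fun s => by rw [h _ (ht.edge s)]
    · exact iff_of_false (fun h => ht (P.inside _ h t (by simp [Piece.tris])))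
        (fun h => ht (Q.inside _ h t (by simp [Piece.tris])))
  | rhombus d =>
    by_cases hd : d.InTriangle n
    · rw [← label_eq_two, ← label_eq_two, h _ hd]
    · exact iff_of_false (fun h => hd (P.inside _ h _ (by simp [Piece.tris])))
        (fun h => hd (Q.inside _ h _ (by simp [Piece.tris])))

theorem SameBoundary.label_eq {P Q : Puzzle n} (h : P.SameBoundary Q) (s : Side) (i : Fin n) :
    P.label (boundaryEdge n s i) = Q.label (boundaryEdge n s i) := by
  have he := inTriangle_boundaryEdge n s i
  have h1 := P.isLabeling.boundary s i
  have h0 := h s i 0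
  have h2 := h s i 1
  rw [P.hasLabel_iff he, Q.hasLabel_iff he] at h0 h2
  have h3 := Q.isLabeling.boundary s i
  revert h0 h1 h2 h3
  generalize P.label _ = a
  generalize Q.label _ = b
  revert a b
  decide

end Puzzle

/-! ### The puzzle of an edge labeling -/

/-- Unit triangles of the lattice triangle. -/
noncomputable def allTris (n : ℕ) : Finset Tri :=
  (upIndex n).image (fun p => .up p.1 p.2) ∪ (downIndex n).image (fun p => .down p.1 p.2)

theorem mem_allTris {n : ℕ} {t : Tri} : t ∈ allTris n ↔ t.InTriangle n := by
  cases t <;> simp [allTris, mem_upIndex, mem_downIndex, Tri.InTriangle]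

open Classical in
/-- The pieces of the puzzle described by an edge labeling. -/
noncomputable def labelingPieces (n : ℕ) (c : Edge → Fin 3) : Finset Piece :=
  ((allTris n).filter fun t => ∀ s, c (t.edge s) = 0).image (Piece.tri · 0) ∪
  ((allTris n).filter fun t => ∀ s, c (t.edge s) = 1).image (Piece.tri · 1) ∪
  (((allTris n) ×ˢ (Finset.univ : Finset Side)).filter fun p => c (p.1.edge p.2) = 2).image
    (fun p => Piece.rhombus (p.1.edge p.2))

theorem tri_mem_labelingPieces {n : ℕ} {c : Edge → Fin 3} {t : Tri} {a : Fin 2} :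
    Piece.tri t a ∈ labelingPieces n c ↔ t.InTriangle n ∧ ∀ s, c (t.edge s) = a.castSucc := by
  have : a = 0 ∨ a = 1 := by omega
  rcases this with rfl | rfl <;> simp [labelingPieces, mem_allTris]

theorem rhombus_mem_labelingPieces {n : ℕ} {c : Edge → Fin 3} {e : Edge} :
    Piece.rhombus e ∈ labelingPieces n c ↔ e.InTriangle n ∧ c e = 2 := by
  simp only [labelingPieces, Finset.mem_union, Finset.mem_image, Finset.mem_filter,
    reduceCtorEq, and_false, exists_false, false_or, Finset.mem_product, Finset.mem_univ,
    and_true, mem_allTris, Piece.rhombus.injEq, Prod.exists]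
  constructor
  · rintro ⟨t, s, ⟨ht, hc⟩, rfl⟩
    exact ⟨ht.edge s, hc⟩
  · rintro ⟨he, hc⟩
    exact ⟨e.upTri, e.side, ⟨he, by simpa using hc⟩, by simp⟩

theorem labelingPieces_hasEdge {n : ℕ} {c : Edge → Fin 3} (hc : IsLabeling n c) {p : Piece}
    (hp : p ∈ labelingPieces n c) {e : Edge} {a : Fin 2} (h : p.HasEdge e a) :
    c e = a.castSucc := by
  cases p with
  | tri t b =>
    obtain ⟨rfl, s, rfl⟩ := h
    exact (tri_mem_labelingPieces.1 hp).2 s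
  | rhombus d =>
    obtain ⟨hd, h2⟩ := rhombus_mem_labelingPieces.1 hp
    obtain ⟨t, ht, h⟩ := h
    have htn : t.InTriangle n := by
      simp only [Piece.tris, Finset.mem_insert, Finset.mem_singleton] at ht
      rcases ht with rfl | rfl
      · exact hd
      · exact hc.isInner hd h2
    have := (hc.fits t htn).of_eq_two (by rw [mem_tris_rhombus.1 ht]; exact h2)
    rcases h with ⟨rfl, rfl⟩ | ⟨rfl, rfl⟩
    · exact this.1
    · exact this.2

/-- The puzzle described by an edge labeling. -/
noncomputable def IsLabeling.puzzle {n : ℕ} {c : Edge → Fin 3} (hc : IsLabeling n c) :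
    Puzzle n where
  pieces := labelingPieces n c
  inside p hp t ht := by
    cases p with
    | tri t' a =>
      obtain rfl : t = t' := by simpa [Piece.tris] using ht
      exact (tri_mem_labelingPieces.1 hp).1
    | rhombus d =>
      obtain ⟨hd, h2⟩ := rhombus_mem_labelingPieces.1 hp
      simp only [Piece.tris, Finset.mem_insert, Finset.mem_singleton] at ht
      rcases ht with rfl | rfl
      · exact hd
      · exact hc.isInner hd h2
  cover t ht := by
    have hr : ∀ d, Piece.rhombus d ∈ labelingPieces n c ∧ t ∈ (Piece.rhombus d).tris →
        c (t.edge d.side) = 2 := by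
      rintro d ⟨h, h'⟩
      rw [mem_tris_rhombus.1 h']
      exact (rhombus_mem_labelingPieces.1 h).2
    rcases hc.fits t ht with h | h | ⟨s, h⟩
    · refine ⟨.tri t 0, ⟨tri_mem_labelingPieces.2 ⟨ht, h⟩, by simp [Piece.tris]⟩, ?_⟩
      rintro (⟨t', a⟩ | d) hp
      · obtain rfl : t = t' := by simpa [Piece.tris] using hp.2
        have := (tri_mem_labelingPieces.1 hp.1).2 .south
        rw [h] at this
        congr 1
        exact (Fin.castSucc_injective _ (Eq.trans (by rfl) this)).symm
      · have := hr d hp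
        simp [h] at this
    · refine ⟨.tri t 1, ⟨tri_mem_labelingPieces.2 ⟨ht, h⟩, by simp [Piece.tris]⟩, ?_⟩
      rintro (⟨t', a⟩ | d) hp
      · obtain rfl : t = t' := by simpa [Piece.tris] using hp.2
        have := (tri_mem_labelingPieces.1 hp.1).2 .south
        rw [h] at this
        congr 1
        exact (Fin.castSucc_injective _ (Eq.trans (by rfl) this)).symm
      · have := hr d hp
        simp [h] at this
    · refine ⟨.rhombus (t.edge s), ⟨rhombus_mem_labelingPieces.2 ⟨ht.edge s, h.1⟩,
        by rw [mem_tris_rhombus, edge_side]⟩, ?_⟩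
      rintro (⟨t', a⟩ | d) hp
      · obtain rfl : t = t' := by simpa [Piece.tris] using hp.2
        have := (tri_mem_labelingPieces.1 hp.1).2 s
        rw [h.1] at this
        exact absurd this.symm (castSucc_ne_two a)
      · have h2 := hr d hp
        rcases Side.eq_or s d.side with h3 | h3 | h3
        · rw [← h3, mem_tris_rhombus.1 hp.2]
        · rw [h3, h.2.1] at h2; simp at h2
        · rw [h3, h.2.2] at h2; simp at h2
  labels_agree p hp q hq e a b ha hb :=
    Fin.castSucc_injective _
      ((labelingPieces_hasEdge hc hp ha).symm.trans (labelingPieces_hasEdge hc hq hb))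

theorem IsLabeling.label_puzzle {n : ℕ} {c : Edge → Fin 3} (hc : IsLabeling n c) {e : Edge}
    (he : e.InTriangle n) : hc.puzzle.label e = c e := by
  have h2 : hc.puzzle.label e = 2 ↔ c e = 2 := by
    rw [Puzzle.label_eq_two]
    exact rhombus_mem_labelingPieces.trans (and_iff_right he)
  have h3 : ∀ a : Fin 2, hc.puzzle.label e = a.castSucc → c e = a.castSucc := by
    intro a ha
    obtain ⟨p, hp, h⟩ := (hc.puzzle.hasLabel_iff he).2 ha
    exact labelingPieces_hasEdge hc hp h
  have h0 := h3 0
  have h1 := h3 1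
  revert h0 h1 h2
  generalize hc.puzzle.label e = a
  generalize c e = b
  revert a b
  decide

/-! ## The functional of a puzzle -/

/-- The weights of a labeling in Green's formula. -/
noncomputable def labelValue (a : Fin 3) : ℝ := ![1, 0, 1 / 2] a

/-- The diagonal gets the mean `1 / 2` of the values of the labels `0` and `1`. With `w` the
indicator of the diagonals, every kind of piece then satisfies the hypothesis of `sum_boundary_eq`.
-/
theorem Fits.labelValue {c : Edge → Fin 3} {t : Tri} (h : Fits c t) : ∃ C : ℝ, ∀ s,
    labelValue (c (t.edge s)) = C + ((if c (t.edge s.next) = 2 then 1 else 0) -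
      (if c (t.edge s.next.next) = 2 then 1 else 0)) / 2 := by
  rcases h with h | h | ⟨s, h1, h2, h3⟩
  · exact ⟨1, fun s => by simp [h, HoneycombPuzzle.labelValue]⟩
  · exact ⟨0, fun s => by simp [h, HoneycombPuzzle.labelValue]⟩
  · refine ⟨1 / 2, fun r => ?_⟩
    rcases Side.eq_or s r with rfl | rfl | rfl <;>
      simp [h1, h2, h3, HoneycombPuzzle.labelValue] <;> norm_num

/-- Green's formula for a puzzle. -/
theorem IsLabeling.sum_boundary {n : ℕ} {c : Edge → Fin 3} (hc : IsLabeling n c)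
    {κ : Edge → ℝ} (hκ : ∀ t : Tri, t.InTriangle n → ∑ s, κ (t.edge s) = 0) :
    ∑ s, ∑ i, (if c (boundaryEdge n s i) = 0 then κ (boundaryEdge n s i) else 0) =
      ∑ p ∈ downIndex n, ∑ s, if c ((Tri.down p.1 p.2).edge s) = 2 then
        len κ ((Tri.down p.1 p.2).edge s) else 0 := by
  have := sum_boundary_eq (n := n) (κ := κ) (y := fun e => labelValue (c e))
    (w := fun e => if c e = 2 then 1 else 0) hκ (fun t ht => (hc.fits t ht).labelValue)
    (fun s i => by rw [if_neg (hc.boundary s i)])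
  simp only [ite_mul, one_mul, zero_mul] at this
  rw [← this]
  refine Finset.sum_congr rfl fun s _ => Finset.sum_congr rfl fun i _ => ?_
  have := hc.boundary s i
  generalize c (boundaryEdge n s i) = a at *
  fin_cases a <;> simp [labelValue] at *

theorem Puzzle.functional_eq {n : ℕ} (P : Puzzle n) {lam mu nu : Fin n → ℝ} {κ : Edge → ℝ}
    (hl : ∀ i, κ (boundaryEdge n .northwest i) = lam i)
    (hm : ∀ i, κ (boundaryEdge n .northeast i) = mu i)
    (hn : ∀ i, κ (boundaryEdge n .south i) = nu i) :
    P.functional lam mu nu = ∑ s, ∑ i,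
      (if P.label (boundaryEdge n s i) = 0 then κ (boundaryEdge n s i) else 0) := by
  have h : ∀ s i, P.HasLabel (boundaryEdge n s i) 0 ↔ P.label (boundaryEdge n s i) = 0 :=
    fun s i => P.hasLabel_iff (inTriangle_boundaryEdge n s i)
  simp only [Puzzle.functional, h, sum_side, hl, hm, hn]
  ring

/-! ## Labelings with diagonals in a given matching -/

section Matching
variable {n : ℕ} {Z : Edge → Prop} {c c' : Edge → Fin 3}

theorem Fits.eq_of_ne_two {t : Tri} (h : Fits c t) (h2 : ∀ s, c (t.edge s) ≠ 2) (r s : Side) :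
    c (t.edge r) = c (t.edge s) := by
  rcases h with h | h | ⟨q, h, -⟩
  · rw [h, h]
  · rw [h, h]
  · exact absurd h (h2 q)

/-- Either the common edge is a diagonal, and opposite sides of the rhombus agree, or neither
triangle contains a diagonal, and both are monochromatic with the label of the common edge. -/
theorem Fits.eq_across {t t' : Tri} {q r : Side} (h : Fits c t) (h' : Fits c t')
    (hq : t.edge q = t'.edge q) (h2 : ∀ s, s ≠ q → c (t.edge s) ≠ 2)
    (h2' : ∀ s, s ≠ q → c (t'.edge s) ≠ 2) (hr : r ≠ q) : c (t.edge r) = c (t'.edge r) := by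
  by_cases h0 : c (t.edge q) = 2
  · have h1 := h.of_eq_two h0
    have h1' := h'.of_eq_two (hq ▸ h0)
    rcases Side.eq_or q r with rfl | rfl | rfl
    · exact absurd rfl hr
    · rw [h1.1, h1'.1]
    · rw [h1.2, h1'.2]
  · rw [h.eq_of_ne_two (fun s => ?_) r q, h'.eq_of_ne_two (fun s => ?_) r q, hq]
    · by_cases hs : s = q
      · rwa [hs, ← hq]
      · exact h2' s hs
    · by_cases hs : s = q
      · rwa [hs]
      · exact h2 s hs

/-- Two labelings whose diagonals belong to a set `Z` of edges, no two of them in a triangle,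
agree if they agree on the Northwest side. -/
theorem labeling_eq_of_matching (hc : IsLabeling n c) (hc' : IsLabeling n c')
    (hZ : ∀ t : Tri, t.InTriangle n → ∀ r s, Z (t.edge r) → Z (t.edge s) → r = s)
    (hZi : ∀ e, Z e → e.IsInner n)
    (h2 : ∀ e : Edge, e.InTriangle n → c e = 2 → Z e)
    (h2' : ∀ e : Edge, e.InTriangle n → c' e = 2 → Z e)
    (hb : ∀ i, c (boundaryEdge n .northwest i) = c' (boundaryEdge n .northwest i))
    (e : Edge) (he : e.InTriangle n) : c e = c' e := by
  have hA : ∀ t : Tri, t.InTriangle n → (∀ s, ¬ Z (t.edge s)) → ∀ r s,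
      (Z (t.edge r) ∨ c (t.edge r) = c' (t.edge r)) →
      (Z (t.edge s) ∨ c (t.edge s) = c' (t.edge s)) := by
    intro t ht hz r s h
    right
    rw [(hc.fits t ht).eq_of_ne_two (fun s h => hz s (h2 _ (ht.edge s) h)) s r,
      (hc'.fits t ht).eq_of_ne_two (fun s h => hz s (h2' _ (ht.edge s) h)) s r]
    exact h.resolve_left (hz r)
  have hB : ∀ t t' : Tri, t.InTriangle n → t'.InTriangle n → ∀ q r, t.edge q = t'.edge q →
      Z (t.edge q) → r ≠ q →
      (Z (t'.edge r) ∨ c (t'.edge r) = c' (t'.edge r)) →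
      (Z (t.edge r) ∨ c (t.edge r) = c' (t.edge r)) := by
    intro t t' ht ht' q r hq hz hr h
    right
    have k : ∀ s, s ≠ q → ¬ Z (t.edge s) := fun s hs h => hs (hZ t ht s q h hz)
    have k' : ∀ s, s ≠ q → ¬ Z (t'.edge s) := fun s hs h => hs (hZ t' ht' s q h (hq ▸ hz))
    rw [(hc.fits t ht).eq_across (hc.fits t' ht') hq (fun s hs h => k s hs (h2 _ (ht.edge s) h))
      (fun s hs h => k' s hs (h2 _ (ht'.edge s) h)) hr,
      (hc'.fits t ht).eq_across (hc'.fits t' ht') hq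
      (fun s hs h => k s hs (h2' _ (ht.edge s) h))
      (fun s hs h => k' s hs (h2' _ (ht'.edge s) h)) hr]
    exact h.resolve_left (k' r hr)
  -- Edges of `Z` are exempt from the invariant and treated at the end. The invariant is propagated
  -- column by column, from the Northwest side eastward.
  set A : Edge → Prop := fun e => Z e ∨ c e = c' e with hAdef
  have step : ∀ x : ℤ, 0 ≤ x →
      (∀ y, (Tri.up x y).InTriangle n → A ⟨x, y, .northwest⟩) →
      (∀ y s, (Tri.up (x - 1) y).InTriangle n → A ⟨x - 1, y, s⟩) →
      (∀ y s, (Tri.up x y).InTriangle n → A ⟨x, y, s⟩) ∧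
      (∀ y, (Tri.up (x + 1) y).InTriangle n → A ⟨x + 1, y, .northwest⟩) := by
    intro x hx hnw hprev
    -- Northeast edges are handled upward, since a possible diagonal on the south edge refers to the
    -- triangle below. The south edges that follow are handled downward for the same reason.
    have hne : ∀ m : ℕ, ∀ y : ℤ, y < m → (Tri.up x y).InTriangle n → A ⟨x, y, .northeast⟩ := by
      intro m
      induction m with
      | zero => intro y hy ht; simp only [Tri.InTriangle] at ht; omega
      | succ m ih =>
        intro y hy ht
        by_cases z1 : Z ⟨x, y, .northeast⟩
        · exact Or.inl z1
        by_cases z2 : Z ⟨x, y, .northwest⟩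
        · have hi : (Tri.down (x - 1) y).InTriangle n := hZi _ z2
          refine hB (.up x y) (.down (x - 1) y) ht hi .northwest .northeast
            (by simp [Tri.edge]) z2 (by simp) (hprev y .northeast ?_)
          simp only [Tri.InTriangle] at *; omega
        by_cases z3 : Z ⟨x, y, .south⟩
        · have hi : (Tri.down x (y - 1)).InTriangle n := hZi _ z3
          refine hB (.up x y) (.down x (y - 1)) ht hi .south .northeast
            (by simp [Tri.edge]) z3 (by simp) (ih (y - 1) (by omega) ?_)
          simp only [Tri.InTriangle] at *; omega
        exact hA (.up x y) ht (fun s => by cases s <;> assumption) .northwest .northeast (hnw y ht)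
    have hso : ∀ m : ℕ, ∀ y : ℤ, n < x + y + m → (Tri.up x y).InTriangle n →
        A ⟨x, y, .south⟩ := by
      intro m
      induction m with
      | zero => intro y hy ht; simp only [Tri.InTriangle] at ht; omega
      | succ m ih =>
        intro y hy ht
        by_cases z3 : Z ⟨x, y, .south⟩
        · exact Or.inl z3
        by_cases z2 : Z ⟨x, y, .northwest⟩
        · have hi : (Tri.down (x - 1) y).InTriangle n := hZi _ z2
          refine hB (.up x y) (.down (x - 1) y) ht hi .northwest .south
            (by simp [Tri.edge]) z2 (by simp) (hprev (y + 1) .south ?_)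
          simp only [Tri.InTriangle] at *; omega
        by_cases z1 : Z ⟨x, y, .northeast⟩
        · have hi : (Tri.down x y).InTriangle n := hZi _ z1
          refine hB (.up x y) (.down x y) ht hi .northeast .south
            (by simp [Tri.edge]) z1 (by simp) (ih (y + 1) (by push_cast at hy; omega) ?_)
          simp only [Tri.InTriangle] at *; omega
        exact hA (.up x y) ht (fun s => by cases s <;> assumption) .northwest .south (hnw y ht)
    refine ⟨fun y s ht => ?_, fun y ht => ?_⟩
    · cases s
      · exact hso (n + 1) y (by simp only [Tri.InTriangle] at ht; push_cast; omega) ht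
      · exact hnw y ht
      · exact hne (y.toNat + 1) y (by simp only [Tri.InTriangle] at ht; omega) ht
    · have hd : (Tri.down x y).InTriangle n := by simp only [Tri.InTriangle] at *; omega
      have hu : (Tri.up x y).InTriangle n := by simp only [Tri.InTriangle] at *; omega
      by_cases z2 : Z ⟨x + 1, y, .northwest⟩
      · exact Or.inl z2
      by_cases z1 : Z ⟨x, y, .northeast⟩
      · exact hB (.down x y) (.up x y) hd hu .northeast .northwest (by simp [Tri.edge]) z1
          (by simp) (hnw y hu)
      by_cases z3 : Z ⟨x, y + 1, .south⟩
      · have hu' : (Tri.up x (y + 1)).InTriangle n := by simp only [Tri.InTriangle] at *; omega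
        exact hB (.down x y) (.up x (y + 1)) hd hu' .south .northwest (by simp [Tri.edge]) z3
          (by simp) (hnw (y + 1) hu')
      exact hA (.down x y) hd (fun s => by cases s <;> assumption) .northeast .northwest
        (hne (y.toNat + 1) y (by simp only [Tri.InTriangle] at ht; omega) hu)
  have all : ∀ m : ℕ, (∀ y s, (Tri.up m y).InTriangle n → A ⟨m, y, s⟩) ∧
      (∀ y, (Tri.up (m + 1) y).InTriangle n → A ⟨m + 1, y, .northwest⟩) := by
    intro m
    induction m with
    | zero =>
      refine step 0 le_rfl (fun y ht => Or.inr ?_)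
        (fun y s ht => by simp only [Tri.InTriangle] at ht; omega)
      simp only [Tri.InTriangle] at ht
      have := hb ⟨y.toNat, by omega⟩
      rw [boundaryEdge] at this
      rwa [show ((⟨y.toNat, by omega⟩ : Fin n) : ℕ) = y.toNat from rfl,
        Int.toNat_of_nonneg ht.2.1] at this
    | succ m ih =>
      push_cast
      exact step (m + 1) (by omega) ih.2 (fun y s ht => by simpa using ih.1 y s (by simpa using ht))
  have hall : ∀ e : Edge, e.InTriangle n → ¬ Z e → c e = c' e := by
    rintro ⟨x, y, s⟩ he hz
    have hx : 0 ≤ x := he.1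
    have := (all x.toNat).1 y s
    rw [Int.toNat_of_nonneg hx] at this
    exact (this he).resolve_left hz
  by_cases hz : Z e
  · have h1 := hall (e.upTri.edge e.side.next) (Tri.InTriangle.edge he _) fun h => by
      have := hZ _ he e.side e.side.next hz h
      revert this
      cases e.side <;> simp [Side.next]
    have h3 := hall (e.upTri.edge e.side.next.next) (Tri.InTriangle.edge he _) fun h => by
      have := hZ _ he e.side e.side.next.next hz h
      revert this
      cases e.side <;> simp [Side.next]
    -- The label of an edge of `Z` is forced by the other two sides of its up triangle: their common
    -- label if they agree, a diagonal if they differ.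
    have key : ∀ d : Edge → Fin 3, Fits d e.upTri → d (e.upTri.edge e.side.next) ≠ 2 →
        d (e.upTri.edge e.side.next.next) ≠ 2 →
        d e = if d (e.upTri.edge e.side.next) = d (e.upTri.edge e.side.next.next) then
          d (e.upTri.edge e.side.next) else 2 := by
      intro d hd g1 g3
      split_ifs with g
      · by_contra hne
        rcases hd with hd | hd | ⟨s, k1, k2, k3⟩
        · exact hne (by rw [hd, ← upTri_edge e, hd])
        · exact hne (by rw [hd, ← upTri_edge e, hd])
        · rcases Side.eq_or e.side s with rfl | rfl | rfl
          · rw [k2, k3] at g; exact absurd g (by decide)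
          · exact g1 k1
          · exact g3 k1
      · rcases hd with hd | hd | ⟨s, k1, k2, k3⟩
        · exact absurd (by rw [hd, hd]) g
        · exact absurd (by rw [hd, hd]) g
        · rcases Side.eq_or e.side s with rfl | rfl | rfl
          · exact k1
          · exact absurd k1 g1
          · exact absurd k1 g3
    have nz : ∀ s, s ≠ e.side → ¬ Z (e.upTri.edge s) := fun s hs h => hs (hZ _ he s _ h hz)
    have n1 : e.side.next ≠ e.side := by cases e.side <;> simp [Side.next]
    have n3 : e.side.next.next ≠ e.side := by cases e.side <;> simp [Side.next]
    rw [key c (hc.fits _ he) (fun h => nz _ n1 (h2 _ (Tri.InTriangle.edge he _) h))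
      (fun h => nz _ n3 (h2 _ (Tri.InTriangle.edge he _) h)),
      key c' (hc'.fits _ he) (fun h => nz _ n1 (h2' _ (Tri.InTriangle.edge he _) h))
      (fun h => nz _ n3 (h2' _ (Tri.InTriangle.edge he _) h)), h1, h3]
  · exact hall e he hz

end Matching

/-! ## Inequalities satisfied by honeycombs -/

section Virtual
variable {n : ℕ} {κ : Edge → ℝ}

theorem upTri_edge_eq_downTri_edge (e : Edge) : e.upTri.edge e.side = e.downTri.edge e.side := by
  simp

theorem len_eq (hκ : ∀ t : Tri, t.InTriangle n → ∑ s, κ (t.edge s) = 0) {e : Edge}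
    (he : e.IsInner n) :
    len κ e = κ (e.downTri.edge e.side.next) - κ (e.upTri.edge e.side.next) := by
  have h1 := hκ _ he
  have h2 := hκ _ he.inTriangle
  rw [sum_side_cycle e.side] at h1 h2
  rw [upTri_edge_eq_downTri_edge] at h2
  rw [len]; linarith

theorem antitone_of_succ_le {f : Fin n → ℝ}
    (h : ∀ i (hi : i + 1 < n), f ⟨i + 1, hi⟩ ≤ f ⟨i, by omega⟩) : Antitone f := by
  cases n with
  | zero => exact fun i => i.elim0
  | succ n =>
    rw [Fin.antitone_iff_succ_le]
    exact fun i => h i (by omega)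

/-- Consecutive boundary edges flank a down triangle, and the drop between their coordinates is the
sum of the lengths of two sides of that triangle. -/
theorem antitone_boundary (hκ : ∀ t : Tri, t.InTriangle n → ∑ s, κ (t.edge s) = 0)
    (hl : ∀ e : Edge, e.IsInner n → 0 ≤ len κ e) (s : Side) :
    Antitone fun i => κ (boundaryEdge n s i) := by
  refine antitone_of_succ_le fun i hi => ?_
  cases s
  · have h1 := len_eq hκ (e := ⟨n - 1 - (i + 1 : ℕ), 0, .northeast⟩)
      (by simp [Edge.IsInner, Edge.downTri, Tri.InTriangle]; omega)
    have h1' := hl ⟨n - 1 - (i + 1 : ℕ), 0, .northeast⟩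
      (by simp [Edge.IsInner, Edge.downTri, Tri.InTriangle]; omega)
    have h2 := hl ⟨n - 1 - i, 0, .northwest⟩
      (by simp [Edge.IsInner, Edge.downTri, Tri.InTriangle]; omega)
    simp only [len, boundaryEdge, Edge.downTri, Edge.upTri, Tri.edge, Side.next] at *
    rw [show (n : ℤ) - 1 - (i + 1 : ℕ) = n - 1 - i - 1 by push_cast; ring] at *
    linarith
  · have h1 := hl ⟨0, i, .northeast⟩
      (by simp [Edge.IsInner, Edge.downTri, Tri.InTriangle]; omega)
    have h2 := len_eq hκ (e := ⟨0, (i + 1 : ℕ), .south⟩)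
      (by simp [Edge.IsInner, Edge.downTri, Tri.InTriangle]; omega)
    have h2' := hl ⟨0, (i + 1 : ℕ), .south⟩
      (by simp [Edge.IsInner, Edge.downTri, Tri.InTriangle]; omega)
    simp only [len, boundaryEdge, Edge.downTri, Edge.upTri, Tri.edge, Side.next] at *
    rw [show ((i + 1 : ℕ) : ℤ) - 1 = i by push_cast; ring] at *
    linarith
  · have h1 := hl ⟨i, n - 1 - i, .south⟩
      (by simp [Edge.IsInner, Edge.downTri, Tri.InTriangle]; omega)
    have h2 := len_eq hκ (e := ⟨(i + 1 : ℕ), n - 1 - (i + 1 : ℕ), .northwest⟩)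
      (by simp [Edge.IsInner, Edge.downTri, Tri.InTriangle]; omega)
    have h2' := hl ⟨(i + 1 : ℕ), n - 1 - (i + 1 : ℕ), .northwest⟩
      (by simp [Edge.IsInner, Edge.downTri, Tri.InTriangle]; omega)
    simp only [len, boundaryEdge, Edge.downTri, Edge.upTri, Tri.edge, Side.next] at *
    rw [show ((i + 1 : ℕ) : ℤ) - 1 = i by push_cast; ring] at *
    rw [show (n : ℤ) - 1 - (i + 1 : ℕ) = n - 1 - i - 1 by push_cast; ring] at *
    linarith

theorem isLabeling_zero (n : ℕ) : IsLabeling n fun _ => 0 :=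
  ⟨fun _ _ => Or.inl fun _ => rfl, fun _ _ => by simp⟩

/-- Green's formula for the puzzle consisting of `0`-triangles only, which has no diagonals. -/
theorem sum_boundary_eq_zero (hκ : ∀ t : Tri, t.InTriangle n → ∑ s, κ (t.edge s) = 0) :
    ∑ s, ∑ i, κ (boundaryEdge n s i) = 0 := by
  have := (isLabeling_zero n).sum_boundary hκ
  simpa using this

theorem isInner_down_edge {p : ℤ × ℤ} (hp : p ∈ downIndex n) (s : Side) :
    ((Tri.down p.1 p.2).edge s).IsInner n := by
  rw [Edge.IsInner, down_edge_downTri]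
  exact mem_downIndex.1 hp

theorem sum_boundary_nonneg {c : Edge → Fin 3} (hc : IsLabeling n c)
    (hκ : ∀ t : Tri, t.InTriangle n → ∑ s, κ (t.edge s) = 0)
    (hl : ∀ e : Edge, e.IsInner n → 0 ≤ len κ e) :
    0 ≤ ∑ s, ∑ i, (if c (boundaryEdge n s i) = 0 then κ (boundaryEdge n s i) else 0) := by
  rw [hc.sum_boundary hκ]
  refine Finset.sum_nonneg fun p hp => Finset.sum_nonneg fun s _ => ?_
  split_ifs
  · exact hl _ (isInner_down_edge hp s)
  · exact le_rfl

/-- The diagonals of a labeling have zero length if its boundary functional vanishes. -/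
theorem len_eq_zero_of_sum_boundary {c : Edge → Fin 3} (hc : IsLabeling n c)
    (hκ : ∀ t : Tri, t.InTriangle n → ∑ s, κ (t.edge s) = 0)
    (hl : ∀ e : Edge, e.IsInner n → c e = 2 → 0 ≤ len κ e)
    (h0 : ∑ s, ∑ i, (if c (boundaryEdge n s i) = 0 then κ (boundaryEdge n s i) else 0) = 0)
    {e : Edge} (he : e.InTriangle n) (h2 : c e = 2) : len κ e = 0 := by
  have hi := hc.isInner he h2
  rw [hc.sum_boundary hκ] at h0
  -- Only the diagonals of `c` need nonnegative length. This matters for the overlay hive, whose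
  -- sign is controlled only away from region edges.
  have hnn : ∀ p ∈ downIndex n, ∀ s, 0 ≤ if c ((Tri.down p.1 p.2).edge s) = 2 then
      len κ ((Tri.down p.1 p.2).edge s) else 0 := by
    intro p hp s
    split_ifs with h
    · exact hl _ (isInner_down_edge hp s) h
    · exact le_rfl
  rw [Finset.sum_eq_zero_iff_of_nonneg
    (fun p hp => Finset.sum_nonneg fun s _ => hnn p hp s)] at h0
  obtain ⟨x, y, hd⟩ : ∃ x y, e.downTri = .down x y := by
    obtain ⟨x, y, s⟩ := e
    cases s <;> exact ⟨_, _, rfl⟩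
  have hp : (x, y) ∈ downIndex n := by
    rw [mem_downIndex]; rw [Edge.IsInner, hd] at hi; exact hi
  have h1 := h0 (x, y) hp
  rw [Finset.sum_eq_zero_iff_of_nonneg (fun s _ => hnn (x, y) hp s)] at h1
  have h3 := h1 e.side (Finset.mem_univ _)
  simp only at h3
  rwa [← hd, downTri_edge, if_pos h2] at h3

theorem SameBoundary.sum_boundary_eq {P Q : Puzzle n} (h : P.SameBoundary Q) :
    ∑ s, ∑ i, (if Q.label (boundaryEdge n s i) = 0 then κ (boundaryEdge n s i) else 0) =
    ∑ s, ∑ i, (if P.label (boundaryEdge n s i) = 0 then κ (boundaryEdge n s i) else 0) := by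
  simp only [h.label_eq]

/-- A puzzle is rigid if its rhombi are degenerate in a honeycomb with simple degeneracies. -/
theorem Puzzle.isRigid_of_len {P : Puzzle n}
    (hκ : ∀ t : Tri, t.InTriangle n → ∑ s, κ (t.edge s) = 0)
    (hl : ∀ e : Edge, e.IsInner n → 0 ≤ len κ e)
    (hP : ∀ e : Edge, e.InTriangle n → P.label e = 2 → len κ e = 0)
    (hZ : ∀ t : Tri, t.InTriangle n → ∀ r s, (t.edge r).IsInner n → (t.edge s).IsInner n →
      len κ (t.edge r) = 0 → len κ (t.edge s) = 0 → r = s) : P.IsRigid := by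
  intro Q hPQ
  have h0 : ∑ s, ∑ i,
      (if P.label (boundaryEdge n s i) = 0 then κ (boundaryEdge n s i) else 0) = 0 := by
    rw [P.isLabeling.sum_boundary hκ]
    refine Finset.sum_eq_zero fun p hp => Finset.sum_eq_zero fun s _ => ?_
    split_ifs with h
    · exact hP _ (isInner_down_edge hp s).inTriangle h
    · rfl
  -- Complementary slackness: `Q` has the same vanishing boundary functional, so its diagonals have
  -- length zero as well and lie in the same matching.
  have hQ : ∀ e : Edge, e.InTriangle n → Q.label e = 2 → len κ e = 0 := fun e he h2 =>
    len_eq_zero_of_sum_boundary Q.isLabeling hκ (fun e h _ => hl e h)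
      ((SameBoundary.sum_boundary_eq hPQ).trans h0) he h2
  refine Puzzle.ext_of_label fun e he => ?_
  exact labeling_eq_of_matching (Z := fun e => e.IsInner n ∧ len κ e = 0) Q.isLabeling
    P.isLabeling (fun t ht r s hr hs => hZ t ht r s hr.1 hs.1 hr.2 hs.2) (fun e h => h.1)
    (fun e he h2 => ⟨Q.isLabeling.isInner he h2, hQ e he h2⟩)
    (fun e he h2 => ⟨P.isLabeling.isInner he h2, hP e he h2⟩)
    (fun i => (hPQ.label_eq _ i).symm) e he

end Virtual

open Classical in
/-- The constant coordinates on the edges of a honeycomb. -/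
noncomputable def Honeycomb.kappa {n : ℕ} (h : Honeycomb n) (e : Edge) : ℝ :=
  if he : e.InTriangle n then h.coord ⟨e.upTri, he⟩ e.side else 0

theorem Honeycomb.kappa_edge {n : ℕ} (h : Honeycomb n) {t : Tri} (ht : t.InTriangle n)
    (s : Side) : h.kappa (t.edge s) = h.coord ⟨t, ht⟩ s := by
  have he := ht.edge s
  rw [Honeycomb.kappa, dif_pos he]
  cases t with
  | up x y => rfl
  | down x y =>
    obtain ⟨ℓ, -, h1, -⟩ := h.edges ((Tri.down x y).edge s) (by rwa [down_edge_downTri]) he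
    simp only [edge_side, down_edge_downTri] at h1
    simp only [edge_side]
    exact h1

theorem Honeycomb.sum_kappa {n : ℕ} (h : Honeycomb n) {t : Tri} (ht : t.InTriangle n) :
    ∑ s, h.kappa (t.edge s) = 0 := by
  simp only [h.kappa_edge ht, sum_side]
  linarith [h.sum_eq_zero ⟨t, ht⟩]

theorem Honeycomb.len_nonneg {n : ℕ} (h : Honeycomb n) {e : Edge} (he : e.IsInner n) :
    0 ≤ len h.kappa e := by
  obtain ⟨ℓ, h0, -, -, h1⟩ := h.edges e he he.inTriangle
  rw [len, h.kappa_edge he, h.kappa_edge (t := e.upTri) he.inTriangle, h1]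
  linarith

theorem Honeycomb.boundary_eq {n : ℕ} (h : Honeycomb n) (s : Side) (i : Fin n) :
    h.boundary s i = h.kappa (boundaryEdge n s i) := by
  rw [Honeycomb.kappa, dif_pos (inTriangle_boundaryEdge n s i)]
  cases s <;> rfl

/-- The inequalities that hold for the boundary coordinates of a honeycomb. -/
theorem inequalities_of_mem_LR {n : ℕ} {lam mu nu : Fin n → ℝ} (h : (lam, mu, nu) ∈ LR n) :
    Antitone lam ∧ Antitone mu ∧ Antitone nu ∧
      (∑ i, lam i) + (∑ i, mu i) + (∑ i, nu i) = 0 ∧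
        ∀ P : Puzzle n, 0 ≤ P.functional lam mu nu := by
  obtain ⟨h, hh⟩ := h
  simp only [Prod.mk.injEq] at hh
  obtain ⟨rfl, rfl, rfl⟩ := hh
  have hκ : ∀ t : Tri, t.InTriangle n → ∑ s, h.kappa (t.edge s) = 0 := fun t ht => h.sum_kappa ht
  have hl : ∀ e : Edge, e.IsInner n → 0 ≤ len h.kappa e := fun e he => h.len_nonneg he
  have hb : ∀ s, h.boundary s = fun i => h.kappa (boundaryEdge n s i) :=
    fun s => funext fun i => h.boundary_eq s i
  refine ⟨hb _ ▸ antitone_boundary hκ hl _, hb _ ▸ antitone_boundary hκ hl _,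
    hb _ ▸ antitone_boundary hκ hl _, ?_, fun P => ?_⟩
  · have := sum_boundary_eq_zero hκ
    simp only [sum_side, ← h.boundary_eq] at this
    linarith
  · rw [P.functional_eq (κ := h.kappa) (fun i => (h.boundary_eq _ i).symm)
      (fun i => (h.boundary_eq _ i).symm) (fun i => (h.boundary_eq _ i).symm)]
    exact sum_boundary_nonneg P.isLabeling hκ hl

/-! ## Hives -/

/-- The increments of a function on the lattice points. -/
def incr (H : ℤ × ℤ → ℝ) (e : Edge) : ℝ := H e.target - H e.source

theorem sum_incr (H : ℤ × ℤ → ℝ) (t : Tri) : ∑ s, incr H (t.edge s) = 0 := by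
  cases t <;> simp only [sum_side, Tri.edge, incr, Edge.source, Edge.target] <;> ring

/-- The honeycomb of a convex hive. -/
def honeycombOfHive (n : ℕ) (H : ℤ × ℤ → ℝ)
    (hl : ∀ e : Edge, e.IsInner n → 0 ≤ len (incr H) e) : Honeycomb n where
  coord t s := incr H (t.1.edge s)
  sum_eq_zero t := by
    have := sum_incr H t.1
    rw [sum_side] at this
    linarith
  edges e hd hu := by
    refine ⟨len (incr H) e, hl e hd, by simp, ?_, ?_⟩
    · rw [len_eq (n := n) (fun t _ => sum_incr H t) hd]; simp
    · rw [len]; simp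

theorem mem_LR_of_hive {n : ℕ} {lam mu nu : Fin n → ℝ} (H : ℤ × ℤ → ℝ)
    (hl : ∀ e : Edge, e.IsInner n → 0 ≤ len (incr H) e)
    (hlam : ∀ i, incr H (boundaryEdge n .northwest i) = lam i)
    (hmu : ∀ i, incr H (boundaryEdge n .northeast i) = mu i)
    (hnu : ∀ i, incr H (boundaryEdge n .south i) = nu i) : (lam, mu, nu) ∈ LR n := by
  refine ⟨honeycombOfHive n H hl, ?_⟩
  simp only [Prod.mk.injEq]
  exact ⟨funext hlam, funext hmu, funext hnu⟩

/-! ## Linear programming duality for hives -/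

/-- Stiemke's lemma. -/
theorem exists_pos_orthogonal {ι : Type*} [Fintype ι] (U : Submodule ℝ (ι → ℝ))
    (hU : ∀ u ∈ U, 0 ≤ u → u = 0) : ∃ w : ι → ℝ, (∀ i, 0 < w i) ∧ ∀ u ∈ U, ∑ i, w i * u i = 0 := by
  classical
  have hdisj : Disjoint (stdSimplex ℝ ι) (U : Set (ι → ℝ)) := by
    rw [Set.disjoint_left]
    intro u hu hu'
    have := hU u hu' hu.1
    have h1 := hu.2
    simp [this] at h1
  -- Separate the compact simplex from the subspace. The values of `f` on the simplex lie below `b <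
  -- 0`, so minus its values at the unit vectors are positive weights.
  obtain ⟨f, a, b, hfa, hab, hfb⟩ := geometric_hahn_banach_compact_closed
    (convex_stdSimplex ℝ ι) (isCompact_stdSimplex ℝ ι) U.convex
    (Submodule.closed_of_finiteDimensional U) hdisj
  have hb : b < 0 := by simpa using hfb 0 U.zero_mem
  -- A linear functional bounded below on a subspace vanishes there: otherwise a multiple of `u`
  -- would attain the value `b`.
  have hf : ∀ u ∈ U, f u = 0 := by
    intro u hu
    by_contra hne
    have := hfb ((b / f u) • u) (U.smul_mem _ hu)
    rw [map_smul, smul_eq_mul, div_mul_cancel₀ _ hne] at this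
    exact lt_irrefl _ this
  refine ⟨fun i => - f (Pi.single i 1), fun i => ?_, fun u hu => ?_⟩
  · have := hfa _ (single_mem_stdSimplex ℝ i)
    linarith
  · have h1 : f u = ∑ i, u i * f (Pi.single i 1) := by
      conv_lhs => rw [pi_eq_sum_univ' u]
      simp [map_sum]
    rw [hf u hu] at h1
    simp only [neg_mul, Finset.sum_neg_distrib, neg_eq_zero]
    rw [h1]
    exact Finset.sum_congr rfl fun i _ => mul_comm _ _

open Classical in
/-- The edges that separate two unit triangles of the lattice triangle. -/
noncomputable def innerEdges (n : ℕ) : Finset Edge :=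
  (downIndex n ×ˢ Finset.univ).image fun q : (ℤ × ℤ) × Side => (Tri.down q.1.1 q.1.2).edge q.2

theorem mem_innerEdges {n : ℕ} {e : Edge} : e ∈ innerEdges n ↔ e.IsInner n := by
  simp only [innerEdges, Finset.mem_image, Finset.mem_product, Finset.mem_univ, and_true]
  constructor
  · rintro ⟨⟨p, s⟩, hp, rfl⟩
    exact isInner_down_edge hp s
  · intro h
    obtain ⟨x, y, hd⟩ : ∃ x y, e.downTri = .down x y := by
      obtain ⟨x, y, s⟩ := e
      cases s <;> exact ⟨_, _, rfl⟩
    refine ⟨⟨(x, y), e.side⟩, ?_, by simp only; rw [← hd, downTri_edge]⟩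
    rw [mem_downIndex]; rw [Edge.IsInner, hd] at h; exact h

theorem sum_innerEdges {n : ℕ} (f : Edge → ℝ) :
    ∑ e ∈ innerEdges n, f e = ∑ p ∈ downIndex n, ∑ s, f ((Tri.down p.1 p.2).edge s) := by
  classical
  rw [innerEdges, Finset.sum_image, Finset.sum_product]
  rintro ⟨p, s⟩ _ ⟨q, r⟩ _ h
  simp only at h
  have h1 : s = r := by rw [← edge_side (.down p.1 p.2) s, h, edge_side]
  have h2 : Tri.down p.1 p.2 = Tri.down q.1 q.2 := by
    rw [← down_edge_downTri p.1 p.2 s, h, down_edge_downTri]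
  simp only [Tri.down.injEq] at h2
  ext <;> simp [h1, h2]

/-- Edge lengths of hives as linear functionals. -/
def hlen (e : Edge) : (ℤ × ℤ → ℝ) →ₗ[ℝ] ℝ where
  toFun H := len (incr H) e
  map_add' H K := by simp only [len, incr, Pi.add_apply]; ring
  map_smul' a H := by simp only [len, incr, Pi.smul_apply, smul_eq_mul, RingHom.id_apply]; ring

theorem hlen_apply (e : Edge) (H : ℤ × ℤ → ℝ) : hlen e H = len (incr H) e := rfl

theorem hlen_south (H : ℤ × ℤ → ℝ) (x y : ℤ) : hlen ⟨x, y, .south⟩ H =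
    H (x, y + 1) + H (x + 1, y - 1) - H (x, y) - H (x + 1, y) := by
  simp [hlen, len, incr, Side.next, Tri.edge, Edge.upTri, Edge.downTri, Edge.source, Edge.target]
  ring

theorem hlen_northwest (H : ℤ × ℤ → ℝ) (x y : ℤ) : hlen ⟨x, y, .northwest⟩ H =
    H (x + 1, y) + H (x - 1, y + 1) - H (x, y) - H (x, y + 1) := by
  simp [hlen, len, incr, Side.next, Tri.edge, Edge.upTri, Edge.downTri, Edge.source, Edge.target]
  ring

theorem hlen_northeast (H : ℤ × ℤ → ℝ) (x y : ℤ) : hlen ⟨x, y, .northeast⟩ H =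
    H (x, y) + H (x + 1, y + 1) - H (x + 1, y) - H (x, y + 1) := by
  simp [hlen, len, incr, Side.next, Tri.edge, Edge.upTri, Edge.downTri, Edge.source, Edge.target]
  ring

/-- The lattice point `v` lies in the interior of the lattice triangle. -/
def IsInterior (n : ℕ) (v : ℤ × ℤ) : Prop := 0 < v.1 ∧ 0 < v.2 ∧ v.1 + v.2 < n

/-- Convexity of a hive. -/
def IsConvexHive (n : ℕ) (H : ℤ × ℤ → ℝ) : Prop := ∀ e : Edge, e.IsInner n → 0 ≤ hlen e H

/-- Sum of the rhombus inequalities over the parallelogram with opposite acute corners `(0, 0)` and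
`(x, y)`. The corners other than `(x, y)` lie on the boundary, so boundary values bound interior
values from below. -/
theorem IsConvexHive.lower {n : ℕ} {H : ℤ × ℤ → ℝ} (hH : IsConvexHive n H) (x y : ℕ)
    (h : x + y ≤ n) : H (0, y) + H (x, 0) ≤ H (x, y) + H (0, 0) := by
  have step : ∀ x y : ℕ, x + 1 + y ≤ n →
      H ((x : ℤ) + 1, 0) - H (x, 0) ≤ H ((x : ℤ) + 1, y) - H (x, y) := by
    intro x y
    induction y with
    | zero => intro _; simp
    | succ y ih =>
      intro h
      have h1 := ih (by omega)
      have h2 := hH ⟨x, y, .northeast⟩ (by simp [Edge.IsInner, Edge.downTri, Tri.InTriangle]; omega)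
      rw [hlen_northeast] at h2
      push_cast
      linarith
  induction x with
  | zero => simp
  | succ x ih =>
    have h1 := ih (by omega)
    have h2 := step x y h
    push_cast
    linarith

/-- Here `(x, y)` is an obtuse corner of a parallelogram whose other three corners lie on the
boundary. Summing the rhombi with horizontal short diagonal bounds the interior value from above. -/
theorem IsConvexHive.upper {n : ℕ} {H : ℤ × ℤ → ℝ} (hH : IsConvexHive n H) (x y : ℕ)
    (h : x + y ≤ n) : H (x, y) + H ((x : ℤ) + y, (n : ℤ) - x - y) ≤
      H ((x : ℤ) + y, 0) + H (x, (n : ℤ) - x) := by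
  have step : ∀ k x y : ℕ, x + y + 1 + k = n → H (x, (y : ℤ) + 1) - H ((x : ℤ) + 1, y) ≤
      H (x, (n : ℤ) - x) - H ((x : ℤ) + 1, (n : ℤ) - x - 1) := by
    intro k
    induction k with
    | zero =>
      intro x y h
      rw [show (n : ℤ) = x + y + 1 by omega]
      ring_nf; rfl
    | succ k ih =>
      intro x y h
      have h1 := ih x (y + 1) (by omega)
      have h2 := hH ⟨x, (y : ℤ) + 1, .south⟩
        (by simp [Edge.IsInner, Edge.downTri, Tri.InTriangle]; omega)
      rw [hlen_south] at h2
      push_cast at h1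
      rw [add_sub_cancel_right] at h2
      linarith
  induction y generalizing x with
  | zero => simp [add_comm]
  | succ y ih =>
    have h1 := ih (x + 1) (by omega)
    have h2 := step (n - (x + y + 1)) x y (by omega)
    push_cast at *
    rw [show (x : ℤ) + 1 + y = x + (y + 1) by ring,
      show (n : ℤ) - (x + 1) - y = n - x - (y + 1) by ring,
      show (n : ℤ) - (x + 1) = n - x - 1 by ring] at h1
    linarith

/-- A strictly convex hive. -/
def quadHive (v : ℤ × ℤ) : ℝ := (v.1 : ℝ) ^ 2 + v.1 * v.2 + (v.2 : ℝ) ^ 2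

theorem hlen_quadHive (e : Edge) : hlen e quadHive = 1 := by
  obtain ⟨x, y, s⟩ := e
  cases s
  · rw [hlen_south]; simp only [quadHive]; push_cast; ring
  · rw [hlen_northwest]; simp only [quadHive]; push_cast; ring
  · rw [hlen_northeast]; simp only [quadHive]; push_cast; ring

/-- Strictness on the boundary survives every convex combination with `G` in which `quadHive` has
positive weight. It excludes flat configurations at boundary points. -/
theorem incr_quadHive_lt {n : ℕ} (s : Side) (i j : Fin n) (h : i < j) :
    incr quadHive (boundaryEdge n s j) < incr quadHive (boundaryEdge n s i) := by
  have : (i : ℝ) < (j : ℝ) := by exact_mod_cast h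
  cases s <;> simp only [boundaryEdge, incr, Edge.source, Edge.target, quadHive] <;> push_cast <;>
    nlinarith

/-! ### Extremal hives and dual weights -/

section Path
variable (n : ℕ) (G : ℤ × ℤ → ℝ)

/-- Convex hives whose boundary values lie on the segment from `quadHive` to `G`. -/
def hivePath : Set (ℝ × (ℤ × ℤ → ℝ)) :=
  {q | q.1 ∈ Set.Icc (0 : ℝ) 1 ∧
    (∀ v, ¬ IsInterior n v → q.2 v = (1 - q.1) * quadHive v + q.1 * G v) ∧ IsConvexHive n q.2}

/-- The conditions are closed. All points off the interior are prescribed, and the two parallelogram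
inequalities bound the interior values by the absolute boundary values collected in `M`. -/
theorem isCompact_hivePath : IsCompact (hivePath n G) := by
  set β : ℤ × ℤ → ℝ := fun v => |quadHive v| + |G v| with hβ
  have hβ0 : ∀ v, 0 ≤ β v := fun v => by positivity
  set M : ℤ × ℤ → ℝ := fun v => β v + β (0, v.2) + β (v.1, 0) + β (0, 0) +
    β (v.1 + v.2, 0) + β (v.1, n - v.1) + β (v.1 + v.2, n - v.1 - v.2) with hM
  refine IsCompact.of_isClosed_subset
    ((isCompact_Icc (a := (0 : ℝ)) (b := 1)).prod
      (isCompact_univ_pi fun v => isCompact_Icc (a := -M v) (b := M v)))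
    ?_ ?_
  · have h1 : IsClosed {q : ℝ × (ℤ × ℤ → ℝ) | q.1 ∈ Set.Icc (0 : ℝ) 1} :=
      isClosed_Icc.preimage continuous_fst
    have h2 : IsClosed {q : ℝ × (ℤ × ℤ → ℝ) |
        ∀ v, ¬ IsInterior n v → q.2 v = (1 - q.1) * quadHive v + q.1 * G v} := by
      simp only [Set.ofPred_forall]
      refine isClosed_iInter fun v => isClosed_iInter fun _ => isClosed_eq ?_ ?_
      · fun_prop
      · fun_prop
    have h3 : IsClosed {q : ℝ × (ℤ × ℤ → ℝ) | IsConvexHive n q.2} := by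
      simp only [IsConvexHive, Set.ofPred_forall]
      refine isClosed_iInter fun e => isClosed_iInter fun _ => isClosed_le continuous_const ?_
      simp only [hlen_apply, len, incr]
      fun_prop
    exact h1.inter (h2.inter h3)
  · rintro ⟨t, H⟩ ⟨ht, hb, hc⟩
    simp only at ht hb hc
    have hb' : ∀ v, ¬ IsInterior n v → |H v| ≤ β v := by
      intro v hv
      rw [hb v hv]
      refine (abs_add_le _ _).trans ?_
      rw [abs_mul, abs_mul, abs_of_nonneg ht.1, abs_of_nonneg (sub_nonneg.2 ht.2)]
      exact add_le_add (mul_le_of_le_one_left (abs_nonneg _) (by linarith [ht.1]))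
        (mul_le_of_le_one_left (abs_nonneg _) ht.2)
    refine ⟨ht, fun v _ => ?_⟩
    obtain ⟨x, y⟩ := v
    have hp := fun a => hβ0 a
    by_cases hv : IsInterior n (x, y)
    · obtain ⟨hx, hy, hxy⟩ := hv
      simp only at hx hy hxy
      have hl := hc.lower x.toNat y.toNat (by omega)
      have hu := hc.upper x.toNat y.toNat (by omega)
      rw [Int.toNat_of_nonneg hx.le, Int.toNat_of_nonneg hy.le] at hl hu
      have b1 := abs_le.1 (hb' (0, y) (by simp [IsInterior]))
      have b2 := abs_le.1 (hb' (x, 0) (by simp [IsInterior]))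
      have b3 := abs_le.1 (hb' (0, 0) (by simp [IsInterior]))
      have b4 := abs_le.1 (hb' (x + y, 0) (by simp [IsInterior]))
      have b5 := abs_le.1 (hb' (x, n - x) (by simp [IsInterior]))
      have b6 := abs_le.1 (hb' (x + y, n - x - y) (by simp [IsInterior]))
      have := hp (x, y)
      have := hp (0, y)
      have := hp (x, 0)
      have := hp (0, 0)
      have := hp (x + y, 0)
      have := hp (x, n - x)
      have := hp (x + y, n - x - y)
      simp only [hM]
      constructor <;> linarith
    · have b1 := abs_le.1 (hb' (x, y) hv)
      have := hp (0, y)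
      have := hp (x, 0)
      have := hp (0, 0)
      have := hp (x + y, 0)
      have := hp (x, n - x)
      have := hp (x + y, n - x - y)
      simp only [hM]
      constructor <;> linarith

/-- Small perturbations of a convex hive by a hive that is convex where the first one is flat. -/
theorem exists_perturbation {h φ : ℤ × ℤ → ℝ} (hh : IsConvexHive n h)
    (hφ : ∀ e : Edge, e.IsInner n → hlen e h = 0 → 0 ≤ hlen e φ) (δ : ℝ) (hδ : 0 < δ) :
    ∃ ε, 0 < ε ∧ ε < δ ∧ IsConvexHive n (h + ε • φ) ∧
      ∀ e : Edge, e.IsInner n → 0 < hlen e h → 0 < hlen e (h + ε • φ) := by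
  have ev : ∀ e ∈ innerEdges n, ∀ᶠ ε in nhdsWithin (0 : ℝ) (Set.Ioi 0),
      0 < hlen e h → 0 < hlen e (h + ε • φ) := by
    intro e he
    by_cases h0 : 0 < hlen e h
    · have hc : Continuous fun ε : ℝ => hlen e h + ε * hlen e φ := by fun_prop
      have : Filter.Tendsto (fun ε : ℝ => hlen e h + ε * hlen e φ) (nhdsWithin 0 (Set.Ioi 0))
          (nhds (hlen e h)) := by
        have := hc.tendsto 0
        simp only [zero_mul, add_zero] at this
        exact this.mono_left nhdsWithin_le_nhds
      filter_upwards [this.eventually (lt_mem_nhds h0)] with ε hε _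
      simpa using hε
    · exact Filter.Eventually.of_forall fun ε h => absurd h h0
  have ev' := (Filter.eventually_all_finset (innerEdges n)).2 ev
  obtain ⟨ε, h1, h2, h3⟩ := (ev'.and ((eventually_mem_nhdsWithin).and
    (nhdsWithin_le_nhds (gt_mem_nhds hδ)))).exists
  refine ⟨ε, h2, h3, fun e he => ?_, fun e he => h1 e (mem_innerEdges.2 he)⟩
  rcases (hh e he).lt_or_eq with h0 | h0
  · exact (h1 e (mem_innerEdges.2 he) h0).le
  · have := hφ e he h0.symm
    rw [map_add, map_smul, ← h0, zero_add, smul_eq_mul]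
    exact mul_nonneg (le_of_lt h2) this

/-- If `G` has no convex modification in the interior, this is witnessed by a weight that is
positive exactly on the edges of length zero of some convex hive. -/
theorem exists_dual_weight
    (hG : ¬ ∃ H, IsConvexHive n H ∧ ∀ v, ¬ IsInterior n v → H v = G v) :
    ∃ (t : ℝ) (h : ℤ × ℤ → ℝ) (w : Edge → ℝ), (0 ≤ t ∧ t < 1) ∧ IsConvexHive n h ∧
      (∀ v, ¬ IsInterior n v → h v = (1 - t) * quadHive v + t * G v) ∧
      (∀ e : Edge, e.IsInner n → hlen e h = 0 → 0 < w e) ∧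
      (∀ e, w e ≠ 0 → e.IsInner n ∧ hlen e h = 0) ∧
      (∀ φ : ℤ × ℤ → ℝ, (∀ v, ¬ IsInterior n v → φ v = 0) →
        ∑ e ∈ innerEdges n, w e * hlen e φ = 0) ∧
      ∑ e ∈ innerEdges n, w e * hlen e G < 0 := by
  classical
  -- The last parameter `t` for which a convex hive exists.
  obtain ⟨⟨t, h0⟩, hmem, hmax⟩ := (isCompact_hivePath n G).exists_isMaxOn
    ⟨(0, quadHive), ⟨by simp, by simp, fun e _ => by rw [hlen_quadHive]; norm_num⟩⟩
    continuous_fst.continuousOn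
  set Zs : (ℤ × ℤ → ℝ) → Finset Edge := fun h => (innerEdges n).filter fun e => hlen e h = 0
    with hZs
  -- Among the convex hives at this parameter, take one with the fewest flat edges, so that no
  -- interior perturbation can resolve a flat edge while keeping the others nonnegative.
  obtain ⟨h, hh, hmin⟩ : ∃ h, (t, h) ∈ hivePath n G ∧
      ∀ h', (t, h') ∈ hivePath n G → (Zs h).card ≤ (Zs h').card := by
    have hne : {h | (t, h) ∈ hivePath n G}.Nonempty := ⟨h0, hmem⟩
    refine ⟨Function.argminOn (fun h => (Zs h).card) _ hne,
      Function.argminOn_mem (fun h => (Zs h).card) _ hne, fun h' hh' => ?_⟩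
    exact Function.argminOn_le (fun h => (Zs h).card) _ hh'
  obtain ⟨ht, hb, hc⟩ := hh
  simp only at ht hb hc
  have ht1 : t < 1 := by
    refine lt_of_le_of_ne ht.2 ?_
    rintro rfl
    exact hG ⟨h, hc, fun v hv => by rw [hb v hv]; ring⟩
  -- With no flat edge, a small step further towards `G` would stay convex, against the maximality
  -- of `t`.
  have hZne : (Zs h).Nonempty := by
    by_contra hne
    rw [Finset.not_nonempty_iff_eq_empty] at hne
    have hno : ∀ e : Edge, e.IsInner n → hlen e h ≠ 0 := by
      intro e he h0
      have : e ∈ Zs h := by simp [hZs, mem_innerEdges, he, h0]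
      simp [hne] at this
    obtain ⟨ε, e0, e1, hconv, -⟩ := exists_perturbation n (h := h) (φ := G - quadHive) hc
      (fun e he h0 => absurd h0 (hno e he)) (1 - t) (by linarith)
    have := hmax (show (t + ε, h + ε • (G - quadHive)) ∈ hivePath n G from
      ⟨⟨by linarith [ht.1], by linarith⟩, fun v hv => by
        simp only [Pi.add_apply, Pi.smul_apply, Pi.sub_apply, smul_eq_mul, hb v hv]; ring, hconv⟩)
    simp only [Set.mem_ofPred_eq] at this
    linarith
  let K : Submodule ℝ (ℤ × ℤ → ℝ) :=
    { carrier := {φ | ∀ v, ¬ IsInterior n v → φ v = 0}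
      add_mem' := fun ha hb v hv => by simp [ha v hv, hb v hv]
      zero_mem' := fun v _ => rfl
      smul_mem' := fun a φ hφ v hv => by simp [hφ v hv] }
  let T : (ℤ × ℤ → ℝ) →ₗ[ℝ] (Zs h → ℝ) := LinearMap.pi fun e => hlen e.1
  -- Stiemke's hypothesis is the minimality of `h`: a perturbation with nonnegative and not all zero
  -- lengths on the flat edges would strictly shrink their set.
  obtain ⟨w, hw, hort⟩ := exists_pos_orthogonal (K.map T) (by
    rintro u ⟨φ, hφ, rfl⟩ hu
    by_contra hne
    obtain ⟨ε, e0, -, hconv, hpos⟩ := exists_perturbation n (h := h) (φ := φ) hc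
      (fun e he h0 => hu ⟨e, by simp [hZs, mem_innerEdges, he, h0]⟩) 1 one_pos
    have hlt : Zs (h + ε • φ) ⊂ Zs h := by
      rw [Finset.ssubset_iff_of_subset]
      · obtain ⟨e, he⟩ := Function.ne_iff.1 hne
        refine ⟨e.1, e.2, fun hmem => he ?_⟩
        have h1 := (Finset.mem_filter.1 e.2).2
        have h2 := (Finset.mem_filter.1 hmem).2
        rw [map_add, map_smul, h1, zero_add, smul_eq_mul] at h2
        exact (mul_eq_zero.1 h2).resolve_left e0.ne'
      · intro e he
        simp only [hZs, Finset.mem_filter, mem_innerEdges] at he ⊢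
        refine ⟨he.1, ?_⟩
        by_contra h0
        exact (hpos e he.1 (lt_of_le_of_ne (hc e he.1) (Ne.symm h0))).ne' he.2
    exact absurd (Finset.card_lt_card hlt) (not_lt.2 (hmin _ ⟨ht, fun v hv => by
      simp [hb v hv, hφ v hv], hconv⟩)))
  set w' : Edge → ℝ := fun e => if he : e ∈ Zs h then w ⟨e, he⟩ else 0 with hw'
  have hsum : ∀ f : Edge → ℝ, ∑ e ∈ innerEdges n, w' e * f e = ∑ e : Zs h, w e * f e := by
    intro f
    rw [← Finset.sum_subset (Finset.filter_subset (fun e => hlen e h = 0) (innerEdges n))]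
    · rw [← Finset.sum_coe_sort]
      refine Finset.sum_congr rfl fun e _ => ?_
      have he : e.1 ∈ Zs h := e.2
      simp only [hw', dif_pos he]
      rfl
    · intro e _ he
      have : w' e = 0 := dif_neg he
      rw [this, zero_mul]
  have hφ0 : ∀ φ : ℤ × ℤ → ℝ, (∀ v, ¬ IsInterior n v → φ v = 0) →
      ∑ e ∈ innerEdges n, w' e * hlen e φ = 0 := by
    intro φ hφ
    rw [hsum fun e => hlen e φ]
    exact hort (T φ) ⟨φ, hφ, rfl⟩
  refine ⟨t, h, w', ⟨ht.1, ht1⟩, hc, hb, fun e he h0 => ?_, fun e he => ?_, hφ0, ?_⟩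
  · have : e ∈ Zs h := by simp [hZs, mem_innerEdges, he, h0]
    simp only [hw', dif_pos this]
    exact hw _
  · by_cases hZ : e ∈ Zs h
    · simpa [hZs, mem_innerEdges] using hZ
    · exact absurd (dif_neg hZ) he
  -- The weight annihilates `h - (1 - t) • quadHive - t • G`, which vanishes off the interior, and
  -- it annihilates `h`. Hence `t` times the pairing with `G` equals `-(1 - t)` times the positive
  -- pairing with `quadHive`.
  · have h1 := hφ0 (h - (1 - t) • quadHive - t • G) (fun v hv => by
      simp only [Pi.sub_apply, Pi.smul_apply, smul_eq_mul, hb v hv]; ring)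
    have h2 : ∑ e ∈ innerEdges n, w' e * hlen e h = 0 := by
      rw [hsum fun e => hlen e h]
      refine Finset.sum_eq_zero fun e _ => ?_
      rw [(Finset.mem_filter.1 e.2).2, mul_zero]
    have h3 : 0 < ∑ e ∈ innerEdges n, w' e * hlen e quadHive := by
      rw [hsum fun e => hlen e quadHive]
      refine Finset.sum_pos (fun e _ => ?_) ?_
      · rw [hlen_quadHive, mul_one]; exact hw e
      · obtain ⟨e, he⟩ := hZne
        exact ⟨⟨e, he⟩, Finset.mem_univ _⟩
    have h4 : ∑ e ∈ innerEdges n, w' e * hlen e (h - (1 - t) • quadHive - t • G) =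
        ∑ e ∈ innerEdges n, w' e * hlen e h
          - (1 - t) * ∑ e ∈ innerEdges n, w' e * hlen e quadHive
          - t * ∑ e ∈ innerEdges n, w' e * hlen e G := by
      rw [Finset.mul_sum, Finset.mul_sum, ← Finset.sum_sub_distrib, ← Finset.sum_sub_distrib]
      refine Finset.sum_congr rfl fun e _ => ?_
      simp only [map_sub, map_smul, smul_eq_mul]; ring
    rw [h1, h2] at h4
    have h5 : 0 < (1 - t) * ∑ e ∈ innerEdges n, w' e * hlen e quadHive :=
      mul_pos (by linarith) h3
    by_contra hge
    have := mul_nonneg ht.1 (not_lt.1 hge)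
    linarith

end Path

/-! ## Edges around a lattice point -/

/-- The unit lattice vector at the angle of `k * 60` degrees. -/
def dir : Fin 6 → ℤ × ℤ := ![(1, 0), (0, 1), (-1, 1), (-1, 0), (0, -1), (1, -1)]

/-- The neighbor of `v` in the direction `k`. -/
def nb (v : ℤ × ℤ) (k : Fin 6) : ℤ × ℤ := v + dir k

/-- The edge from `v` in the direction `k`. -/
def spoke (v : ℤ × ℤ) : Fin 6 → Edge :=
  ![⟨v.1, v.2, .south⟩, ⟨v.1, v.2, .northwest⟩, ⟨v.1 - 1, v.2, .northeast⟩,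
    ⟨v.1 - 1, v.2, .south⟩, ⟨v.1, v.2 - 1, .northwest⟩, ⟨v.1, v.2 - 1, .northeast⟩]

theorem fin_six_cases : ∀ i k : Fin 6,
    i = k ∨ i = k + 1 ∨ i = k + 2 ∨ i = k + 3 ∨ i = k + 4 ∨ i = k + 5 := by decide

theorem nb_nb_two (v : ℤ × ℤ) (k : Fin 6) : nb (nb v k) (k + 2) = nb v (k + 1) := by
  rw [nb, nb, nb, add_assoc]; congr 1; revert k; decide

theorem nb_nb_three (v : ℤ × ℤ) (k : Fin 6) : nb (nb v k) (k + 3) = v := by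
  rw [nb, nb, add_assoc]; convert add_zero v; revert k; decide

theorem nb_nb_four (v : ℤ × ℤ) (k : Fin 6) : nb (nb v k) (k + 4) = nb v (k + 5) := by
  rw [nb, nb, nb, add_assoc]; congr 1; revert k; decide

theorem spoke_nb (v : ℤ × ℤ) (k : Fin 6) : spoke (nb v k) (k + 3) = spoke v k := by
  fin_cases k <;> simp [spoke, nb, dir, ← sub_eq_add_neg]

theorem exists_spoke (e : Edge) : ∃ v k, e = spoke v k := by
  obtain ⟨x, y, s⟩ := e
  cases s
  · exact ⟨(x, y), 0, rfl⟩
  · exact ⟨(x, y), 1, rfl⟩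
  · exact ⟨(x + 1, y), 2, by simp [spoke]⟩

theorem hlen_spoke (H : ℤ × ℤ → ℝ) (v : ℤ × ℤ) (k : Fin 6) : hlen (spoke v k) H =
    H (nb v (k + 1)) + H (nb v (k + 5)) - H v - H (nb v k) := by
  obtain ⟨x, y⟩ := v
  fin_cases k <;>
    simp [spoke, nb, dir, hlen_south, hlen_northwest, hlen_northeast, ← sub_eq_add_neg] <;> ring

theorem exists_adjacent_spokes (t : Tri) {r s : Side} (h : r ≠ s) :
    ∃ v k, (t.edge r = spoke v k ∧ t.edge s = spoke v (k + 1)) ∨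
      (t.edge s = spoke v k ∧ t.edge r = spoke v (k + 1)) := by
  cases t with
  | up x y =>
    have h1 : (Tri.up x y).edge .south = spoke (x, y) 0 ∧
      (Tri.up x y).edge .northwest = spoke (x, y) (0 + 1) := by simp [Tri.edge, spoke]
    have h2 : (Tri.up x y).edge .northeast = spoke (x + 1, y) 2 ∧
      (Tri.up x y).edge .south = spoke (x + 1, y) (2 + 1) := by simp [Tri.edge, spoke]
    have h3 : (Tri.up x y).edge .northwest = spoke (x, y + 1) 4 ∧
      (Tri.up x y).edge .northeast = spoke (x, y + 1) (4 + 1) := by simp [Tri.edge, spoke]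
    cases r <;> cases s <;> first
      | exact absurd rfl h
      | exact ⟨_, _, Or.inl h1⟩
      | exact ⟨_, _, Or.inr h1⟩
      | exact ⟨_, _, Or.inl h2⟩
      | exact ⟨_, _, Or.inr h2⟩
      | exact ⟨_, _, Or.inl h3⟩
      | exact ⟨_, _, Or.inr h3⟩
  | down x y =>
    have h1 : (Tri.down x y).edge .northwest = spoke (x + 1, y) 1 ∧
      (Tri.down x y).edge .northeast = spoke (x + 1, y) (1 + 1) := by simp [Tri.edge, spoke]
    have h2 : (Tri.down x y).edge .northeast = spoke (x, y + 1) 5 ∧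
      (Tri.down x y).edge .south = spoke (x, y + 1) (5 + 1) := by simp [Tri.edge, spoke]
    have h3 : (Tri.down x y).edge .south = spoke (x + 1, y + 1) 3 ∧
      (Tri.down x y).edge .northwest = spoke (x + 1, y + 1) (3 + 1) := by simp [Tri.edge, spoke]
    cases r <;> cases s <;> first
      | exact absurd rfl h
      | exact ⟨_, _, Or.inl h1⟩
      | exact ⟨_, _, Or.inr h1⟩
      | exact ⟨_, _, Or.inl h2⟩
      | exact ⟨_, _, Or.inr h2⟩
      | exact ⟨_, _, Or.inl h3⟩
      | exact ⟨_, _, Or.inr h3⟩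

theorem isInner_spoke {n : ℕ} {v : ℤ × ℤ} (hv : IsInterior n v) (k : Fin 6) :
    (spoke v k).IsInner n := by
  obtain ⟨x, y⟩ := v
  obtain ⟨h1, h2, h3⟩ := hv
  simp only at h1 h2 h3
  fin_cases k <;> simp [spoke, Edge.IsInner, Edge.downTri, Tri.InTriangle] <;> omega

/-- A property of interior points that is inherited by the neighbor in a fixed direction never
holds. -/
theorem not_of_propagates {n : ℕ} {R : ℤ × ℤ → Prop} (hR : ∀ v, R v → IsInterior n v)
    (k : Fin 6) (hk : ∀ v, R v → R (nb v k)) (v : ℤ × ℤ) : ¬ R v := by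
  intro hv
  have : ∀ m : ℕ, R (v + m • dir k) := by
    intro m
    induction m with
    | zero => simpa using hv
    | succ m ih => rw [succ_nsmul, ← add_assoc]; exact hk _ ih
  have h0 := hR _ hv
  have h1 := hR _ (this (n + 1))
  obtain ⟨x, y⟩ := v
  simp only [IsInterior] at h0 h1
  fin_cases k <;> simp [dir] at h1 <;> omega

/-! ## Simple degeneracies -/

section Degeneracies
variable {n : ℕ} (A : ℤ × ℤ → Fin 6 → Prop)

/-- Sets of edges, given by the directions of their edges at each point, that look locally like the
set of edges of length zero of a honeycomb. -/
structure IsFlatSet (n : ℕ) (A : ℤ × ℤ → Fin 6 → Prop) : Prop where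
  symm : ∀ v k, A (nb v k) (k + 3) ↔ A v k
  three : ∀ v k, A v k → A v (k + 1) → A v (k + 3)
  four : ∀ v k, A v k → A v (k + 1) → A v (k + 4)
  two_five : ∀ v k, A v k → A v (k + 1) → (A v (k + 2) ↔ A v (k + 5))
  interior : ∀ v k, A v k → A v (k + 1) → IsInterior n v

open Classical in
/-- The dimension of the cell of the point `v` in the subdivision into flat regions. -/
noncomputable def cellDim (v : ℤ × ℤ) : ℕ :=
  (if ∃ k, A v k ∧ A v (k + 1) then 1 else 0) + (if ∀ k, A v k then 1 else 0)

variable {A} (hA : IsFlatSet n A)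

theorem all_of_six {p : Fin 6 → Prop} (k : Fin 6) (h0 : p k) (h1 : p (k + 1)) (h2 : p (k + 2))
    (h3 : p (k + 3)) (h4 : p (k + 4)) (h5 : p (k + 5)) (i : Fin 6) : p i := by
  rcases fin_six_cases i k with rfl | rfl | rfl | rfl | rfl | rfl <;> assumption

theorem fin_six_add_one : ∀ k : Fin 6, k + 1 + 1 = k + 2 ∧ k + 2 + 1 = k + 3 ∧ k + 3 + 1 = k + 4 ∧
    k + 4 + 1 = k + 5 ∧ k + 5 + 1 = k := by decide

include hA in
theorem IsFlatSet.all_of_three {v : ℤ × ℤ} {k : Fin 6} (h0 : A v k) (h1 : A v (k + 1))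
    (h2 : A v (k + 2)) : ∀ i, A v i :=
  all_of_six k h0 h1 h2 (hA.three v k h0 h1) (hA.four v k h0 h1) ((hA.two_five v k h0 h1).1 h2)

include hA in
-- Two adjacent flat spokes force the opposite two to be flat. Only one opposite pair can then be
-- missing, so a missing spoke leaves the four spokes outside its own line.
theorem IsFlatSet.next_of_not {v : ℤ × ℤ} (h : ∃ k, A v k ∧ A v (k + 1)) {i : Fin 6}
    (hi : ¬ A v i) : A v (i + 1) ∧ A v (i + 2) ∧ A v (i + 4) ∧ A v (i + 5) := by
  obtain ⟨k, h0, h1⟩ := h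
  have h3 := hA.three v k h0 h1
  have h4 := hA.four v k h0 h1
  have e : ∀ k : Fin 6, k + 2 + 1 = k + 3 ∧ k + 2 + 2 = k + 4 ∧ k + 2 + 4 = k ∧ k + 2 + 5 = k + 1 ∧
    k + 5 + 1 = k ∧ k + 5 + 2 = k + 1 ∧ k + 5 + 4 = k + 3 ∧ k + 5 + 5 = k + 4 := by decide
  obtain ⟨e1, e2, e3, e4, e5, e6, e7, e8⟩ := e k
  rcases fin_six_cases i k with rfl | rfl | rfl | rfl | rfl | rfl
  · exact absurd h0 hi
  · exact absurd h1 hi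
  · rw [e1, e2, e3, e4]; exact ⟨h3, h4, h0, h1⟩
  · exact absurd h3 hi
  · exact absurd h4 hi
  · rw [e5, e6, e7, e8]; exact ⟨h0, h1, h3, h4⟩

/-- The propositional core of `IsFlatSet.cellDim_le`. `P`, `Q` concern the two far corners and `A`,
`C` the ends of the flat edge; `x1`, `x5`, `y2`, `y4` are flatness of the four sides of the rhombus.
-/
theorem ite_add_ite_le {P1 P2 Q1 Q2 A1 A2 C1 C2 x1 x5 y2 y4 : Prop} [Decidable P1]
    [Decidable P2] [Decidable Q1] [Decidable Q2] [Decidable A1] [Decidable A2] [Decidable C1]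
    [Decidable C2]
    (a1 : x1 → A1) (a5 : x5 → A1) (a15 : x1 → x5 → A2) (c2 : y2 → C1) (c4 : y4 → C1)
    (c24 : y2 → y4 → C2) (p1 : P1 → x1 ∨ y2) (q1 : Q1 → x5 ∨ y4) (p2 : P2 → x1 ∧ y2)
    (q2 : Q2 → x5 ∧ y4) (up : P2 → P1) (uq : Q2 → Q1) (ua : A2 → A1) (uc : C2 → C1) :
    ((if P1 then 1 else 0) + (if P2 then 1 else 0)) +
      ((if Q1 then 1 else 0) + (if Q2 then 1 else 0)) ≤
    ((if A1 then 1 else 0) + (if A2 then 1 else 0)) +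
      ((if C1 then 1 else 0) + (if C2 then 1 else 0) : ℕ) := by
  classical
  by_cases x1 <;> by_cases x5 <;> by_cases y2 <;> by_cases y4 <;> simp_all <;>
    (try split_ifs) <;> simp_all

include hA in
/-- The cell dimension is concave along flat edges. -/
theorem IsFlatSet.cellDim_le {a : ℤ × ℤ} {k : Fin 6} (h : A a k) :
    cellDim A (nb a (k + 1)) + cellDim A (nb a (k + 5)) ≤ cellDim A a + cellDim A (nb a k) := by
  set c := nb a k with hc
  set p := nb a (k + 1) with hp
  set q := nb a (k + 5) with hq
  have hk : ∀ k : Fin 6, k + 1 + 3 = k + 4 ∧ k + 5 + 3 = k + 2 ∧ k + 2 + 3 = k + 5 ∧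
    k + 4 + 3 = k + 1 ∧ k + 5 + 2 = k + 1 ∧ k + 2 + 2 = k + 4 := by decide
  obtain ⟨e1, e2, e3, e4, -, -⟩ := hk k
  obtain ⟨f1, f2, f3, f4, f5⟩ := fin_six_add_one k
  have ap : A p (k + 4) ↔ A a (k + 1) := by rw [← e1]; exact hA.symm a (k + 1)
  have aq : A q (k + 2) ↔ A a (k + 5) := by rw [← e2]; exact hA.symm a (k + 5)
  have cp : A p (k + 5) ↔ A c (k + 2) := by
    rw [hp, ← nb_nb_two, ← hc, ← hA.symm c (k + 2), e3]
  have cq : A q (k + 1) ↔ A c (k + 4) := by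
    rw [hq, ← nb_nb_four, ← hc, ← hA.symm c (k + 4), e4]
  have ac : A c (k + 3) := (hA.symm a k).2 h
  have a1 : A a (k + 1) → ∃ k, A a k ∧ A a (k + 1) := fun h' => ⟨k, h, h'⟩
  have a5 : A a (k + 5) → ∃ k, A a k ∧ A a (k + 1) := fun h' => ⟨k + 5, h', by rw [f5]; exact h⟩
  have a15 : A a (k + 1) → A a (k + 5) → ∀ k, A a k := fun h1 h5 =>
    hA.all_of_three h5 (by rw [f5]; exact h) (by
      rw [show k + 5 + 2 = k + 1 from (hk k).2.2.2.2.1]; exact h1)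
  have c2 : A c (k + 2) → ∃ k, A c k ∧ A c (k + 1) := fun h' => ⟨k + 2, h', by rw [f2]; exact ac⟩
  have c4 : A c (k + 4) → ∃ k, A c k ∧ A c (k + 1) := fun h' => ⟨k + 3, ac, by rw [f3]; exact h'⟩
  have c24 : A c (k + 2) → A c (k + 4) → ∀ k, A c k := fun h2 h4 =>
    hA.all_of_three h2 (by rw [f2]; exact ac) (by
      rw [show k + 2 + 2 = k + 4 from (hk k).2.2.2.2.2]; exact h4)
  -- The two sides of the rhombus at `p` are adjacent spokes, and a point of positive cell dimension
  -- cannot miss two adjacent spokes.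
  have p1 : (∃ k, A p k ∧ A p (k + 1)) → A a (k + 1) ∨ A c (k + 2) := by
    intro h1
    rw [← ap, ← cp]
    by_contra hn
    push Not at hn
    exact hn.2 (f4 ▸ (hA.next_of_not h1 hn.1).1)
  have q1 : (∃ k, A q k ∧ A q (k + 1)) → A a (k + 5) ∨ A c (k + 4) := by
    intro h1
    rw [← aq, ← cq]
    by_contra hn
    push Not at hn
    exact hn.1 (f1 ▸ (hA.next_of_not h1 hn.2).1)
  have p2 : (∀ k, A p k) → A a (k + 1) ∧ A c (k + 2) := fun h => ⟨ap.1 (h _), cp.1 (h _)⟩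
  have q2 : (∀ k, A q k) → A a (k + 5) ∧ A c (k + 4) := fun h => ⟨aq.1 (h _), cq.1 (h _)⟩
  have up : (∀ k, A p k) → ∃ k, A p k ∧ A p (k + 1) := fun h => ⟨0, h _, h _⟩
  have uq : (∀ k, A q k) → ∃ k, A q k ∧ A q (k + 1) := fun h => ⟨0, h _, h _⟩
  have ua : (∀ k, A a k) → ∃ k, A a k ∧ A a (k + 1) := fun h => ⟨0, h _, h _⟩
  have uc : (∀ k, A c k) → ∃ k, A c k ∧ A c (k + 1) := fun h => ⟨0, h _, h _⟩
  classical
  unfold cellDim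
  convert ite_add_ite_le a1 a5 a15 c2 c4 c24 p1 q1 p2 q2 up uq ua uc

theorem cellDim_le_two (v : ℤ × ℤ) : cellDim A v ≤ 2 := by
  unfold cellDim; split_ifs <;> omega

theorem cellDim_eq_two_iff {v : ℤ × ℤ} : cellDim A v = 2 ↔ ∀ k, A v k := by
  unfold cellDim
  constructor
  · intro h; split_ifs at h with h1 h2 <;> first | assumption | omega
  · intro h; rw [if_pos ⟨0, h _, h _⟩, if_pos h]

theorem cellDim_ne_zero_iff {v : ℤ × ℤ} : cellDim A v ≠ 0 ↔ ∃ k, A v k ∧ A v (k + 1) := by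
  unfold cellDim
  constructor
  · intro h
    by_contra h1
    rw [if_neg h1, if_neg (fun h => h1 ⟨0, h _, h _⟩)] at h
    exact h rfl
  · intro h; rw [if_pos h]; omega

include hA in
-- Equality in the concavity of `cellDim` makes positive cell dimension spread along a ray, which
-- eventually leaves the lattice triangle.
theorem IsFlatSet.not_adjacent (heq : ∀ a k, A a k →
    cellDim A (nb a (k + 1)) + cellDim A (nb a (k + 5)) = cellDim A a + cellDim A (nb a k))
    (v : ℤ × ℤ) (k : Fin 6) (h0 : A v k) (h1 : A v (k + 1)) : False := by
  have hle := cellDim_le_two (A := A)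
  -- Adding the six equalities at a point of dimension two makes the dimensions of its neighbors sum
  -- to `12`. Each is at most `2`, so all neighbors have dimension two.
  have no2 : ∀ v, ¬ ∀ k, A v k := by
    refine not_of_propagates (n := n) (fun v h => hA.interior v 0 (h _) (h _)) 0 fun v h => ?_
    have hv := cellDim_eq_two_iff.2 h
    rw [← cellDim_eq_two_iff]
    have g0 := heq v 0 (h _)
    have g1 := heq v 1 (h _)
    have g2 := heq v 2 (h _)
    have g3 := heq v 3 (h _)
    have g4 := heq v 4 (h _)
    have g5 := heq v 5 (h _)
    simp only [Fin.isValue, Fin.reduceAdd, zero_add] at g0 g1 g2 g3 g4 g5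
    have := hle (nb v 0)
    have := hle (nb v 1)
    have := hle (nb v 2)
    have := hle (nb v 3)
    have := hle (nb v 4)
    have := hle (nb v 5)
    omega
  have hle1 : ∀ v, cellDim A v ≤ 1 := by
    intro v
    have h1 := hle v
    have h2 := (cellDim_eq_two_iff (A := A) (v := v)).not.2 (no2 v)
    omega
  refine not_of_propagates (n := n) (R := fun v => A v k ∧ A v (k + 1))
    (fun v h => hA.interior v k h.1 h.2) (k + 2) (fun v h => ?_) v ⟨h0, h1⟩
  -- Adding the equalities for the two flat edges gives total dimension `2` at the neighbors `k + 2`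
  -- and `k + 5`, hence one at each. The edge joining `v` to the neighbor `k + 2` is not flat, so
  -- the same pair of directions is flat there.
  have g0 := heq v k h.1
  have g1 := heq v (k + 1) h.2
  have e : k + 1 + 5 = k ∧ k + 1 + 1 = k + 2 ∧ k + 2 + 3 = k + 5 ∧ k + 5 + 1 = k ∧
    k + 5 + 2 = k + 1 := by clear * -; revert k; decide
  obtain ⟨e1, e2, e3, e4, e5⟩ := e
  rw [e1, e2] at g1
  have hv : cellDim A v ≠ 0 := cellDim_ne_zero_iff.2 ⟨k, h⟩
  have l1 := hle1 (nb v (k + 2))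
  have l2 := hle1 (nb v (k + 5))
  have hn2 : cellDim A (nb v (k + 2)) ≠ 0 := by omega
  have hnot : ¬ A (nb v (k + 2)) (k + 5) := by
    rw [← e3, hA.symm]
    exact fun h2 => no2 v (hA.all_of_three h.1 h.2 h2)
  have := hA.next_of_not (cellDim_ne_zero_iff.1 hn2) hnot
  rw [e4, e5] at this
  exact ⟨this.1, this.2.1⟩

end Degeneracies

/-- Two adjacent lengths add up to a second difference along a lattice line through `v`. -/
theorem hlen_spoke_add (H : ℤ × ℤ → ℝ) (v : ℤ × ℤ) (k : Fin 6) :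
    hlen (spoke v k) H + hlen (spoke v (k + 1)) H =
      H (nb v (k + 2)) + H (nb v (k + 5)) - 2 * H v := by
  have e : k + 1 + 5 = k ∧ k + 1 + 1 = k + 2 := by revert k; decide
  rw [hlen_spoke, hlen_spoke, e.1, e.2]; ring

/-- The edges of length zero of a convex hive that is strictly convex along the sides. -/
theorem isFlatSet_of_hive {n : ℕ} {h : ℤ × ℤ → ℝ} (hc : IsConvexHive n h)
    (hs : ∀ s (i : ℕ) (hi : i + 1 < n),
      incr h (boundaryEdge n s ⟨i + 1, hi⟩) < incr h (boundaryEdge n s ⟨i, by omega⟩)) :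
    IsFlatSet n fun v k => (spoke v k).IsInner n ∧ hlen (spoke v k) h = 0 := by
  have hint : ∀ v k, ((spoke v k).IsInner n ∧ hlen (spoke v k) h = 0) →
      ((spoke v (k + 1)).IsInner n ∧ hlen (spoke v (k + 1)) h = 0) → IsInterior n v := by
    rintro ⟨x, y⟩ k ⟨hk, hk0⟩ ⟨hk1, hk10⟩
    -- At a point off the interior, two adjacent spokes can both be inner only along a side.
    -- Flatness would make the hive linear along that side, against the strict decrease of the
    -- increments.
    by_contra hv
    have hsum := hlen_spoke_add h (x, y) k
    rw [hk0, hk10] at hsum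
    fin_cases k <;>
      simp [spoke, Edge.IsInner, Edge.downTri, Tri.InTriangle, IsInterior] at hk hk1 hv
    · omega
    · have hy : y = 0 := by omega
      subst hy
      have := hs .south (n - 1 - x).toNat (by omega)
      simp only [boundaryEdge, incr, Edge.source, Edge.target] at this
      push_cast [Int.toNat_of_nonneg (show (0 : ℤ) ≤ n - 1 - x by omega)] at this
      simp [nb, dir, ← sub_eq_add_neg] at hsum
      ring_nf at this hsum
      linarith
    · omega
    · have hy : y = n - x := by omega
      subst hy
      have := hs .northeast (x - 1).toNat (by omega)
      simp only [boundaryEdge, incr, Edge.source, Edge.target] at this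
      push_cast [Int.toNat_of_nonneg (show (0 : ℤ) ≤ x - 1 by omega)] at this
      simp [nb, dir, ← sub_eq_add_neg] at hsum
      ring_nf at this hsum
      linarith
    · omega
    · have hy : x = 0 := by omega
      subst hy
      have := hs .northwest (y - 1).toNat (by omega)
      simp only [boundaryEdge, incr, Edge.source, Edge.target] at this
      push_cast [Int.toNat_of_nonneg (show (0 : ℤ) ≤ y - 1 by omega)] at this
      simp [nb, dir, ← sub_eq_add_neg] at hsum
      ring_nf at this hsum
      linarith
  have e : ∀ k : Fin 6, k + 3 + 2 = k + 5 ∧ k + 3 + 5 = k + 2 ∧ k + 3 + 1 = k + 4 ∧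
    k + 1 + 5 = k ∧ k + 1 + 2 = k + 3 ∧ k + 1 + 1 = k + 2 ∧ k + 4 + 1 = k + 5 ∧ k + 4 + 2 = k ∧
    k + 4 + 5 = k + 3 := by decide
  -- The spokes `k + 3`, `k + 4` have the same second difference as `k`, `k + 1`, namely zero, and
  -- their lengths are nonnegative. Comparing second differences along the direction `k` then
  -- equates the remaining two lengths.
  have key : ∀ v k, ((spoke v k).IsInner n ∧ hlen (spoke v k) h = 0) →
      ((spoke v (k + 1)).IsInner n ∧ hlen (spoke v (k + 1)) h = 0) →
      hlen (spoke v (k + 3)) h = 0 ∧ hlen (spoke v (k + 4)) h = 0 ∧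
        hlen (spoke v (k + 2)) h = hlen (spoke v (k + 5)) h := by
    intro v k hk hk1
    have hv := hint v k hk hk1
    obtain ⟨e1, e2, e3, e4, e5, e6, e7, e8, e9⟩ := e k
    have s0 := hlen_spoke_add h v k
    have s3 := hlen_spoke_add h v (k + 3)
    have s1 := hlen_spoke_add h v (k + 1)
    have s4 := hlen_spoke_add h v (k + 4)
    rw [e1, e2, e3] at s3
    rw [e4, e5, e6] at s1
    rw [e7, e8, e9] at s4
    have p3 := hc _ (isInner_spoke hv (k + 3))
    have p4 := hc _ (isInner_spoke hv (k + 4))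
    rw [hk.2, hk1.2] at s0
    rw [hk1.2] at s1
    refine ⟨?_, ?_, ?_⟩ <;> linarith
  refine ⟨fun v k => by rw [spoke_nb], fun v k h0 h1 => ?_, fun v k h0 h1 => ?_,
    fun v k h0 h1 => ?_, hint⟩
  · exact ⟨isInner_spoke (hint v k h0 h1) _, (key v k h0 h1).1⟩
  · exact ⟨isInner_spoke (hint v k h0 h1) _, (key v k h0 h1).2.1⟩
  · rw [(key v k h0 h1).2.2]
    exact and_congr_left fun _ => iff_of_true (isInner_spoke (hint v k h0 h1) _)
      (isInner_spoke (hint v k h0 h1) _)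

/-- The edges of length zero are a matching if they carry a positive balanced weight. -/
theorem matching_of_weight {n : ℕ} {h : ℤ × ℤ → ℝ} (hc : IsConvexHive n h)
    (hs : ∀ s (i : ℕ) (hi : i + 1 < n),
      incr h (boundaryEdge n s ⟨i + 1, hi⟩) < incr h (boundaryEdge n s ⟨i, by omega⟩))
    {w : Edge → ℝ} (hw : ∀ e : Edge, e.IsInner n → hlen e h = 0 → 0 < w e)
    (hw0 : ∀ e, w e ≠ 0 → e.IsInner n ∧ hlen e h = 0)
    (hbal : ∀ φ : ℤ × ℤ → ℝ, (∀ v, ¬ IsInterior n v → φ v = 0) →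
        ∑ e ∈ innerEdges n, w e * hlen e φ = 0) (t : Tri) (r s : Side)
    (hr : (t.edge r).IsInner n ∧ hlen (t.edge r) h = 0)
    (hs' : (t.edge s).IsInner n ∧ hlen (t.edge s) h = 0) : r = s := by
  have hA := isFlatSet_of_hive hc hs
  set A : ℤ × ℤ → Fin 6 → Prop := fun v k => (spoke v k).IsInner n ∧ hlen (spoke v k) h = 0
    with hAdef
  -- An admissible test function with nonnegative length on every flat edge. A positive balanced
  -- weight therefore forces all these lengths to be zero.
  set φ : ℤ × ℤ → ℝ := fun v => -(cellDim A v : ℝ) with hφ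
  have hφ0 : ∀ v, ¬ IsInterior n v → φ v = 0 := by
    intro v hv
    by_contra hne
    have : cellDim A v ≠ 0 := by
      intro h0; apply hne; simp [hφ, h0]
    obtain ⟨k, h0, h1⟩ := cellDim_ne_zero_iff.1 this
    exact hv (hA.interior v k h0 h1)
  have hnn : ∀ v k, A v k → 0 ≤ hlen (spoke v k) φ := by
    intro v k hk
    have := hA.cellDim_le hk
    have : (cellDim A (nb v (k + 1)) + cellDim A (nb v (k + 5)) : ℝ) ≤
      cellDim A v + cellDim A (nb v k) := by exact_mod_cast this
    rw [hlen_spoke]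
    simp only [hφ]
    linarith
  have hterm : ∀ e ∈ innerEdges n, 0 ≤ w e * hlen e φ := by
    intro e _
    by_cases h0 : w e = 0
    · rw [h0, zero_mul]
    · obtain ⟨v, k, rfl⟩ := exists_spoke e
      have hk := hw0 _ h0
      exact mul_nonneg (hw _ hk.1 hk.2).le (hnn v k hk)
  have hzero := (Finset.sum_eq_zero_iff_of_nonneg hterm).1 (hbal φ hφ0)
  have heq : ∀ a k, A a k → cellDim A (nb a (k + 1)) + cellDim A (nb a (k + 5)) =
      cellDim A a + cellDim A (nb a k) := by
    intro a k hk
    have h1 := hzero _ (mem_innerEdges.2 hk.1)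
    have h2 := (mul_eq_zero.1 h1).resolve_left (hw _ hk.1 hk.2).ne'
    rw [hlen_spoke] at h2
    simp only [hφ] at h2
    have : (cellDim A (nb a (k + 1)) + cellDim A (nb a (k + 5)) : ℝ) =
      cellDim A a + cellDim A (nb a k) := by linarith
    exact_mod_cast this
  by_contra hne
  obtain ⟨v, k, ⟨h1, h2⟩ | ⟨h1, h2⟩⟩ := exists_adjacent_spokes t hne
  · exact hA.not_adjacent heq v k (by rw [h1] at hr; exact hr) (by rw [h2] at hs'; exact hs')
  · exact hA.not_adjacent heq v k (by rw [h1] at hs'; exact hs') (by rw [h2] at hr; exact hr)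

/-! ## From balanced weights to puzzles -/

/-- Discrete potentials on a triangle. -/
theorem exists_lattice_potential {M : Type*} [AddCommGroup M] (m : ℤ) (a b : ℤ → ℤ → M)
    (hsq : ∀ x y, 0 ≤ x → 0 ≤ y → x + y + 2 ≤ m → a x y + b (x + 1) y = b x y + a x (y + 1)) :
    ∃ C : ℤ → ℤ → M, C 0 0 = 0 ∧ ∀ x y, 0 ≤ x → 0 ≤ y → x + y + 1 ≤ m →
      C (x + 1) y = C x y + a x y ∧ C x (y + 1) = C x y + b x y := by
  -- Integrate up the west side, then eastward; closure on unit squares gives independence of the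
  -- path.
  set C : ℤ → ℤ → M := fun x y =>
    ∑ j ∈ Finset.range y.toNat, b 0 j + ∑ i ∈ Finset.range x.toNat, a i y with hC
  have h1 : ∀ x y, 0 ≤ x → C (x + 1) y = C x y + a x y := by
    intro x y hx
    simp only [hC]
    rw [show (x + 1).toNat = x.toNat + 1 by omega, Finset.sum_range_succ, Int.toNat_of_nonneg hx,
      add_assoc]
  have h2 : ∀ (x : ℕ) (y : ℤ), 0 ≤ y → x + y + 1 ≤ m → C x (y + 1) = C x y + b x y := by
    intro x
    induction x with
    | zero =>
      intro y hy _
      simp only [hC]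
      rw [show (y + 1).toNat = y.toNat + 1 by omega, Finset.sum_range_succ,
        Int.toNat_of_nonneg hy]
      simp
    | succ x ih =>
      intro y hy h
      push_cast at h ⊢
      have e1 := h1 x (y + 1) (by omega)
      have e2 := h1 x y (by omega)
      have e3 := ih y hy (by omega)
      have e4 := hsq x y (by omega) hy (by omega)
      rw [e1, e2, e3, add_assoc (C x y), add_assoc (C x y), e4]
  refine ⟨C, by simp [hC], fun x y hx hy h => ⟨h1 x y hx, ?_⟩⟩
  have := h2 x.toNat y hy (by omega)
  rwa [Int.toNat_of_nonneg hx] at this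

theorem sum_mul_single {n : ℕ} (g : ℤ × ℤ → ℝ) (v : ℤ × ℤ) (a b : ℤ)
    (hg : ∀ p, p ∉ downIndex n → g p = 0) :
    ∑ p ∈ downIndex n, g p * (Pi.single v 1 : ℤ × ℤ → ℝ) (p.1 + a, p.2 + b) =
      g (v.1 - a, v.2 - b) := by
  have h : ∀ p : ℤ × ℤ, (Pi.single v 1 : ℤ × ℤ → ℝ) (p.1 + a, p.2 + b) =
      if p = (v.1 - a, v.2 - b) then 1 else 0 := by
    intro p
    rw [Pi.single_apply]
    congr 1
    simp only [Prod.ext_iff, eq_iff_iff]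
    omega
  simp only [h, mul_ite, mul_one, mul_zero, Finset.sum_ite_eq']
  split_ifs with h'
  · rfl
  · exact (hg _ h').symm

/-- The balance of a weight at an interior point. -/
theorem balance_of_orthogonal {n : ℕ} {w : Edge → ℝ} (hw : ∀ e, w e ≠ 0 → e.IsInner n)
    (hbal : ∀ φ : ℤ × ℤ → ℝ, (∀ v, ¬ IsInterior n v → φ v = 0) →
        ∑ e ∈ innerEdges n, w e * hlen e φ = 0) (x y : ℤ) (hv : IsInterior n (x, y)) :
    w ⟨x, y - 1, .south⟩ + w ⟨x - 1, y + 1, .south⟩ + w ⟨x - 1, y, .northwest⟩ +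
      w ⟨x + 1, y - 1, .northwest⟩ + w ⟨x, y, .northeast⟩ + w ⟨x - 1, y - 1, .northeast⟩ =
    w ⟨x, y, .south⟩ + w ⟨x - 1, y, .south⟩ + w ⟨x, y, .northwest⟩ +
      w ⟨x, y - 1, .northwest⟩ + w ⟨x - 1, y, .northeast⟩ + w ⟨x, y - 1, .northeast⟩ := by
  -- Test against the indicator of the point. The six positive terms come from rhombi with an acute
  -- corner there, the six negative ones from rhombi with an obtuse corner.
  have h := hbal (Pi.single (x, y) 1) (fun v hv' => by
    rw [Pi.single_apply, if_neg]; rintro rfl; exact hv' hv)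
  rw [sum_innerEdges] at h
  have g0 : ∀ s p, p ∉ downIndex n → w ((Tri.down p.1 p.2).edge s) = 0 := by
    intro s p hp
    by_contra hne
    have := hw _ hne
    rw [Edge.IsInner, down_edge_downTri] at this
    exact hp (mem_downIndex.2 this)
  have key := fun s a b => sum_mul_single (n := n) (fun p => w ((Tri.down p.1 p.2).edge s))
    (x, y) a b (g0 s)
  have hS : ∀ p : ℤ × ℤ, ∀ H, hlen ((Tri.down p.1 p.2).edge .south) H =
      H (p.1 + 0, p.2 + 2) + H (p.1 + 1, p.2 + 0) - H (p.1 + 0, p.2 + 1)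
        - H (p.1 + 1, p.2 + 1) := by
    intro p H
    simp only [Tri.edge, hlen_south]
    ring_nf
  have hNW : ∀ p : ℤ × ℤ, ∀ H, hlen ((Tri.down p.1 p.2).edge .northwest) H =
      H (p.1 + 2, p.2 + 0) + H (p.1 + 0, p.2 + 1) - H (p.1 + 1, p.2 + 0)
        - H (p.1 + 1, p.2 + 1) := by
    intro p H
    simp only [Tri.edge, hlen_northwest]
    ring_nf
  have hNE : ∀ p : ℤ × ℤ, ∀ H, hlen ((Tri.down p.1 p.2).edge .northeast) H =
      H (p.1 + 0, p.2 + 0) + H (p.1 + 1, p.2 + 1) - H (p.1 + 1, p.2 + 0)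
        - H (p.1 + 0, p.2 + 1) := by
    intro p H
    simp only [Tri.edge, hlen_northeast]
    ring_nf
  simp only [sum_side, hS, hNW, hNE, mul_add, mul_sub, Finset.sum_add_distrib,
    Finset.sum_sub_distrib, key] at h
  simp only [Tri.edge, sub_zero] at h
  rw [show y - 2 + 1 = y - 1 by ring, show y - 1 + 1 = y by ring, show x - 2 + 1 = x - 1 by ring,
    show x - 1 + 1 = x by ring] at h
  linarith

/-- Edge values whose differences in each triangle are given by a balanced weight. -/
theorem exists_edge_values {n : ℕ} {w : Edge → ℝ} (hw : ∀ e, w e ≠ 0 → e.IsInner n)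
    (hbal : ∀ φ : ℤ × ℤ → ℝ, (∀ v, ¬ IsInterior n v → φ v = 0) →
        ∑ e ∈ innerEdges n, w e * hlen e φ = 0) :
    ∃ y : Edge → ℝ, ∀ t : Tri, t.InTriangle n → ∃ C, ∀ s,
      y (t.edge s) = C + (w (t.edge s.next) - w (t.edge s.next.next)) / 2 := by
  -- `C` is the constant of the up triangles. Its increments are what matching the values on both
  -- sides of a down triangle forces, and closing up around a lattice point is exactly the balance
  -- of `w` there.
  obtain ⟨C, -, hC⟩ := exists_lattice_potential (n - 1)
    (fun x y => (w ⟨x, y, .south⟩ - w ⟨x, y, .northwest⟩) / 2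
      - (w ⟨x, y + 1, .south⟩ - w ⟨x + 1, y, .northwest⟩) / 2
      + (w ⟨x, y, .northeast⟩ - w ⟨x, y + 1, .south⟩) / 2
      - (w ⟨x + 1, y, .northeast⟩ - w ⟨x + 1, y, .south⟩) / 2)
    (fun x y => (w ⟨x, y, .south⟩ - w ⟨x, y, .northwest⟩) / 2
      - (w ⟨x, y + 1, .south⟩ - w ⟨x + 1, y, .northwest⟩) / 2
      + (w ⟨x + 1, y, .northwest⟩ - w ⟨x, y, .northeast⟩) / 2
      - (w ⟨x, y + 1, .northwest⟩ - w ⟨x, y + 1, .northeast⟩) / 2)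
    (by
      intro x y hx hy hxy
      have := balance_of_orthogonal hw hbal (x + 1) (y + 1)
        ⟨by simp only; omega, by simp only; omega, by simp only; omega⟩
      simp only [add_sub_cancel_right] at this
      linarith)
  refine ⟨fun e => C e.x e.y +
    (w (e.upTri.edge e.side.next) - w (e.upTri.edge e.side.next.next)) / 2, fun t ht => ?_⟩
  cases t with
  | up x y => exact ⟨C x y, fun s => rfl⟩
  | down x y =>
    obtain ⟨h1, h2, h3⟩ := ht
    obtain ⟨k1, k2⟩ := hC x y h1 h2 (by omega)
    refine ⟨C x y + (w ⟨x, y, .south⟩ - w ⟨x, y, .northwest⟩) / 2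
      - (w ⟨x, y + 1, .south⟩ - w ⟨x + 1, y, .northwest⟩) / 2, fun s => ?_⟩
    cases s <;> simp only [Tri.edge, Edge.upTri, Side.next, k1, k2] <;> ring

/-- The labeling obtained by thresholding edge values. -/
noncomputable def thresholdLabel (w y : Edge → ℝ) (θ : ℝ) (e : Edge) : Fin 3 :=
  if y e - w e / 2 < θ ∧ θ ≤ y e + w e / 2 then 2 else if θ ≤ y e then 0 else 1

theorem thresholdLabel_of_zero {w y : Edge → ℝ} {θ : ℝ} {e : Edge} (h : w e = 0) :
    thresholdLabel w y θ e = if θ ≤ y e then 0 else 1 := by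
  rw [thresholdLabel, if_neg]
  rw [h]; rintro ⟨h1, h2⟩; linarith

/-- In a triangle with constant `C` and one weighted edge `s`, the edges `s`, `s.next`,
`s.next.next` have values `C`, `C - w / 2`, `C + w / 2`. A threshold between the last two makes `s`
a diagonal; any other makes the triangle monochromatic. -/
theorem isLabeling_threshold {n : ℕ} {w y : Edge → ℝ} (θ : ℝ) (hw0 : ∀ e, 0 ≤ w e)
    (hw : ∀ e, w e ≠ 0 → e.IsInner n)
    (hy : ∀ t : Tri, t.InTriangle n → ∃ C, ∀ s,
      y (t.edge s) = C + (w (t.edge s.next) - w (t.edge s.next.next)) / 2)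
    (hm : ∀ t : Tri, ∀ r s, w (t.edge r) ≠ 0 → w (t.edge s) ≠ 0 → r = s) :
    IsLabeling n (thresholdLabel w y θ) where
  fits t ht := by
    obtain ⟨C, hC⟩ := hy t ht
    by_cases h : ∃ s, w (t.edge s) ≠ 0
    · obtain ⟨s, hs⟩ := h
      have hn : w (t.edge s.next) = 0 := by
        by_contra h'
        have := hm t _ _ hs h'
        revert this; cases s <;> simp [Side.next]
      have hnn : w (t.edge s.next.next) = 0 := by
        by_contra h'
        have := hm t _ _ hs h'
        revert this; cases s <;> simp [Side.next]
      have y0 := hC s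
      have y1 := hC s.next
      have y2 := hC s.next.next
      rw [next_next_next, hnn] at y1
      rw [next_next_next, hn] at y2
      rw [hn, hnn] at y0
      simp only [sub_zero, zero_sub, zero_div, add_zero] at y0 y1 y2
      have hp := hw0 (t.edge s)
      by_cases h1 : C - w (t.edge s) / 2 < θ
      · by_cases h2 : θ ≤ C + w (t.edge s) / 2
        · right; right
          refine ⟨s, ?_, ?_, ?_⟩
          · rw [thresholdLabel, y0, if_pos ⟨h1, h2⟩]
          · rw [thresholdLabel_of_zero hn, if_neg]; rw [y1]; linarith
          · rw [thresholdLabel_of_zero hnn, if_pos]; rw [y2]; exact h2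
        · right; left
          intro r
          rcases Side.eq_or s r with rfl | rfl | rfl
          · rw [thresholdLabel, y0, if_neg (fun h => h2 h.2), if_neg]; linarith
          · rw [thresholdLabel_of_zero hn, if_neg]; rw [y1]; linarith
          · rw [thresholdLabel_of_zero hnn, if_neg]; rw [y2]; exact h2
      · left
        intro r
        rcases Side.eq_or s r with rfl | rfl | rfl
        · rw [thresholdLabel, y0, if_neg (fun h => h1 h.1), if_pos]; linarith
        · rw [thresholdLabel_of_zero hn, if_pos]; rw [y1]; linarith
        · rw [thresholdLabel_of_zero hnn, if_pos]; rw [y2]; linarith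
    · push Not at h
      have hyC : ∀ s, y (t.edge s) = C := fun s => by rw [hC, h, h]; simp
      by_cases hθ : θ ≤ C
      · exact Or.inl fun s => by rw [thresholdLabel_of_zero (h s), hyC, if_pos hθ]
      · exact Or.inr (Or.inl fun s => by rw [thresholdLabel_of_zero (h s), hyC, if_neg hθ])
  boundary s i := by
    have : w (boundaryEdge n s i) = 0 := by
      by_contra h; exact not_isInner_boundaryEdge n s i (hw _ h)
    rw [thresholdLabel_of_zero this]
    split_ifs <;> simp

/-- A linear functional is nonnegative if those of all superlevel sets are. -/
theorem sum_mul_nonneg_of_superlevel {ι : Type*} [Fintype ι] (κ : ι → ℝ) (h0 : ∑ i, κ i = 0)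
    (m : ℕ) : ∀ y : ι → ℝ, (Finset.univ.image y).card ≤ m →
    (∀ θ, 0 ≤ ∑ i, if θ ≤ y i then κ i else 0) → 0 ≤ ∑ i, y i * κ i := by
  classical
  induction m with
  | zero =>
    intro y hy _
    have : Finset.univ.image y = ∅ := by simpa using hy
    rw [Finset.image_eq_empty] at this
    rw [this, Finset.sum_empty]
  | succ m ih =>
    intro y hy hθ
    by_cases hne : (Finset.univ.image y).Nonempty
    swap
    · rw [Finset.not_nonempty_iff_eq_empty, Finset.image_eq_empty] at hne
      rw [hne, Finset.sum_empty]
    set M := (Finset.univ.image y).max' hne with hM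
    have hyM : ∀ i, y i ≤ M := fun i =>
      Finset.le_max' _ _ (Finset.mem_image_of_mem _ (Finset.mem_univ i))
    have hMmem : M ∈ Finset.univ.image y := Finset.max'_mem _ _
    by_cases hne' : ((Finset.univ.image y).erase M).Nonempty
    · set M' := ((Finset.univ.image y).erase M).max' hne' with hM'
      have hM'mem : M' ∈ (Finset.univ.image y).erase M := Finset.max'_mem _ _
      have hlt : M' < M := by
        obtain ⟨h1, h2⟩ := Finset.mem_erase.1 hM'mem
        exact lt_of_le_of_ne (Finset.le_max' _ _ h2) h1
      have hy' : ∀ i, y i = M ∨ y i ≤ M' := by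
        intro i
        by_cases h : y i = M
        · exact Or.inl h
        · exact Or.inr (Finset.le_max' _ _ (Finset.mem_erase.2
            ⟨h, Finset.mem_image_of_mem _ (Finset.mem_univ i)⟩))
      have h1 := ih (fun i => min (y i) M') (by
        refine Nat.le_of_lt_succ (lt_of_lt_of_le (Finset.card_lt_card ?_) hy)
        rw [Finset.ssubset_iff_of_subset]
        · refine ⟨M, hMmem, fun h => ?_⟩
          obtain ⟨i, -, hi⟩ := Finset.mem_image.1 h
          have := min_le_right (y i) M'
          linarith
        · intro a ha
          obtain ⟨i, -, rfl⟩ := Finset.mem_image.1 ha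
          rcases min_choice (y i) M' with h | h
          · simp only [h]; exact Finset.mem_image_of_mem _ (Finset.mem_univ i)
          · simp only [h]; exact (Finset.mem_erase.1 hM'mem).2) (by
        intro θ
        by_cases h : θ ≤ M'
        · simpa [h] using hθ θ
        · simp [h])
      have h2 := mul_nonneg (sub_nonneg.2 hlt.le) (hθ M)
      rw [Finset.mul_sum] at h2
      -- Layer cake: truncating the maximum `M` to the next value `M'` splits off `M - M'` times the
      -- indicator of the top level set and lowers the number of values.
      have h3 : ∑ i, y i * κ i = ∑ i, min (y i) M' * κ i +
          ∑ i, (M - M') * (if M ≤ y i then κ i else 0) := by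
        rw [← Finset.sum_add_distrib]
        refine Finset.sum_congr rfl fun i _ => ?_
        rcases hy' i with h | h
        · rw [h, min_eq_right hlt.le, if_pos le_rfl]; ring
        · rw [min_eq_left h, if_neg (by linarith)]; ring
      rw [h3]
      exact add_nonneg h1 h2
    · rw [Finset.not_nonempty_iff_eq_empty] at hne'
      have : ∀ i, y i = M := by
        intro i
        by_contra h
        have : y i ∈ (Finset.univ.image y).erase M :=
          Finset.mem_erase.2 ⟨h, Finset.mem_image_of_mem _ (Finset.mem_univ i)⟩
        rw [hne'] at this
        simp at this
      simp only [this, ← Finset.mul_sum, h0, mul_zero, le_refl]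

/-! ## Hives with given boundary -/

/-- Partial sums of a finite sequence. -/
noncomputable def partialSum {n : ℕ} (f : Fin n → ℝ) (m : ℤ) : ℝ :=
  ∑ i : Fin n, if (i : ℤ) < m then f i else 0

theorem partialSum_succ {n : ℕ} (f : Fin n → ℝ) (i : Fin n) :
    partialSum f (i + 1) = partialSum f i + f i := by
  have : ∀ j : Fin n, (if (j : ℤ) < i + 1 then f j else 0) =
      (if (j : ℤ) < i then f j else 0) + if j = i then f j else 0 := by
    intro j
    by_cases h : j = i
    · subst h; simp
    · have : (j : ℕ) ≠ i := fun h' => h (Fin.ext h')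
      rw [if_neg h, add_zero]
      congr 1
      simp only [eq_iff_iff]; omega
  simp only [partialSum, this, Finset.sum_add_distrib, Finset.sum_ite_eq', Finset.mem_univ,
    if_true]

theorem partialSum_zero {n : ℕ} (f : Fin n → ℝ) : partialSum f 0 = 0 := by
  refine Finset.sum_eq_zero fun i _ => if_neg ?_
  omega

theorem partialSum_self {n : ℕ} (f : Fin n → ℝ) : partialSum f n = ∑ i, f i := by
  refine Finset.sum_congr rfl fun i _ => if_pos ?_
  have := i.2
  omega

/-- Partial sums around the boundary, starting at the lower left corner; the zero total makes them
close up. The last formula also serves as a filler elsewhere, where the values are irrelevant. -/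
theorem exists_hive_boundary {n : ℕ} (lam mu nu : Fin n → ℝ)
    (h : (∑ i, lam i) + (∑ i, mu i) + (∑ i, nu i) = 0) :
    ∃ G : ℤ × ℤ → ℝ, (∀ i, incr G (boundaryEdge n .northwest i) = lam i) ∧
      (∀ i, incr G (boundaryEdge n .northeast i) = mu i) ∧
      (∀ i, incr G (boundaryEdge n .south i) = nu i) := by
  set G : ℤ × ℤ → ℝ := fun v => if v.1 = 0 then - partialSum lam v.2 else
    if v.1 + v.2 = n then - partialSum lam n - partialSum mu v.1 else
      - partialSum lam n - partialSum mu n - partialSum nu (n - v.1) with hG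
  have h1 : ∀ y, G (0, y) = - partialSum lam y := fun y => if_pos rfl
  have h2 : ∀ x, G (x, n - x) = - partialSum lam n - partialSum mu x := by
    intro x
    simp only [hG]
    by_cases hx : x = 0
    · rw [if_pos hx, hx, partialSum_zero]; simp
    · rw [if_neg hx, if_pos (by ring)]
  have h3 : ∀ x, G (x, 0) = - partialSum lam n - partialSum mu n - partialSum nu (n - x) := by
    intro x
    simp only [hG]
    by_cases hx : x = 0
    · rw [if_pos hx, hx, partialSum_zero]
      simp only [sub_zero, partialSum_self]; linarith
    · rw [if_neg hx]
      split_ifs with hn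
      · have : x = n := by omega
        rw [this]; simp [partialSum_zero]
      · rfl
  refine ⟨G, fun i => ?_, fun i => ?_, fun i => ?_⟩
  · simp only [incr, boundaryEdge, Edge.target, Edge.source, h1, partialSum_succ]; ring
  · simp only [incr, boundaryEdge, Edge.target, Edge.source]
    have e1 := h2 i
    have e2 := h2 (i + 1)
    rw [partialSum_succ] at e2
    rw [show (n : ℤ) - 1 - i + 1 = n - i by ring, show (n : ℤ) - 1 - i = n - (i + 1) by ring,
      e1, e2]
    ring
  · simp only [incr, boundaryEdge, Edge.target, Edge.source, h3]
    rw [show (n : ℤ) - (n - 1 - i + 1) = i by ring, show (n : ℤ) - (n - 1 - i) = i + 1 by ring,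
      partialSum_succ]
    ring

theorem boundaryEdge_not_isInterior {n : ℕ} (s : Side) (i : Fin n) :
    ¬ IsInterior n (boundaryEdge n s i).source ∧ ¬ IsInterior n (boundaryEdge n s i).target := by
  cases s <;> simp [boundaryEdge, Edge.source, Edge.target, IsInterior]; omega

/-- The inequalities given by rigid puzzles are sufficient. -/
theorem mem_LR_of_inequalities {n : ℕ} {lam mu nu : Fin n → ℝ} (hlam : Antitone lam)
    (hmu : Antitone mu) (hnu : Antitone nu)
    (h0 : (∑ i, lam i) + (∑ i, mu i) + (∑ i, nu i) = 0)
    (hP : ∀ P : Puzzle n, P.IsRigid → 0 ≤ P.functional lam mu nu) : (lam, mu, nu) ∈ LR n := by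
  by_contra hLR
  obtain ⟨G, g1, g2, g3⟩ := exists_hive_boundary lam mu nu h0
  have hGanti : ∀ s, Antitone fun i => incr G (boundaryEdge n s i) := by
    intro s
    cases s
    · simpa only [g3] using hnu
    · simpa only [g1] using hlam
    · simpa only [g2] using hmu
  have hb : ∀ {H : ℤ × ℤ → ℝ} {t : ℝ},
      (∀ v, ¬ IsInterior n v → H v = (1 - t) * quadHive v + t * G v) → ∀ s i,
      incr H (boundaryEdge n s i) = (1 - t) * incr quadHive (boundaryEdge n s i) +
        t * incr G (boundaryEdge n s i) := by
    intro H t hH s i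
    obtain ⟨k1, k2⟩ := boundaryEdge_not_isInterior s i
    simp only [incr, hH _ k1, hH _ k2]
    ring
  have hG : ¬ ∃ H, IsConvexHive n H ∧ ∀ v, ¬ IsInterior n v → H v = G v := by
    rintro ⟨H, hc, hH⟩
    have hb' : ∀ s i, incr H (boundaryEdge n s i) = incr G (boundaryEdge n s i) := fun s i => by
      rw [hb (t := 1) (fun v hv => by rw [hH v hv]; ring) s i]; ring
    exact hLR (mem_LR_of_hive H hc (fun i => by rw [hb', g1]) (fun i => by rw [hb', g2])
      (fun i => by rw [hb', g3]))
  obtain ⟨t, h, w, ⟨ht0, ht1⟩, hc, hh, hwpos, hwz, hbal, hneg⟩ := exists_dual_weight n G hG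
  -- Since `t < 1`, the strictly decreasing increments of `quadHive` enter with positive weight.
  have hstrict : ∀ s (i : ℕ) (hi : i + 1 < n),
      incr h (boundaryEdge n s ⟨i + 1, hi⟩) < incr h (boundaryEdge n s ⟨i, by omega⟩) := by
    intro s i hi
    rw [hb hh, hb hh]
    have a1 := incr_quadHive_lt (n := n) s ⟨i, by omega⟩ ⟨i + 1, hi⟩ (by simp)
    have a2 := hGanti s (show (⟨i, by omega⟩ : Fin n) ≤ ⟨i + 1, hi⟩ by simp)
    simp only at a2
    have a3 := mul_lt_mul_of_pos_left a1 (show 0 < 1 - t by linarith)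
    have a4 := mul_le_mul_of_nonneg_left a2 ht0
    linarith
  have hm := matching_of_weight hc hstrict hwpos hwz hbal
  have hwi : ∀ e, w e ≠ 0 → e.IsInner n := fun e he => (hwz e he).1
  have hw0 : ∀ e, 0 ≤ w e := by
    intro e
    by_cases he : w e = 0
    · rw [he]
    · exact (hwpos e (hwz e he).1 (hwz e he).2).le
  obtain ⟨y, hy⟩ := exists_edge_values hwi hbal
  have hwb : ∀ s i, w (boundaryEdge n s i) = 0 := by
    intro s i
    by_contra hne
    exact not_isInner_boundaryEdge n s i (hwi _ hne)
  -- The negative pairing of `w` with `G` becomes a pairing of `y` with the boundary coordinates,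
  -- which only need be tested on superlevel sets of `y`.
  have hpair := sum_boundary_eq (κ := incr G) (fun t _ => sum_incr G t) hy hwb
  rw [sum_innerEdges] at hneg
  simp only [hlen_apply] at hneg
  rw [← hpair] at hneg
  have hlayer := sum_mul_nonneg_of_superlevel
    (fun q : Side × Fin n => incr G (boundaryEdge n q.1 q.2)) (by
      rw [Fintype.sum_prod_type]
      exact sum_boundary_eq_zero (fun t _ => sum_incr G t)) _
    (fun q => y (boundaryEdge n q.1 q.2)) le_rfl (fun θ => by
      have hL := isLabeling_threshold θ hw0 hwi hy
        (fun t r s hr hs => hm t r s (hwz _ hr) (hwz _ hs))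
      have hlab : ∀ e : Edge, e.InTriangle n → hL.puzzle.label e = 2 → w e ≠ 0 := by
        intro e he h2 hw
        rw [hL.label_puzzle he, thresholdLabel_of_zero hw] at h2
        split_ifs at h2 <;> exact absurd h2 (by decide)
      have hrigid : hL.puzzle.IsRigid := Puzzle.isRigid_of_len (κ := incr h)
        (fun t _ => sum_incr h t) hc (fun e he h2 => (hwz e (hlab e he h2)).2)
        (fun t _ r s hr hs hr0 hs0 => hm t r s ⟨hr, hr0⟩ ⟨hs, hs0⟩)
      have := hP _ hrigid
      rw [Puzzle.functional_eq _ g1 g2 g3] at this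
      rw [Fintype.sum_prod_type]
      refine this.trans (le_of_eq ?_)
      refine Finset.sum_congr rfl fun s _ => Finset.sum_congr rfl fun i _ => ?_
      rw [hL.label_puzzle (inTriangle_boundaryEdge n s i), thresholdLabel_of_zero (hwb s i)]
      simp only
      by_cases hθ : θ ≤ y (boundaryEdge n s i) <;> simp [hθ])
  rw [Fintype.sum_prod_type] at hlayer
  exact absurd hneg (not_lt.2 hlayer)

/-! ## Region edges around a lattice point -/

/-- The oriented edge from `v` in the direction `k`. -/
def arrowOf (v : ℤ × ℤ) (k : Fin 6) : Arrow :=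
  ⟨spoke v k, ![true, false, true, false, true, false] k⟩

/-- The unit triangle at `v` between the directions `k` and `k + 1`. -/
def sector (v : ℤ × ℤ) (k : Fin 6) : Tri := (arrowOf v k).leftTri

/-- The side of the lattice triangle parallel to the direction `k`. -/
def dirSide : Fin 6 → Side :=
  ![.south, .northwest, .northeast, .south, .northwest, .northeast]

theorem arrowOf_tail (v : ℤ × ℤ) (k : Fin 6) : (arrowOf v k).tail = v := by
  fin_cases k <;> simp [arrowOf, Arrow.tail, spoke, Edge.source, Edge.target]

theorem arrowOf_head (v : ℤ × ℤ) (k : Fin 6) : (arrowOf v k).head = nb v k := by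
  fin_cases k <;>
    simp [arrowOf, Arrow.head, spoke, Edge.source, Edge.target, nb, dir, Prod.ext_iff,
      ← sub_eq_add_neg]

theorem arrowOf_direction (v : ℤ × ℤ) (k : Fin 6) :
    (arrowOf v k).direction = (![0, 1, 2, 3, 4, 5] : Fin 6 → ZMod 6) k := by
  fin_cases k <;> simp [arrowOf, Arrow.direction, spoke] <;> rfl

theorem gentleStep_arrowOf (v : ℤ × ℤ) (k : Fin 6) :
    GentleStep (arrowOf v k) (arrowOf (nb v k) k) ∧
      GentleStep (arrowOf v k) (arrowOf (nb v k) (k + 1)) ∧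
      GentleStep (arrowOf v k) (arrowOf (nb v k) (k + 5)) := by
  simp only [GentleStep, arrowOf_head, arrowOf_tail, true_and, arrowOf_direction]
  revert k
  decide

theorem arrowOf_nb (v : ℤ × ℤ) (k : Fin 6) :
    arrowOf (nb v k) (k + 3) = ⟨(arrowOf v k).edge, !(arrowOf v k).ccw⟩ := by
  rw [arrowOf, spoke_nb]
  fin_cases k <;> rfl

theorem leftTri_arrowOf (v : ℤ × ℤ) (k : Fin 6) : (arrowOf v k).leftTri = sector v k := rfl

theorem rightTri_arrowOf (v : ℤ × ℤ) (k : Fin 6) : (arrowOf v k).rightTri = sector v (k + 5) := by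
  fin_cases k <;> simp [arrowOf, Arrow.rightTri, Arrow.leftTri, sector, spoke, Edge.upTri,
    Edge.downTri]

theorem sector_edge (v : ℤ × ℤ) (k : Fin 6) : (sector v k).edge (dirSide k) = spoke v k := by
  fin_cases k <;> simp [sector, arrowOf, Arrow.leftTri, spoke, dirSide, Edge.upTri, Edge.downTri,
    Tri.edge]

theorem sector_edge_next (v : ℤ × ℤ) (k : Fin 6) :
    (sector v k).edge (dirSide k).next = spoke v (k + 1) := by
  fin_cases k <;> simp [sector, arrowOf, Arrow.leftTri, spoke, dirSide, Edge.upTri, Edge.downTri,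
    Tri.edge, Side.next]

theorem sector_inTriangle {n : ℕ} {v : ℤ × ℤ} {k : Fin 6} (h : (spoke v k).IsInner n) :
    (sector v k).InTriangle n ∧ (sector v (k + 5)).InTriangle n := by
  rw [← rightTri_arrowOf, ← leftTri_arrowOf]
  have h1 : (spoke v k).upTri.InTriangle n := h.inTriangle
  have h2 : (spoke v k).downTri.InTriangle n := h
  simp only [Arrow.leftTri, Arrow.rightTri]
  by_cases hb : (arrowOf v k).ccw = true
  · rw [if_pos hb, if_pos hb]; exact ⟨h1, h2⟩
  · rw [if_neg hb, if_neg hb]; exact ⟨h2, h1⟩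

theorem isInner_of_leftTri_rightTri {n : ℕ} {a : Arrow} (h1 : a.leftTri.InTriangle n)
    (h2 : a.rightTri.InTriangle n) : a.edge.IsInner n := by
  simp only [Arrow.leftTri, Arrow.rightTri] at h1 h2
  split_ifs at h1 h2
  · exact h2
  · exact h1

/-- The possible labels of two consecutive edges at a point, read counterclockwise. -/
def Adj (a b : Fin 3) : Prop :=
  (a = 0 ∧ b = 0) ∨ (a = 0 ∧ b = 2) ∨ (a = 2 ∧ b = 1) ∨ (a = 1 ∧ b = 1) ∨ (a = 1 ∧ b = 0)

instance (a b : Fin 3) : Decidable (Adj a b) := by unfold Adj; infer_instance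

/-- The type of the piece between two consecutive edges at a point. -/
def pairKind (a b : Fin 3) : Kind :=
  if a = 0 ∧ b = 0 then .zero else if a = 1 ∧ b = 1 then .one else .rhombus

/-- The middle one of three consecutive edges at a point is a region edge that leaves it. -/
def Leaves (r a l : Fin 3) : Prop :=
  pairKind a l ≠ pairKind r a ∧ pairKind a l ≠ .one ∧ pairKind r a ≠ .zero

/-- The middle one of three consecutive edges at a point is a region edge that enters it. -/
def Enters (r a l : Fin 3) : Prop :=
  pairKind r a ≠ pairKind a l ∧ pairKind r a ≠ .one ∧ pairKind a l ≠ .zero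

instance (a b c : Fin 3) : Decidable (Leaves a b c) := by unfold Leaves; infer_instance

instance (a b c : Fin 3) : Decidable (Enters a b c) := by unfold Enters; infer_instance

theorem Fits.adj {c : Edge → Fin 3} {t : Tri} (h : Fits c t) (s : Side) :
    Adj (c (t.edge s)) (c (t.edge s.next)) := by
  rcases h with h | h | ⟨r, h1, h2, h3⟩
  · rw [h, h]; decide
  · rw [h, h]; decide
  · rcases Side.eq_or r s with rfl | rfl | rfl
    · rw [h1, h2]; decide
    · rw [h2, h3]; decide
    · rw [next_next_next, h3, h1]; decide

theorem Puzzle.kind_eq {n : ℕ} (P : Puzzle n) {p : Piece} (hp : p ∈ P.pieces) {t : Tri}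
    (ht : t ∈ p.tris) (s : Side) :
    p.kind = pairKind (P.label (t.edge s)) (P.label (t.edge s.next)) := by
  cases p with
  | tri t' a =>
    obtain rfl : t = t' := by simpa [Piece.tris] using ht
    rw [P.label_of_tri hp, P.label_of_tri hp]
    revert a; intro a _ _
    fin_cases a <;> rfl
  | rhombus d =>
    obtain ⟨h1, h2, h3⟩ := P.label_of_rhombus hp ht
    rcases Side.eq_or d.side s with rfl | rfl | rfl
    · rw [h1, h2]; rfl
    · rw [h2, h3]; rfl
    · rw [next_next_next, h3, h1]; rfl

section Region
variable {n : ℕ} (P : Puzzle n)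

/-- Whether a spoke is a region edge depends only on three consecutive labels, which reduces the
conservation law at a point to a finite check. -/
theorem isRegionEdge_iff {v : ℤ × ℤ} {k : Fin 6} (h : (spoke v k).IsInner n) :
    P.IsRegionEdge (arrowOf v k) ↔
      Leaves (P.label (spoke v (k + 5))) (P.label (spoke v k)) (P.label (spoke v (k + 1))) := by
  obtain ⟨hl, hr⟩ := sector_inTriangle h
  have h5 : k + 5 + 1 = k := by clear * -; revert k; decide
  have kl : ∀ p ∈ P.pieces, sector v k ∈ p.tris →
      p.kind = pairKind (P.label (spoke v k)) (P.label (spoke v (k + 1))) := by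
    intro p hp ht
    rw [P.kind_eq hp ht (dirSide k), sector_edge, sector_edge_next]
  have kr : ∀ p ∈ P.pieces, sector v (k + 5) ∈ p.tris →
      p.kind = pairKind (P.label (spoke v (k + 5))) (P.label (spoke v k)) := by
    intro p hp ht
    rw [P.kind_eq hp ht (dirSide (k + 5)), sector_edge, sector_edge_next, h5]
  constructor
  · rintro ⟨p, hp, q, hq, h1, h2, h3⟩
    rw [leftTri_arrowOf] at h1
    rw [rightTri_arrowOf] at h2
    rwa [kl p hp h1, kr q hq h2] at h3
  · intro h3
    obtain ⟨p, ⟨hp, h1⟩, -⟩ := P.cover _ hl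
    obtain ⟨q, ⟨hq, h2⟩, -⟩ := P.cover _ hr
    refine ⟨p, hp, q, hq, h1, by rwa [rightTri_arrowOf], ?_⟩
    rwa [kl p hp h1, kr q hq h2]

theorem isRegionEdge_nb_iff {v : ℤ × ℤ} {k : Fin 6} (h : (spoke v k).IsInner n) :
    P.IsRegionEdge (arrowOf (nb v k) (k + 3)) ↔
      Enters (P.label (spoke v (k + 5))) (P.label (spoke v k)) (P.label (spoke v (k + 1))) := by
  obtain ⟨hl, hr⟩ := sector_inTriangle h
  have h5 : k + 5 + 1 = k := by clear * -; revert k; decide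
  have el : (arrowOf (nb v k) (k + 3)).leftTri = sector v (k + 5) := by
    rw [← rightTri_arrowOf, arrowOf_nb]
    simp only [Arrow.leftTri, Arrow.rightTri]
    cases (arrowOf v k).ccw <;> rfl
  have er : (arrowOf (nb v k) (k + 3)).rightTri = sector v k := by
    rw [← leftTri_arrowOf, arrowOf_nb]
    simp only [Arrow.leftTri, Arrow.rightTri]
    cases (arrowOf v k).ccw <;> rfl
  have kl : ∀ p ∈ P.pieces, sector v k ∈ p.tris →
      p.kind = pairKind (P.label (spoke v k)) (P.label (spoke v (k + 1))) := by
    intro p hp ht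
    rw [P.kind_eq hp ht (dirSide k), sector_edge, sector_edge_next]
  have kr : ∀ p ∈ P.pieces, sector v (k + 5) ∈ p.tris →
      p.kind = pairKind (P.label (spoke v (k + 5))) (P.label (spoke v k)) := by
    intro p hp ht
    rw [P.kind_eq hp ht (dirSide (k + 5)), sector_edge, sector_edge_next, h5]
  constructor
  · rintro ⟨p, hp, q, hq, h1, h2, h3⟩
    rw [el] at h1
    rw [er] at h2
    rwa [kr p hp h1, kl q hq h2] at h3
  · intro h3
    obtain ⟨p, ⟨hp, h1⟩, -⟩ := P.cover _ hr
    obtain ⟨q, ⟨hq, h2⟩, -⟩ := P.cover _ hl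
    refine ⟨p, hp, q, hq, by rwa [el], by rwa [er], ?_⟩
    rwa [kr p hp h1, kl q hq h2]

theorem isInner_of_isRegionEdge {a : Arrow} (h : P.IsRegionEdge a) : a.edge.IsInner n := by
  obtain ⟨p, hp, q, hq, h1, h2, -⟩ := h
  exact isInner_of_leftTri_rightTri (P.inside p hp _ h1) (P.inside q hq _ h2)

theorem adj_spokes {v : ℤ × ℤ} {k : Fin 6} (h : (spoke v k).IsInner n) :
    Adj (P.label (spoke v k)) (P.label (spoke v (k + 1))) ∧
      Adj (P.label (spoke v (k + 5))) (P.label (spoke v k)) := by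
  obtain ⟨hl, hr⟩ := sector_inTriangle h
  have h1 := (P.isLabeling.fits _ hl).adj (dirSide k)
  have h2 := (P.isLabeling.fits _ hr).adj (dirSide (k + 5))
  have h5 : k + 5 + 1 = k := by clear * -; revert k; decide
  rw [sector_edge, sector_edge_next] at h1 h2
  rw [h5] at h2
  exact ⟨h1, h2⟩

/-- The conservation law for region edges at a point with edge labels `a`, …, `f`. -/
theorem leaves_enters : ∀ a b c d e f : Fin 3,
    Adj a b → Adj b c → Adj c d → Adj d e → Adj e f → Adj f a →
    (Leaves f a b → (Enters c d e ∧ ¬ Enters d e f ∧ ¬ Enters b c d) ∨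
      (¬ Enters c d e ∧ Enters d e f ∧ Enters b c d)) ∧
    (Enters c d e → Leaves f a b ∨ Leaves a b c ∨ Leaves e f a) := by
  decide

theorem fin_six_add : ∀ k : Fin 6, k + 3 + 1 = k + 4 ∧ k + 3 + 5 = k + 2 ∧ k + 4 + 1 = k + 5 ∧
    k + 4 + 5 = k + 3 ∧ k + 2 + 1 = k + 3 ∧ k + 2 + 5 = k + 1 ∧ k + 5 + 1 = k ∧ k + 5 + 5 = k + 4 ∧
    k + 1 + 1 = k + 2 ∧ k + 1 + 5 = k ∧ k + 3 + 3 = k ∧ k + 4 + 3 = k + 1 ∧ k + 2 + 3 = k + 5 := by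
  decide

/-- A region edge that leaves an interior point is the sum of its gentle predecessors. -/
theorem predecessors {v : ℤ × ℤ} (hv : IsInterior n v) (k : Fin 6) :
    (P.IsRegionEdge (arrowOf v k) →
      (P.IsRegionEdge (arrowOf (nb v (k + 3)) k) ∧
        ¬ P.IsRegionEdge (arrowOf (nb v (k + 4)) (k + 1)) ∧
        ¬ P.IsRegionEdge (arrowOf (nb v (k + 2)) (k + 5))) ∨
      (¬ P.IsRegionEdge (arrowOf (nb v (k + 3)) k) ∧
        P.IsRegionEdge (arrowOf (nb v (k + 4)) (k + 1)) ∧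
        P.IsRegionEdge (arrowOf (nb v (k + 2)) (k + 5)))) ∧
    (P.IsRegionEdge (arrowOf (nb v (k + 3)) k) → P.IsRegionEdge (arrowOf v k) ∨
      P.IsRegionEdge (arrowOf v (k + 1)) ∨ P.IsRegionEdge (arrowOf v (k + 5))) := by
  obtain ⟨e1, e2, e3, e4, e5, e6, e7, e8, e9, e10, e11, e12, e13⟩ := fin_six_add k
  have hi := isInner_spoke hv
  have l0 := isRegionEdge_iff P (hi k)
  have l1 := isRegionEdge_iff P (hi (k + 1))
  have l5 := isRegionEdge_iff P (hi (k + 5))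
  have n3 := isRegionEdge_nb_iff P (hi (k + 3))
  have n4 := isRegionEdge_nb_iff P (hi (k + 4))
  have n2 := isRegionEdge_nb_iff P (hi (k + 2))
  rw [e9, e10] at l1
  rw [e7, e8] at l5
  rw [e11, e1, e2] at n3
  rw [e12, e3, e4] at n4
  rw [e13, e5, e6] at n2
  rw [l0, l1, l5, n3, n4, n2]
  have a0 := (adj_spokes P (hi k)).1
  have a1 := (adj_spokes P (hi (k + 1))).1
  have a2 := (adj_spokes P (hi (k + 2))).1
  have a3 := (adj_spokes P (hi (k + 3))).1
  have a4 := (adj_spokes P (hi (k + 4))).1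
  have a5 := (adj_spokes P (hi (k + 5))).1
  rw [e9] at a1
  rw [e5] at a2
  rw [e1] at a3
  rw [e3] at a4
  rw [e7] at a5
  exact leaves_enters _ _ _ _ _ _ a0 a1 a2 a3 a4 a5

end Region

/-! ## Weights of gentle paths -/

section Weights
variable {n : ℕ} (P : Puzzle n)

/-- Oriented region edges, given by their tails and directions. -/
def RegionArrow : Type := {q : (ℤ × ℤ) × Fin 6 // P.IsRegionEdge (arrowOf q.1 q.2)}

theorem mem_Icc_of_isRegionEdge {v : ℤ × ℤ} {k : Fin 6} (h : P.IsRegionEdge (arrowOf v k)) :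
    v ∈ Finset.Icc (0 : ℤ) n ×ˢ Finset.Icc (0 : ℤ) n ∧
      nb v k ∈ Finset.Icc (0 : ℤ) n ×ˢ Finset.Icc (0 : ℤ) n := by
  have hi := isInner_of_isRegionEdge P h
  obtain ⟨x, y⟩ := v
  simp only [Finset.mem_product, Finset.mem_Icc, arrowOf] at *
  fin_cases k <;> simp [spoke, Edge.IsInner, Edge.downTri, Tri.InTriangle, nb, dir] at * <;> omega

instance : Finite (RegionArrow P) := by
  refine Set.Finite.subset (((Finset.Icc (0 : ℤ) n ×ˢ Finset.Icc (0 : ℤ) n) ×ˢ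
    (Finset.univ : Finset (Fin 6))).finite_toSet) ?_
  rintro ⟨v, k⟩ h
  exact Finset.mem_coe.2 (Finset.mem_product.2
    ⟨(mem_Icc_of_isRegionEdge P h).1, Finset.mem_univ _⟩)

/-- The region edge `r` continues the region edge `q` in a gentle path. -/
def RegionArrow.Next (r q : RegionArrow P) : Prop :=
  r.1.1 = nb q.1.1 q.1.2 ∧ (r.1.2 = q.1.2 ∨ r.1.2 = q.1.2 + 1 ∨ r.1.2 = q.1.2 + 5)

theorem RegionArrow.Next.gentleStep {r q : RegionArrow P} (h : r.Next P q) :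
    GentleStep (arrowOf q.1.1 q.1.2) (arrowOf r.1.1 r.1.2) := by
  obtain ⟨h1, h2⟩ := h
  obtain ⟨g1, g2, g3⟩ := gentleStep_arrowOf q.1.1 q.1.2
  rw [h1]
  rcases h2 with h2 | h2 | h2 <;> rw [h2] <;> assumption

theorem exists_gentlePath {q r : RegionArrow P}
    (h : Relation.TransGen (fun a b => RegionArrow.Next P b a) q r) :
    ∃ l, P.IsGentlePath (arrowOf q.1.1 q.1.2 :: (l ++ [arrowOf r.1.1 r.1.2])) := by
  induction h using Relation.TransGen.head_induction_on with
  | single h =>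
    rename_i a
    refine ⟨[], ?_, ?_⟩
    · intro b hb
      simp only [List.nil_append, List.mem_cons, List.not_mem_nil, or_false] at hb
      rcases hb with rfl | rfl
      · exact a.2
      · exact r.2
    · simpa [List.isChain_cons_cons] using h.gentleStep
  | head h hcr ih =>
    rename_i a c
    obtain ⟨l, h1, h2⟩ := ih
    refine ⟨arrowOf c.1.1 c.1.2 :: l, ?_, ?_⟩
    · intro b hb
      rcases List.mem_cons.1 hb with rfl | hb
      · exact a.2
      · exact h1 b hb
    · rw [List.cons_append, List.isChain_cons_cons]
      exact ⟨h.gentleStep, h2⟩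

/-- There are finitely many region edges, and a cycle of the successor relation would be a gentle
loop. -/
theorem wellFounded_next (hP : ¬ P.HasGentleLoop) : WellFounded (RegionArrow.Next P) := by
  have : Std.Irrefl (Relation.TransGen (RegionArrow.Next P)) := ⟨fun q hq => by
    have hq' := Relation.transGen_swap.2 hq
    obtain ⟨l, hl⟩ := exists_gentlePath P hq'
    exact hP ⟨_, l, hl⟩⟩
  exact Subrelation.wf (fun h => Relation.TransGen.single h)
    (Finite.wellFounded_of_trans_of_irrefl (Relation.TransGen (RegionArrow.Next P)))

open Classical in
/-- The number of gentle paths that start with a region edge and end at the boundary. -/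
theorem exists_path_weight (hP : ¬ P.HasGentleLoop) : ∃ N : ℤ × ℤ → Fin 6 → ℝ,
    (∀ v k, ¬ P.IsRegionEdge (arrowOf v k) → N v k = 0) ∧
    (∀ v k, P.IsRegionEdge (arrowOf v k) → 0 < N v k) ∧
    (∀ v k, P.IsRegionEdge (arrowOf v k) → IsInterior n (nb v k) →
      N v k = N (nb v k) k + N (nb v k) (k + 1) + N (nb v k) (k + 5)) := by
  have wf := wellFounded_next P hP
  -- A path stops when the head reaches the boundary and contributes `1`; otherwise the counts of
  -- the three possible gentle continuations are added.
  let F : (q : RegionArrow P) → ((r : RegionArrow P) → r.Next P q → ℝ) → ℝ := fun q rec =>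
    if IsInterior n (nb q.1.1 q.1.2) then
      (if h : P.IsRegionEdge (arrowOf (nb q.1.1 q.1.2) q.1.2) then
        rec ⟨(nb q.1.1 q.1.2, q.1.2), h⟩ ⟨rfl, Or.inl rfl⟩ else 0) +
      (if h : P.IsRegionEdge (arrowOf (nb q.1.1 q.1.2) (q.1.2 + 1)) then
        rec ⟨(nb q.1.1 q.1.2, q.1.2 + 1), h⟩ ⟨rfl, Or.inr (Or.inl rfl)⟩ else 0) +
      (if h : P.IsRegionEdge (arrowOf (nb q.1.1 q.1.2) (q.1.2 + 5)) then
        rec ⟨(nb q.1.1 q.1.2, q.1.2 + 5), h⟩ ⟨rfl, Or.inr (Or.inr rfl)⟩ else 0)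
    else 1
  let N₀ : RegionArrow P → ℝ := wf.fix F
  let N : ℤ × ℤ → Fin 6 → ℝ := fun v k =>
    if h : P.IsRegionEdge (arrowOf v k) then N₀ ⟨(v, k), h⟩ else 0
  have hN : ∀ v k (h : P.IsRegionEdge (arrowOf v k)),
      N v k = N₀ (⟨(v, k), h⟩ : RegionArrow P) := fun v k h => dif_pos h
  have hN0 : ∀ v k, ¬ P.IsRegionEdge (arrowOf v k) → N v k = 0 := fun v k h => dif_neg h
  have hrec : ∀ q : RegionArrow P, N₀ q = if IsInterior n (nb q.1.1 q.1.2) then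
      N (nb q.1.1 q.1.2) q.1.2 + N (nb q.1.1 q.1.2) (q.1.2 + 1) + N (nb q.1.1 q.1.2) (q.1.2 + 5)
      else 1 := by
    intro q
    exact wf.fix_eq F q
  have hpos : ∀ q : RegionArrow P, 0 < N₀ q := by
    intro q
    induction q using wf.induction with
    | h q ih =>
      rw [hrec]
      split_ifs with hv
      · have hnn : ∀ j, (j = q.1.2 ∨ j = q.1.2 + 1 ∨ j = q.1.2 + 5) →
            (0 ≤ N (nb q.1.1 q.1.2) j ∧
            (P.IsRegionEdge (arrowOf (nb q.1.1 q.1.2) j) → 0 < N (nb q.1.1 q.1.2) j)) := by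
          intro j hj
          by_cases h : P.IsRegionEdge (arrowOf (nb q.1.1 q.1.2) j)
          · have := ih ⟨(nb q.1.1 q.1.2, j), h⟩ ⟨rfl, hj⟩
            have := this.trans_eq (hN _ _ h).symm
            exact ⟨this.le, fun _ => this⟩
          · exact ⟨(hN0 _ _ h).ge, fun h' => absurd h' h⟩
        have h0 := hnn _ (Or.inl rfl)
        have h1 := hnn _ (Or.inr (Or.inl rfl))
        have h5 := hnn _ (Or.inr (Or.inr rfl))
        -- A region edge ending at an interior point has at least one gentle continuation, so the
        -- count stays positive.
        have := (predecessors P hv q.1.2).2 (by rw [nb_nb_three]; exact q.2)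
        rcases this with h | h | h
        · linarith [h0.2 h]
        · linarith [h1.2 h]
        · linarith [h5.2 h]
      · exact one_pos
  exact ⟨N, hN0, fun v k h => (hpos _).trans_eq (hN v k h).symm,
    fun v k h hv => (hN v k h).trans ((hrec _).trans (if_pos hv))⟩

/-- The determinant of the direction `k` with a lattice vector. -/
def det (k : Fin 6) (δ : ℤ × ℤ) : ℤ := (dir k).1 * δ.2 - (dir k).2 * δ.1

/-- Since `dir k = dir (k + 1) + dir (k + 5)`, replacing the straight predecessor by the two turning
ones preserves the determinant. -/
theorem det_add_one_add_five (k : Fin 6) (δ : ℤ × ℤ) : det (k + 1) δ + det (k + 5) δ = det k δ := by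
  fin_cases k <;> simp [det, dir] <;> ring

theorem det_sub (k : Fin 6) (δ ε : ℤ × ℤ) : det k (δ - ε) = det k δ - det k ε := by
  simp only [det, Prod.fst_sub, Prod.snd_sub]; ring

theorem sum_nb_eq {S : Finset (ℤ × ℤ)} (k : Fin 6) (f : ℤ × ℤ → ℝ)
    (hf : ∀ v, f v ≠ 0 → v ∈ S ∧ nb v k ∈ S) :
    ∑ v ∈ S, f v = ∑ u ∈ S, f (nb u (k + 3)) := by
  have h3 : ∀ u, nb (nb u (k + 3)) k = u := by
    intro u
    have := nb_nb_three u (k + 3)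
    rwa [show k + 3 + 3 = k from (fin_six_add k).2.2.2.2.2.2.2.2.2.2.1] at this
  refine Finset.sum_bij_ne_zero (fun v _ _ => nb v k) (fun v _ h => (hf v h).2) ?_ ?_ ?_
  · intro v _ _ u _ _ h
    have h : nb v k = nb u k := h
    rw [← nb_nb_three v k, h, nb_nb_three]
  · intro u hu h
    refine ⟨nb u (k + 3), (hf _ h).1, ?_, h3 u⟩
    exact h
  · intro v _ _
    simp only [nb_nb_three]

/-- Gentle path weights are balanced. -/
theorem sum_path_weight {N : ℤ × ℤ → Fin 6 → ℝ}
    (h0 : ∀ v k, ¬ P.IsRegionEdge (arrowOf v k) → N v k = 0)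
    (hN : ∀ v k, P.IsRegionEdge (arrowOf v k) → IsInterior n (nb v k) →
      N v k = N (nb v k) k + N (nb v k) (k + 1) + N (nb v k) (k + 5))
    (δ : ℤ × ℤ → ℤ × ℤ)
    (hδ : ∀ v k, (spoke v k).IsInner n → ¬ IsInterior n v → δ v = 0) :
    ∑ k, ∑ v ∈ Finset.Icc (0 : ℤ) n ×ˢ Finset.Icc (0 : ℤ) n,
      N v k * (det k (δ (nb v k)) - det k (δ v)) = 0 := by
  set S := Finset.Icc (0 : ℤ) n ×ˢ Finset.Icc (0 : ℤ) n with hS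
  have hreg : ∀ v k, N v k ≠ 0 → P.IsRegionEdge (arrowOf v k) := by
    intro v k h
    by_contra h'
    exact h (h0 v k h')
  have h1 : ∀ k, ∑ v ∈ S, N v k * (det k (δ (nb v k)) : ℝ) =
      ∑ u ∈ S, N (nb u (k + 3)) k * (det k (δ u) : ℝ) := by
    intro k
    rw [sum_nb_eq k]
    · refine Finset.sum_congr rfl fun u _ => ?_
      have := nb_nb_three u (k + 3)
      rw [show k + 3 + 3 = k from (fin_six_add k).2.2.2.2.2.2.2.2.2.2.1] at this
      rw [this]
    · intro v hv
      exact mem_Icc_of_isRegionEdge P (hreg v k (left_ne_zero_of_mul hv))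
  simp only [mul_sub, Finset.sum_sub_distrib, h1]
  rw [← Finset.sum_sub_distrib]
  simp only [← Finset.sum_sub_distrib]
  rw [Finset.sum_comm]
  refine Finset.sum_eq_zero fun v _ => ?_
  rw [Finset.sum_sub_distrib, sub_eq_zero]
  by_cases hv : IsInterior n v
  swap
  · refine (Finset.sum_eq_zero fun k _ => ?_).trans (Finset.sum_eq_zero fun k _ => ?_).symm
    · by_cases hr : P.IsRegionEdge (arrowOf (nb v (k + 3)) k)
      · have hi := isInner_of_isRegionEdge P hr
        have hi' : (spoke v (k + 3)).IsInner n := by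
          rw [← spoke_nb, show k + 3 + 3 = k from (fin_six_add k).2.2.2.2.2.2.2.2.2.2.1]
          exact hi
        rw [hδ v _ hi' hv]; simp [det]
      · rw [h0 _ _ hr, zero_mul]
    · by_cases hr : P.IsRegionEdge (arrowOf v k)
      · rw [hδ v k (isInner_of_isRegionEdge P hr) hv]; simp [det]
      · rw [h0 _ _ hr, zero_mul]
  classical
  set I : Fin 6 → ℝ := fun k => if P.IsRegionEdge (arrowOf (nb v (k + 3)) k) then 1 else 0 with hI
  have h3 : ∀ k : Fin 6, nb (nb v (k + 3)) k = v := by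
    intro k
    have := nb_nb_three v (k + 3)
    rwa [show k + 3 + 3 = k from (fin_six_add k).2.2.2.2.2.2.2.2.2.2.1] at this
  have hin : ∀ k, N (nb v (k + 3)) k = I k * (N v k + N v (k + 1) + N v (k + 5)) := by
    intro k
    by_cases hr : P.IsRegionEdge (arrowOf (nb v (k + 3)) k)
    · have := hN _ _ hr (by rw [h3]; exact hv)
      rw [h3] at this
      simp only [hI, if_pos hr, one_mul, this]
    · simp only [hI, if_neg hr, zero_mul, h0 _ _ hr]
  -- By `predecessors`, an outgoing region edge has as its incoming gentle neighbors either the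
  -- straight one alone or exactly the two turning ones; in both cases the determinants add up to
  -- that of its own direction.
  have hout : ∀ k, N v k * (I k * (det k (δ v) : ℝ) + I (k + 1) * (det (k + 1) (δ v) : ℝ) +
      I (k + 5) * (det (k + 5) (δ v) : ℝ)) = N v k * (det k (δ v) : ℝ) := by
    intro k
    by_cases hr : P.IsRegionEdge (arrowOf v k)
    · congr 1
      have e1 : k + 1 + 3 = k + 4 ∧ k + 5 + 3 = k + 2 := by clear * -; revert k; decide
      have hd : (det (k + 1) (δ v) + det (k + 5) (δ v) : ℝ) = det k (δ v) := by
        exact_mod_cast det_add_one_add_five k (δ v)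
      rcases (predecessors P hv k).1 hr with ⟨g1, g2, g3⟩ | ⟨g1, g2, g3⟩
      · simp only [hI, e1, if_pos g1, if_neg g2, if_neg g3]; ring
      · simp only [hI, e1, if_neg g1, if_pos g2, if_pos g3]; linarith
    · rw [h0 _ _ hr]; ring
  simp only [hin]
  rw [← Finset.sum_congr rfl fun k _ => hout k]
  simp only [Fin.sum_univ_six, Fin.isValue, Fin.reduceAdd, zero_add]
  ring

/-! ## Deflation of a labeling -/

/-- The part of the edge vector in the direction `k` that belongs to the label `0`. -/
def zeroPart (a : Fin 3) (k : Fin 6) : ℤ × ℤ := ![dir k, 0, dir (k + 5)] a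

/-- The `0`-parts close up around a triangle, so collapsing the `1`-labeled edges is consistent. -/
theorem Fits.zeroPart {c : Edge → Fin 3} {t : Tri} (h : Fits c t) :
    zeroPart (c (t.edge .south)) 0 + zeroPart (c (t.edge .northeast)) 2 =
      zeroPart (c (t.edge .northwest)) 1 := by
  rcases h with h | h | ⟨s, h1, h2, h3⟩
  · rw [h, h, h]; decide
  · rw [h, h, h]; decide
  · cases s <;> simp only [Side.next] at h1 h2 h3 <;> rw [h1, h2, h3] <;> decide

/-- `D` is the position of a lattice point after the `1`-labeled edges have been shrunk to points;
it is the potential of the `0`-parts. -/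
theorem exists_deflation {n : ℕ} {c : Edge → Fin 3} (hc : IsLabeling n c) :
    ∃ D : ℤ × ℤ → ℤ × ℤ, D (0, 0) = 0 ∧ ∀ v k, (spoke v k).InTriangle n →
      D (nb v k) = D v + zeroPart (c (spoke v k)) k := by
  obtain ⟨C, h0, hC⟩ := exists_lattice_potential (n : ℤ)
    (fun x y => zeroPart (c ⟨x, y, .south⟩) 0) (fun x y => zeroPart (c ⟨x, y, .northwest⟩) 1) (by
      intro x y hx hy hxy
      have h1 := (hc.fits (.up x y) ⟨hx, hy, by omega⟩).zeroPart
      have h2 := (hc.fits (.down x y) ⟨hx, hy, by omega⟩).zeroPart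
      simp only [Tri.edge] at h1 h2
      rw [← h1, ← h2]
      abel)
  have hS : ∀ x y, (Tri.up x y).InTriangle n →
      C (x + 1) y = C x y + zeroPart (c ⟨x, y, .south⟩) 0 := fun x y h => (hC x y h.1 h.2.1 h.2.2).1
  have hNW : ∀ x y, (Tri.up x y).InTriangle n →
      C x (y + 1) = C x y + zeroPart (c ⟨x, y, .northwest⟩) 1 :=
    fun x y h => (hC x y h.1 h.2.1 h.2.2).2
  have hNE : ∀ x y, (Tri.up x y).InTriangle n →
      C x (y + 1) = C (x + 1) y + zeroPart (c ⟨x, y, .northeast⟩) 2 := by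
    intro x y h
    have h1 := (hc.fits (.up x y) h).zeroPart
    simp only [Tri.edge] at h1
    rw [hS x y h, hNW x y h, ← h1]
    abel
  have hneg : ∀ a : Fin 3, zeroPart a 3 = - zeroPart a 0 ∧ zeroPart a 4 = - zeroPart a 1 ∧
      zeroPart a 5 = - zeroPart a 2 := by decide
  refine ⟨fun v => C v.1 v.2, h0, ?_⟩
  rintro ⟨x, y⟩ k h
  fin_cases k <;> simp [spoke, nb, dir, Edge.InTriangle, Edge.upTri, ← sub_eq_add_neg] at h ⊢
  · exact hS x y h
  · exact hNW x y h
  · have := hNE (x - 1) y h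
    rwa [sub_add_cancel] at this
  · have := hS (x - 1) y h
    rw [sub_add_cancel] at this
    rw [(hneg _).1, this]; abel
  · have := hNW x (y - 1) h
    rw [sub_add_cancel] at this
    rw [(hneg _).2.1, this]; abel
  · have := hNE x (y - 1) h
    rw [sub_add_cancel] at this
    rw [(hneg _).2.2, this]; abel

/-- Deflations of labelings that agree on the boundary agree on the boundary. -/
theorem deflation_eq_of_boundary {c c' : Edge → Fin 3} {D D' : ℤ × ℤ → ℤ × ℤ}
    (h0 : D (0, 0) = 0) (h0' : D' (0, 0) = 0)
    (hD : ∀ v k, (spoke v k).InTriangle n → D (nb v k) = D v + zeroPart (c (spoke v k)) k)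
    (hD' : ∀ v k, (spoke v k).InTriangle n → D' (nb v k) = D' v + zeroPart (c' (spoke v k)) k)
    (hb : ∀ s i, c (boundaryEdge n s i) = c' (boundaryEdge n s i)) (v : ℤ × ℤ)
    (hv : 0 ≤ v.1 ∧ 0 ≤ v.2 ∧ v.1 + v.2 ≤ n) (hint : ¬ IsInterior n v) : D v = D' v := by
  have hW : ∀ m : ℕ, m ≤ n → D (0, m) = D' (0, m) := by
    intro m
    induction m with
    | zero => intro _; simpa using h0.trans h0'.symm
    | succ m ih =>
      intro hm
      have hT : (spoke (0, (m : ℤ)) 1).InTriangle n := by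
        simp [spoke, Edge.InTriangle, Edge.upTri, Tri.InTriangle]; omega
      have h1 := hD (0, m) 1 hT
      have h2 := hD' (0, m) 1 hT
      have h3 : c (spoke (0, (m : ℤ)) 1) = c' (spoke (0, (m : ℤ)) 1) := hb .northwest ⟨m, hm⟩
      have e : nb (0, (m : ℤ)) 1 = (0, ((m + 1 : ℕ) : ℤ)) := by simp [nb, dir]
      rw [e] at h1 h2
      rw [h1, h2, h3, ih (by omega)]
  have hS : ∀ m : ℕ, m ≤ n → D (m, 0) = D' (m, 0) := by
    intro m
    induction m with
    | zero => intro _; simpa using h0.trans h0'.symm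
    | succ m ih =>
      intro hm
      have hT : (spoke ((m : ℤ), 0) 0).InTriangle n := by
        simp [spoke, Edge.InTriangle, Edge.upTri, Tri.InTriangle]; omega
      have h1 := hD (m, 0) 0 hT
      have h2 := hD' (m, 0) 0 hT
      have h3 : c (spoke ((m : ℤ), 0) 0) = c' (spoke ((m : ℤ), 0) 0) := by
        have := hb .south ⟨n - 1 - m, by omega⟩
        simp only [boundaryEdge] at this
        rw [show (n : ℤ) - 1 - ((n - 1 - m : ℕ) : ℤ) = m by omega] at this
        exact this
      have e : nb ((m : ℤ), 0) 0 = (((m + 1 : ℕ) : ℤ), 0) := by simp [nb, dir]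
      rw [e] at h1 h2
      rw [h1, h2, h3, ih (by omega)]
  have hE : ∀ m : ℕ, m ≤ n → D (m, n - m) = D' (m, n - m) := by
    intro m
    induction m with
    | zero => intro _; simpa using hW n le_rfl
    | succ m ih =>
      intro hm
      have e0 : spoke ((m : ℤ), (n : ℤ) - m) 5 = boundaryEdge n .northeast ⟨m, hm⟩ := by
        simp [spoke, boundaryEdge]; ring
      have hT : (spoke ((m : ℤ), (n : ℤ) - m) 5).InTriangle n := by
        rw [e0]; exact inTriangle_boundaryEdge _ _ _
      have h1 := hD (m, n - m) 5 hT
      have h2 := hD' (m, n - m) 5 hT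
      have h3 : c (spoke ((m : ℤ), (n : ℤ) - m) 5) = c' (spoke ((m : ℤ), (n : ℤ) - m) 5) := by
        rw [e0, hb]
      have e : nb ((m : ℤ), (n : ℤ) - m) 5 = (((m + 1 : ℕ) : ℤ), (n : ℤ) - ((m + 1 : ℕ) : ℤ)) := by
        simp [nb, dir]; ring
      rw [e] at h1 h2
      rw [h1, h2, h3, ih (by omega)]
  obtain ⟨x, y⟩ := v
  obtain ⟨hx, hy, hxy⟩ := hv
  simp only [IsInterior] at *
  by_cases hx0 : x = 0
  · subst hx0
    have := hW y.toNat (by omega)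
    rwa [Int.toNat_of_nonneg hy] at this
  by_cases hy0 : y = 0
  · subst hy0
    have := hS x.toNat (by omega)
    rwa [Int.toNat_of_nonneg hx] at this
  have := hE x.toNat (by omega)
  rw [Int.toNat_of_nonneg hx] at this
  rwa [show (n : ℤ) - x = y by omega] at this

/-- A labeled edge keeps its direction or vanishes, while a diagonal turns clockwise to the
direction `k + 5`. The determinant therefore detects diagonals, with a fixed sign. -/
theorem det_zeroPart : ∀ (a : Fin 3) (k : Fin 6),
    det k (zeroPart a k) = if a = 2 then -1 else 0 := by
  decide

/-- If a puzzle has no gentle loops, then the rhombi of another puzzle with the same boundary do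
not cross its region edges. -/
theorem label_ne_two_of_isRegionEdge (hP : ¬ P.HasGentleLoop) {Q : Puzzle n}
    (hPQ : P.SameBoundary Q) {v : ℤ × ℤ} {k : Fin 6} (h : P.IsRegionEdge (arrowOf v k)) :
    Q.label (spoke v k) ≠ 2 := by
  obtain ⟨N, N0, Npos, Nrec⟩ := exists_path_weight P hP
  obtain ⟨D, hD0, hD⟩ := exists_deflation P.isLabeling
  obtain ⟨D', hD0', hD'⟩ := exists_deflation Q.isLabeling
  -- The deflations depend on the boundary labels alone along the boundary, so their difference
  -- vanishes there.
  have hsum := sum_path_weight P N0 Nrec (fun v => D' v - D v) (by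
    intro v k hi hv
    refine sub_eq_zero.2 (deflation_eq_of_boundary hD0 hD0' hD hD'
      (fun s i => hPQ.label_eq s i) v ?_ hv).symm
    have := hi.inTriangle
    clear hv
    obtain ⟨x, y⟩ := v
    fin_cases k <;> simp [spoke, Edge.InTriangle, Edge.upTri, Tri.InTriangle] at this ⊢ <;> omega)
  have hPlab : ∀ v k, P.IsRegionEdge (arrowOf v k) → P.label (spoke v k) ≠ 2 := by
    intro v k hr h2
    have hi := isInner_of_isRegionEdge P hr
    have ha := adj_spokes P hi
    rw [isRegionEdge_iff P hi] at hr
    revert ha hr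
    rw [show P.label (spoke v k) = 2 from h2]
    generalize P.label _ = a
    generalize P.label _ = b
    revert a b
    decide
  -- Region edges of `P` are never diagonals of `P`, so each term is minus the weight if the edge is
  -- a diagonal of `Q`, and zero otherwise. All terms have one sign and must vanish.
  have hterm : ∀ v k, N v k * ((det k (D' (nb v k) - D (nb v k)) : ℝ) - det k (D' v - D v)) =
      - (N v k * if Q.label (spoke v k) = 2 then 1 else 0) := by
    intro v k
    by_cases hr : P.IsRegionEdge (arrowOf v k)
    · have hi := (isInner_of_isRegionEdge P hr).inTriangle
      rw [← mul_neg]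
      congr 1
      have hz : det k (D' (nb v k) - D (nb v k)) - det k (D' v - D v) =
          - if Q.label (spoke v k) = 2 then 1 else 0 := by
        rw [← det_sub, hD v k hi, hD' v k hi,
          show D' v + zeroPart (Q.label (spoke v k)) k - (D v + zeroPart (P.label (spoke v k)) k)
            - (D' v - D v) = zeroPart (Q.label (spoke v k)) k - zeroPart (P.label (spoke v k)) k
            by abel, det_sub, det_zeroPart, det_zeroPart, if_neg (hPlab v k hr)]
        split_ifs <;> rfl
      have := congrArg (Int.cast : ℤ → ℝ) hz
      push_cast at this
      rw [this]
    · rw [N0 _ _ hr]; simp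
  simp only [hterm, Finset.sum_neg_distrib, neg_eq_zero] at hsum
  have hNnn : ∀ v k, 0 ≤ N v k * if Q.label (spoke v k) = 2 then (1 : ℝ) else 0 := by
    intro v k
    refine mul_nonneg ?_ (by split_ifs <;> norm_num)
    by_cases hr : P.IsRegionEdge (arrowOf v k)
    · exact (Npos v k hr).le
    · rw [N0 v k hr]
  rw [Finset.sum_eq_zero_iff_of_nonneg
    (fun k _ => Finset.sum_nonneg fun v _ => hNnn v k)] at hsum
  have h1 := hsum k (Finset.mem_univ k)
  rw [Finset.sum_eq_zero_iff_of_nonneg (fun v _ => hNnn v k)] at h1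
  have h2 := h1 v (mem_Icc_of_isRegionEdge P h).1
  intro h3
  rw [if_pos h3, mul_one] at h2
  exact (Npos v k h).ne' h2

/-! ## The overlay of the two deflations -/

/-- The invariant bilinear form. -/
def bform (u v : ℤ × ℤ) : ℤ := 2 * u.1 * v.1 + u.1 * v.2 + u.2 * v.1 + 2 * u.2 * v.2

/-- The deflation is affine on the two triangles at an edge unless that edge is a region edge. -/
theorem overlay_local : ∀ (r a l : Fin 3) (k : Fin 6), Adj r a → Adj a l →
    zeroPart l (k + 1) + zeroPart r (k + 5) = zeroPart a k ∨ Leaves r a l ∨ Enters r a l := by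
  decide

/-- The length of an edge in the overlay hive, up to the base point: one quadratic contribution from
the `0`-parts and one from the complementary `1`-parts. -/
theorem overlay_value : ∀ (r a l : Fin 3) (k : Fin 6), Adj r a → Adj a l → ¬ Leaves r a l →
    ¬ Enters r a l →
    0 ≤ bform (zeroPart l (k + 1)) (zeroPart l (k + 1)) +
      bform (zeroPart r (k + 5)) (zeroPart r (k + 5)) - bform (zeroPart a k) (zeroPart a k) +
      (bform (dir (k + 1) - zeroPart l (k + 1)) (dir (k + 1) - zeroPart l (k + 1)) +
      bform (dir (k + 5) - zeroPart r (k + 5)) (dir (k + 5) - zeroPart r (k + 5)) -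
      bform (dir k - zeroPart a k) (dir k - zeroPart a k)) ∧
    (bform (zeroPart l (k + 1)) (zeroPart l (k + 1)) +
      bform (zeroPart r (k + 5)) (zeroPart r (k + 5)) - bform (zeroPart a k) (zeroPart a k) +
      (bform (dir (k + 1) - zeroPart l (k + 1)) (dir (k + 1) - zeroPart l (k + 1)) +
      bform (dir (k + 5) - zeroPart r (k + 5)) (dir (k + 5) - zeroPart r (k + 5)) -
      bform (dir k - zeroPart a k) (dir k - zeroPart a k)) = 0 ↔ a = 2) := by
  decide

theorem dir_add_one_add_five : ∀ k, dir (k + 1) + dir (k + 5) = dir k := by decide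

/-- The hive of the overlay of the two deflations of a puzzle. -/
theorem exists_overlay : ∃ H : ℤ × ℤ → ℝ, ∀ v k, (spoke v k).IsInner n →
    ¬ P.IsRegionEdge (arrowOf v k) → ¬ P.IsRegionEdge (arrowOf (nb v k) (k + 3)) →
    0 ≤ hlen (spoke v k) H ∧ (hlen (spoke v k) H = 0 ↔ P.label (spoke v k) = 2) := by
  obtain ⟨D, -, hD⟩ := exists_deflation P.isLabeling
  refine ⟨fun v => ((bform (D v) (D v) + bform (v - D v) (v - D v) : ℤ) : ℝ),
    fun v k hi h1 h2 => ?_⟩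
  rw [isRegionEdge_iff P hi] at h1
  rw [isRegionEdge_nb_iff P hi] at h2
  obtain ⟨a2, a1⟩ := adj_spokes P hi
  obtain ⟨hl, hr⟩ := sector_inTriangle hi
  have tl : (spoke v (k + 1)).InTriangle n := by rw [← sector_edge_next]; exact hl.edge _
  have tr : (spoke v (k + 5)).InTriangle n := by rw [← sector_edge]; exact hr.edge _
  have hx := ((overlay_local _ _ _ k a1 a2).resolve_right (by tauto))
  have hval := overlay_value _ _ _ k a1 a2 h1 h2
  have hdir := dir_add_one_add_five k
  rw [hlen_spoke]
  simp only [hD v k hi.inTriangle, hD v (k + 1) tl, hD v (k + 5) tr]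
  generalize P.label (spoke v k) = a at *
  generalize P.label (spoke v (k + 1)) = l at *
  generalize P.label (spoke v (k + 5)) = r at *
  simp only [nb]
  generalize zeroPart a k = A at *
  generalize zeroPart l (k + 1) = B at *
  generalize zeroPart r (k + 5) = C at *
  generalize dir (k + 1) = d1 at *
  generalize dir (k + 5) = d5 at *
  generalize D v = d at *
  generalize dir k = d0 at *
  subst hx hdir
  -- Because both deflations are affine here, the terms linear in `d` and `v` cancel and only the
  -- local constant of `overlay_value` remains.
  have key : bform (d + B) (d + B) + bform (v + d1 - (d + B)) (v + d1 - (d + B)) +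
      (bform (d + C) (d + C) + bform (v + d5 - (d + C)) (v + d5 - (d + C))) -
      (bform d d + bform (v - d) (v - d)) -
      (bform (d + (B + C)) (d + (B + C)) +
        bform (v + (d1 + d5) - (d + (B + C))) (v + (d1 + d5) - (d + (B + C)))) =
      bform B B + bform C C - bform (B + C) (B + C) +
      (bform (d1 - B) (d1 - B) + bform (d5 - C) (d5 - C) -
        bform (d1 + d5 - (B + C)) (d1 + d5 - (B + C))) := by
    simp only [bform, Prod.fst_add, Prod.snd_add, Prod.fst_sub, Prod.snd_sub]; ring
  rw [← key] at hval
  constructor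
  · exact_mod_cast hval.1
  · rw [← hval.2]
    norm_cast

/-- Puzzles without gentle loops are rigid. -/
theorem Puzzle.isRigid_of_not_hasGentleLoop (hP : ¬ P.HasGentleLoop) : P.IsRigid := by
  intro Q hPQ
  obtain ⟨H, hH⟩ := exists_overlay P
  have hnotreg : ∀ v k, Q.label (spoke v k) = 2 → ¬ P.IsRegionEdge (arrowOf v k) ∧
      ¬ P.IsRegionEdge (arrowOf (nb v k) (k + 3)) := by
    intro v k h2
    refine ⟨fun h => label_ne_two_of_isRegionEdge P hP hPQ h h2, fun h => ?_⟩
    refine label_ne_two_of_isRegionEdge P hP hPQ h ?_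
    rwa [spoke_nb]
  -- The crossing lemma applied to `P` itself.
  have hPreg : ∀ v k, P.label (spoke v k) = 2 → ¬ P.IsRegionEdge (arrowOf v k) ∧
      ¬ P.IsRegionEdge (arrowOf (nb v k) (k + 3)) := by
    intro v k h2
    have hPP : P.SameBoundary P := fun _ _ _ => Iff.rfl
    refine ⟨fun h => label_ne_two_of_isRegionEdge P hP hPP h h2, fun h => ?_⟩
    refine label_ne_two_of_isRegionEdge P hP hPP h ?_
    rwa [spoke_nb]
  have hQ2 : ∀ e : Edge, e.InTriangle n → Q.label e = 2 → P.label e = 2 := by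
    intro e he h2
    have hκ : ∀ t : Tri, t.InTriangle n → ∑ s, incr H (t.edge s) = 0 := fun t _ => sum_incr H t
    -- The diagonals of `P` are flat in the overlay, so the common boundary functional is zero. The
    -- diagonals of `Q` avoid the region edges, so their lengths are nonnegative and must vanish
    -- too.
    have h0 : ∑ s, ∑ i, (if P.label (boundaryEdge n s i) = 0 then
        incr H (boundaryEdge n s i) else 0) = 0 := by
      rw [P.isLabeling.sum_boundary hκ]
      refine Finset.sum_eq_zero fun p hp => Finset.sum_eq_zero fun s _ => ?_
      split_ifs with h
      · obtain ⟨v, k, hvk⟩ := exists_spoke ((Tri.down p.1 p.2).edge s)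
        have hi := isInner_down_edge hp s
        rw [hvk] at h hi ⊢
        obtain ⟨g1, g2⟩ := hPreg v k h
        exact (hH v k hi g1 g2).2.2 h
      · rfl
    have hl : ∀ e : Edge, e.IsInner n → Q.label e = 2 →
        0 ≤ hlen e H ∧ (hlen e H = 0 ↔ P.label e = 2) := by
      intro e hi h
      obtain ⟨v, k, rfl⟩ := exists_spoke e
      obtain ⟨g1, g2⟩ := hnotreg v k h
      exact hH v k hi g1 g2
    have := len_eq_zero_of_sum_boundary Q.isLabeling hκ (fun e hi h => (hl e hi h).1)
      ((SameBoundary.sum_boundary_eq hPQ).trans h0) he h2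
    exact (hl e (Q.isLabeling.isInner he h2) h2).2.1 this
  refine Puzzle.ext_of_label fun e he => ?_
  refine labeling_eq_of_matching (Z := fun e => e.InTriangle n ∧ P.label e = 2) Q.isLabeling
    P.isLabeling ?_ (fun e h => P.isLabeling.isInner h.1 h.2) (fun e he h => ⟨he, hQ2 e he h⟩)
    (fun e he h => ⟨he, h⟩) (fun i => (hPQ.label_eq _ i).symm) e he
  rintro t ht r s ⟨-, hr⟩ ⟨-, hs⟩
  have := (P.isLabeling.fits t ht).of_eq_two hr
  rcases Side.eq_or r s with rfl | rfl | rfl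
  · rfl
  · rw [this.1] at hs; exact absurd hs (by decide)
  · rw [this.2] at hs; exact absurd hs (by decide)

end Weights
end HoneycombPuzzle

theorem mainTheorem4 (n : ℕ) :
    (∀ P : HoneycombPuzzle.Puzzle n, ¬ P.HasGentleLoop → P.IsRigid) ∧
    (∀ lam mu nu : Fin n → ℝ,
      (lam, mu, nu) ∈ HoneycombPuzzle.LR n ↔
        Antitone lam ∧ Antitone mu ∧ Antitone nu ∧
        (∑ i, lam i) + (∑ i, mu i) + (∑ i, nu i) = 0 ∧
        ∀ P : HoneycombPuzzle.Puzzle n, P.IsRigid → 0 ≤ P.functional lam mu nu) := by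
  refine ⟨fun P hP => P.isRigid_of_not_hasGentleLoop hP, fun lam mu nu => ⟨fun h => ?_, ?_⟩⟩
  · obtain ⟨h1, h2, h3, h4, h5⟩ := HoneycombPuzzle.inequalities_of_mem_LR h
    exact ⟨h1, h2, h3, h4, fun P _ => h5 P⟩
  · rintro ⟨h1, h2, h3, h4, h5⟩
    exact HoneycombPuzzle.mem_LR_of_inequalities h1 h2 h3 h4 h5
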